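/- All Banach spaces are complex. For a Banach space $X$, $X^*$ denotes the Banach space of bounded conjugate-linear functionals on $X$, and adjoints are taken with respect to these duals. **System nodes.** Let $U,X,Y$ be Banach spaces. A *system node* $\Sigma(A,B,C,\mathbf G)$ on $(U,X,Y)$ consists of the generator $A:D(A)\subset X\to X$ of a $C_0$-semigroup $\mathbb T$ with growth bound $\omega(\mathbb T)\in[-\infty,\infty)$, operators $B\in\mathcal L(U,X_{-1})$ and $C\in\mathcal L(X_1,Y)$, and an analytic function $\mathbf G:\{z\in\mathbb C:\operatorname{Re}z>\omega(\mathbb T)\}\to\mathcal L(U,Y)$ with $$\mathbf G(\alpha)-\mathbf G(\gamma)=C\big[R(\alpha,A_{-1})-R(\gamma,A_{-1})\big]B\qquad(\operatorname{Re}\alpha,\operatorname{Re}\gamma>\omega(\mathbb T)).$$ Here $X_1$ is $D(A)$ with the norm $\|(\beta-A)x\|$, and $X_{-1}$ is the completion of $X$ in the norm $\|R(\beta,A)x\|$, where $R(\beta,A)=(\beta-A)^{-1}$ and $\operatorname{Re}\beta>\omega(\mathbb T)$; the operators $A_{-1}:X\to X_{-1}$, $R(\alpha,A_{-1}):X_{-1}\to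 X$ and $\mathbb T_{-1}(t):X_{-1}\to X_{-1}$ are the continuous extensions of $A$, $R(\alpha,A)$ and $\mathbb T(t)$. Put $$C\&D\begin{bmatrix}x\\u\end{bmatrix}=C\big[x-R(\beta,A_{-1})Bu\big]+\mathbf G(\beta)u\quad\text{on}\quad D(C\&D)=\Big\{\begin{bmatrix}x\\u\end{bmatrix}\in X\times U: A_{-1}x+Bu\in X\Big\}.$$ **Generalised solutions.** A *generalised distributional solution* is a triple $(u,x,y)$ with $u\in L^1_{\rm loc}([0,\infty),U)$, $x\in C([0,\infty),X_{-1})$ of the form $x(t)=\mathbb T(t)x_0+\int_0^t\mathbb T_{-1}(t-s)Bu(s)\,ds$ for some $x_0\in X$ and all $t\ge0$, and $y$ the $Y$-valued distribution $$y=\frac{d^2}{dt^2}\Big(C\&D\int_0^t(t-s)\begin{bmatrix}x(s)\\u(s)\end{bmatrix}ds\Big),\qquad t\ge0,$$ where functions on $[0,\infty)$ are regarded as distributions on $\mathbb R$ by extending them by zero. **Stability.** The system node is *$L^\infty$-BIBO stable* if there is $c>0$ such that every generalised distributional solution with $u\in L^\infty_{\rm loc}([0,\infty),U)$ and $x(0)=0$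 satisfies $y\in L^\infty_{\rm loc}([0,\infty),Y)$ and $\|y\|_{L^\infty([0,t],Y)}\le c\,\|u\|_{L^\infty([0,t],U)}$ for all $t>0$. It is *$L^1$-LILO stable* if there is $c>0$ such that every generalised distributional solution with $u\in L^1_{\rm loc}([0,\infty),U)$ and $x(0)=0$ satisfies $y\in L^1_{\rm loc}([0,\infty),Y)$ and $\|y\|_{L^1([0,t],Y)}\le c\,\|u\|_{L^1([0,t],U)}$ for all $t>0$. **Theorem.** Let $\Sigma(A,B,C,\mathbf G)$ be an $L^\infty$-BIBO stable system node on $(U,X,Y)$ such that the adjoint $A^*$ generates a $C_0$-semigroup on $X^*$. Then the dual system node $\Sigma\big(A^*,C^*,B^*,\overline{\mathbf G}(\overline{\,\cdot\,})\big)$ on $(Y^*,X^*,U^*)$ is $L^1$-LILO stable. Here $C^*\in\mathcal L(Y^*,(X^*)_{-1})$ and $B^*\in\mathcal L((X^*)_1,U^*)$ are the adjoints of $C$ and $B$ under the canonical identifications $(X_1)^*=(X^*)_{-1}$ and $(X_{-1})^*=(X^*)_1$, and $\overline{\mathbf G}(\overline z)$ stands for the adjoint operator $\mathbf G(\overline z)^*\in\mathcal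 L(Y^*,U^*)$. In particular, these data do form a system node. -/

import Mathlib

open MeasureTheory Set Filter Topology
open scoped NNReal ENNReal

noncomputable section

namespace LinSys

/-! ### Strongly continuous semigroups, generators, resolvents -/

section Semigroup

/-- A strongly continuous semigroup `(T t)_{t ≥ 0}` of bounded operators on `X`
(the values of `T` at negative times carry no information). -/
structure C0Semigroup (X : Type*) [NormedAddCommGroup X] [NormedSpace ℂ X] where
  T : ℝ → X →L[ℂ] X
  T_zero : T 0 = ContinuousLinearMap.id ℂ X
  T_add : ∀ s t : ℝ, 0 ≤ s → 0 ≤ t → T (s + t) = (T s).comp (T t)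
  strong_cont : ∀ x : X, Tendsto (fun t : ℝ => T t x) (𝓝[>] 0) (𝓝 x)

variable {X : Type*} [NormedAddCommGroup X] [NormedSpace ℂ X]

/-- The graph of the generator: all `(x, z)` with `z = lim_{t → 0+} (T t x - x) / t`. -/
def C0Semigroup.generatorGraph (T : C0Semigroup X) : Submodule ℂ (X × X) where
  carrier := {p | Tendsto (fun t : ℝ => ((t : ℂ)⁻¹) • (T.T t p.1 - p.1)) (𝓝[>] 0) (𝓝 p.2)}
  add_mem' := by
    intro a b ha hb
    simp only [mem_ofPred_eq] at ha hb ⊢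
    refine (ha.add hb).congr fun t => ?_
    simp only [Prod.fst_add, map_add, smul_sub, smul_add]
    abel
  zero_mem' := by simp
  smul_mem' := by
    intro c a ha
    simp only [mem_ofPred_eq] at ha ⊢
    refine (ha.const_smul c).congr fun t => ?_
    simp only [Prod.smul_fst, map_smul, smul_sub, smul_comm c]

/-- The infinitesimal generator of a strongly continuous semigroup. -/
def C0Semigroup.generator (T : C0Semigroup X) : X →ₗ.[ℂ] X :=
  T.generatorGraph.toLinearPMap

/-- The graph is single valued, so that `generator` is the operator with this graph. -/
theorem C0Semigroup.generator_graph (T : C0Semigroup X) :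
    T.generator.graph = T.generatorGraph := by
  refine Submodule.toLinearPMap_graph_eq _ fun p hp h0 => ?_
  have hp' : Tendsto (fun t : ℝ => ((t : ℂ)⁻¹) • (T.T t p.1 - p.1)) (𝓝[>] 0) (𝓝 p.2) := hp
  rw [h0] at hp'
  simp only [map_zero, sub_zero, smul_zero] at hp'
  exact tendsto_nhds_unique hp' tendsto_const_nhds

/-- The growth bound `ω(T)`, the infimum of all real `w` for which `‖T t‖ ≤ M e^{w t}` on
`[0, ∞)` for some `M`; it may be `-∞`. -/
def C0Semigroup.growthBound (T : C0Semigroup X) : EReal :=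
  sInf {w : EReal | ∃ r : ℝ, w = (r : EReal) ∧
    ∃ M : ℝ, ∀ t : ℝ, 0 ≤ t → ‖T.T t‖ ≤ M * Real.exp (r * t)}

/-- The open right half-plane of all `z` with `Re z > ω(T)`. -/
def C0Semigroup.halfPlane (T : C0Semigroup X) : Set ℂ :=
  {z | T.growthBound < (z.re : EReal)}

/-- `R` is the bounded two-sided inverse of `β - A : D(A) → X`. -/
structure IsResolvent (A : X →ₗ.[ℂ] X) (β : ℂ) (R : X →L[ℂ] X) : Prop where
  mem_domain : ∀ x : X, R x ∈ A.domain
  right_inv : ∀ x : X, β • R x - A ⟨R x, mem_domain x⟩ = x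
  left_inv : ∀ x : A.domain, R (β • (x : X) - A x) = x

open scoped Classical in
/-- The resolvent operator `R(β, A) = (β - A)⁻¹` (and `0` if `β` is not in the resolvent set). -/
def resolvent (A : X →ₗ.[ℂ] X) (β : ℂ) : X →L[ℂ] X :=
  if h : ∃ R, IsResolvent A β R then h.choose else 0

end Semigroup

/-! ### The spaces `X₁` and `X₋₁` -/

section Scale

variable {X : Type*} [NormedAddCommGroup X] [NormedSpace ℂ X]

/-- The space `X₁`: the domain of `A` with the norm `‖(β - A) x‖`. -/
def DomSpace (A : X →ₗ.[ℂ] X) (_β : ℂ) : Type _ := A.domain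

instance (A : X →ₗ.[ℂ] X) (β : ℂ) : AddCommGroup (DomSpace A β) :=
  inferInstanceAs (AddCommGroup A.domain)

instance (A : X →ₗ.[ℂ] X) (β : ℂ) : Module ℂ (DomSpace A β) :=
  inferInstanceAs (Module ℂ A.domain)

/-- The operator `β - A : D(A) → X`. -/
def DomSpace.shift (A : X →ₗ.[ℂ] X) (β : ℂ) : DomSpace A β →ₗ[ℂ] X :=
  β • A.domain.subtype - A.toFun

instance (A : X →ₗ.[ℂ] X) (β : ℂ) : SeminormedAddCommGroup (DomSpace A β) :=
  SeminormedAddCommGroup.induced (DomSpace A β) X (DomSpace.shift A β)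

instance (A : X →ₗ.[ℂ] X) (β : ℂ) : NormedSpace ℂ (DomSpace A β) :=
  NormedSpace.induced ℂ (DomSpace A β) X (DomSpace.shift A β)

/-- An element of `D(A)`, seen in `X₁`. -/
def DomSpace.mk {A : X →ₗ.[ℂ] X} (β : ℂ) (x : X) (h : x ∈ A.domain) : DomSpace A β :=
  (⟨x, h⟩ : A.domain)

/-- The inclusion `X₁ → X`. -/
def DomSpace.val {A : X →ₗ.[ℂ] X} {β : ℂ} : DomSpace A β →ₗ[ℂ] X := A.domain.subtype

/-- The space `X` with the norm `‖R(β, A) x‖`. -/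
def PreExtrap (_A : X →ₗ.[ℂ] X) (_β : ℂ) : Type _ := X

instance (A : X →ₗ.[ℂ] X) (β : ℂ) : AddCommGroup (PreExtrap A β) :=
  inferInstanceAs (AddCommGroup X)

instance (A : X →ₗ.[ℂ] X) (β : ℂ) : Module ℂ (PreExtrap A β) :=
  inferInstanceAs (Module ℂ X)

/-- `R(β, A)` as a map on `PreExtrap A β`. -/
def PreExtrap.res (A : X →ₗ.[ℂ] X) (β : ℂ) : PreExtrap A β →ₗ[ℂ] X :=
  (resolvent A β).toLinearMap

instance (A : X →ₗ.[ℂ] X) (β : ℂ) : SeminormedAddCommGroup (PreExtrap A β) :=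
  SeminormedAddCommGroup.induced (PreExtrap A β) X (PreExtrap.res A β)

instance (A : X →ₗ.[ℂ] X) (β : ℂ) : NormedSpace ℂ (PreExtrap A β) :=
  NormedSpace.induced ℂ (PreExtrap A β) X (PreExtrap.res A β)

/-- The extrapolation space `X₋₁`: the completion of `X` in the norm `‖R(β, A) x‖`. -/
abbrev Extrap (A : X →ₗ.[ℂ] X) (β : ℂ) : Type _ := UniformSpace.Completion (PreExtrap A β)

/-- The canonical dense embedding `X → X₋₁`. -/
def incl (A : X →ₗ.[ℂ] X) (β : ℂ) : X →ₗ[ℂ] Extrap A β where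
  toFun x := ((show PreExtrap A β from x : PreExtrap A β) : Extrap A β)
  map_add' x y := UniformSpace.Completion.coe_add (α := PreExtrap A β) x y
  map_smul' c x := UniformSpace.Completion.coe_smul (X := PreExtrap A β) c x

/-- `R(α, A₋₁) : X₋₁ → X`, the continuous extension of `R(α, A)`. -/
def resExt (A : X →ₗ.[ℂ] X) (β : ℂ) [CompleteSpace X] (α : ℂ) : Extrap A β →L[ℂ] X :=
  (resolvent A α).toLinearMap.extendOfNorm (incl A β)

/-- `A₋₁ : X → X₋₁`, the continuous extension of `A : D(A) → X`. -/
def genExt (A : X →ₗ.[ℂ] X) (β : ℂ) : X →L[ℂ] Extrap A β :=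
  ((incl A β).comp A.toFun).extendOfNorm A.domain.subtype

/-- `T₋₁(t) : X₋₁ → X₋₁`, the continuous extension of `T t`. -/
def C0Semigroup.ext (T : C0Semigroup X) (β : ℂ) (t : ℝ) :
    Extrap T.generator β →L[ℂ] Extrap T.generator β :=
  ((incl T.generator β).comp (T.T t).toLinearMap).extendOfNorm (incl T.generator β)

end Scale

/-! ### Duality -/

section Dual

variable {X : Type*} [NormedAddCommGroup X] [NormedSpace ℂ X]

/-- The Banach space dual `X*`, realised as the space of bounded conjugate-linear functionals.
(With this convention adjoints of operators depend conjugate-linearly on the operator, and for a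
Hilbert space `X* = X`.) -/
abbrev AntiDual (X : Type*) [NormedAddCommGroup X] [NormedSpace ℂ X] : Type _ := X →L⋆[ℂ] ℂ

/-- The graph of the adjoint: all `(x*, z*)` with `z*(x) = x*(A x)` for all `x ∈ D(A)`. -/
def adjointGraph (A : X →ₗ.[ℂ] X) : Submodule ℂ (AntiDual X × AntiDual X) where
  carrier := {p | ∀ x : A.domain, p.2 (x : X) = p.1 (A x)}
  add_mem' := by
    intro a b ha hb x
    simp [ha x, hb x]
  zero_mem' := by simp
  smul_mem' := by
    intro c a ha x
    simp [ha x]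

/-- The Banach space adjoint `A*` of a densely defined operator `A`. -/
def adjoint (A : X →ₗ.[ℂ] X) : AntiDual X →ₗ.[ℂ] AntiDual X :=
  (adjointGraph A).toLinearPMap

/-- For densely defined `A` the graph is single valued. -/
theorem adjoint_graph (A : X →ₗ.[ℂ] X) (hA : Dense (A.domain : Set X)) :
    (adjoint A).graph = adjointGraph A := by
  refine Submodule.toLinearPMap_graph_eq _ fun p hp h0 => ?_
  have hp' : ∀ x : A.domain, p.2 (x : X) = p.1 (A x) := hp
  have h : (p.2 : X → ℂ) = fun _ => 0 :=
    Continuous.ext_on hA p.2.continuous continuous_const fun x hx => by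
      have := hp' ⟨x, hx⟩
      rw [h0] at this
      simpa using this
  ext x
  exact congrFun h x

/-- The continuous extension to `X₋₁` of a functional `f` on `X` (it exists if `f ∈ D(A*)`). -/
def functionalExt (A : X →ₗ.[ℂ] X) (β : ℂ) (f : AntiDual X) : Extrap A β →L⋆[ℂ] ℂ :=
  f.toLinearMap.extendOfNorm (incl A β)

/-- For `x` in `X`, the evaluation `x* ↦ x*(x)`. -/
def evalAt (x : X) : AntiDual X →ₗ[ℂ] ℂ where
  toFun f := f x
  map_add' _ _ := rfl
  map_smul' _ _ := rfl

/-- The canonical pairing of `ζ ∈ (X*)₋₁` with `x` in `X`, i.e. the continuous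
extension of `x* ↦ x*(x)` to `(X*)₋₁` (it exists if `A'` is `A*` and `x ∈ D(A)`).
It identifies `(X*)₋₁` with `(X₁)*`. -/
def extrapEval (A' : AntiDual X →ₗ.[ℂ] AntiDual X) (β : ℂ) (x : X) : Extrap A' β →L[ℂ] ℂ :=
  (evalAt x).extendOfNorm (incl A' β)

end Dual

/-! ### System nodes -/

section Nodes

/-- A system node `Σ(A, B, C, G)` on Banach spaces `(U, X, Y)`. Here `A` is the generator of `T`,
`β` is the point used in the norms of `X₁` and `X₋₁`, and only the
values of `G` on the half-plane `Re z > ω(T)` matter. -/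
structure SystemNode (U X Y : Type*)
    [NormedAddCommGroup U] [NormedSpace ℂ U]
    [NormedAddCommGroup X] [NormedSpace ℂ X] [CompleteSpace X]
    [NormedAddCommGroup Y] [NormedSpace ℂ Y] where
  T : C0Semigroup X
  β : ℂ
  β_mem : β ∈ T.halfPlane
  B : U →L[ℂ] Extrap T.generator β
  C : DomSpace T.generator β →L[ℂ] Y
  G : ℂ → U →L[ℂ] Y
  analytic : AnalyticOnNhd ℂ G T.halfPlane
  G_sub : ∀ z ∈ T.halfPlane, ∀ w ∈ T.halfPlane, ∀ u : U,
    ∃ h : resExt T.generator β z (B u) - resExt T.generator β w (B u) ∈ T.generator.domain,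
      G z u - G w u = C (DomSpace.mk β _ h)

variable {U X Y : Type*}
  [NormedAddCommGroup U] [NormedSpace ℂ U]
  [NormedAddCommGroup X] [NormedSpace ℂ X] [CompleteSpace X]
  [NormedAddCommGroup Y] [NormedSpace ℂ Y]

namespace SystemNode

/-- The generator `A` of the system node. -/
abbrev A (S : SystemNode U X Y) : X →ₗ.[ℂ] X := S.T.generator

/-- The space `X₋₁` of the system node. -/
abbrev XExt (S : SystemNode U X Y) : Type _ := Extrap S.A S.β

/-- The domain of `C&D`: all `(x, u) ∈ X × U` with `A₋₁ x + B u ∈ X`. -/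
def cdDomain (S : SystemNode U X Y) : Set (X × U) :=
  {p | ∃ z : X, genExt S.A S.β p.1 + S.B p.2 = incl S.A S.β z}

open scoped Classical in
/-- The combined observation/feedthrough operator
`C&D (x, u) = C (x - R(β, A₋₁) B u) + G(β) u`, for `(x, u) ∈ cdDomain`
(where `x - R(β, A₋₁) B u` belongs to `D(A)`). -/
def cd (S : SystemNode U X Y) (p : X × U) : Y :=
  if h : p.1 - resExt S.A S.β S.β (S.B p.2) ∈ S.A.domain then
    S.C (DomSpace.mk S.β _ h) + S.G S.β p.2
  else 0

end SystemNode

/-- The space `L^p_loc([0, ∞), E)`. -/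
def MemLpLoc {E : Type*} [NormedAddCommGroup E] (p : ℝ≥0∞) (f : ℝ → E) : Prop :=
  ∀ t : ℝ, 0 < t → MemLp f p (volume.restrict (Icc 0 t))

/-- The norm of `L^p([0, t], E)`. -/
def lpNormOn {E : Type*} [NormedAddCommGroup E] (p : ℝ≥0∞) (f : ℝ → E) (t : ℝ) : ℝ≥0∞ :=
  eLpNorm f p (volume.restrict (Icc 0 t))

/-- `E`-valued distributions on the real line. -/
abbrev Distr (E : Type*) [NormedAddCommGroup E] [NormedSpace ℂ E] : Type _ :=
  Distribution (⊤ : TopologicalSpace.Opens ℝ) E ⊤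

/-- The distribution given by a locally integrable function `f` on `[0, ∞)`, extended by zero to
the real line: `φ ↦ ∫_0^∞ φ(t) f(t) dt`. -/
def distrOf {E : Type*} [NormedAddCommGroup E] [NormedSpace ℂ E] (f : ℝ → E) : Distr E :=
  ContinuousLinearMap.toUniformConvergenceCLM (RingHom.id ℝ) E
    {K : Set (TestFunction (⊤ : TopologicalSpace.Opens ℝ) ℝ ⊤) | IsCompact K}
    (TestFunction.integralAgainstBilinCLM (ContinuousLinearMap.lsmul ℝ ℝ) volume
      ((Ici (0 : ℝ)).indicator f))

/-- Generalised solutions `(u, x, y)` in the distributional sense of a system node. The function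
`K` below is `∫_0^t (t - s) x(s) ds`, which takes values in `X`. -/
structure IsGeneralisedSolution (S : SystemNode U X Y)
    (u : ℝ → U) (x : ℝ → S.XExt) (y : Distr Y) : Prop where
  input : MemLpLoc 1 u
  cont : ContinuousOn x (Ici 0)
  state : ∃ x₀ : X, ∀ t : ℝ, 0 ≤ t →
    x t = S.T.ext S.β t (incl S.A S.β x₀) + ∫ s in (0 : ℝ)..t, S.T.ext S.β (t - s) (S.B (u s))
  output : ∃ K : ℝ → X,
    (∀ t : ℝ, 0 ≤ t → incl S.A S.β (K t) = ∫ s in (0 : ℝ)..t, ((t - s : ℝ) : ℂ) • x s) ∧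
    (∀ t : ℝ, 0 ≤ t → (K t, ∫ s in (0 : ℝ)..t, ((t - s : ℝ) : ℂ) • u s) ∈ S.cdDomain) ∧
    y = LineDeriv.lineDerivOp (1 : ℝ) (LineDeriv.lineDerivOp (1 : ℝ)
      (distrOf fun t => S.cd (K t, ∫ s in (0 : ℝ)..t, ((t - s : ℝ) : ℂ) • u s)))

/-- `L^p`-to-`L^p` input-output stability in terms of generalised solutions. -/
def IOStable (p : ℝ≥0∞) (S : SystemNode U X Y) : Prop :=
  ∃ c : ℝ≥0, 0 < c ∧ ∀ (u : ℝ → U) (x : ℝ → S.XExt) (y : Distr Y),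
    IsGeneralisedSolution S u x y → MemLpLoc p u → x 0 = 0 →
      ∃ f : ℝ → Y, MemLpLoc p f ∧ y = distrOf f ∧
        ∀ t : ℝ, 0 < t → lpNormOn p f t ≤ c * lpNormOn p u t

/-- `L^∞`-BIBO stability. -/
def LinftyBIBOStable (S : SystemNode U X Y) : Prop := IOStable ∞ S

/-- `L^1`-LILO stability. -/
def L1LILOStable (S : SystemNode U X Y) : Prop := IOStable 1 S

/-- `Sd` is the dual system node `Σ(A*, C*, B*, G(conj ·)*)` of `S`, where `C*` takes values in
`(X₁)* = (X*)₋₁` and `B*` is defined on `(X*)₁ = D(A*) = (X₋₁)*`. -/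
structure IsDualNode (S : SystemNode U X Y)
    (Sd : SystemNode (AntiDual Y) (AntiDual X) (AntiDual U)) : Prop where
  generator_eq : Sd.A = adjoint S.A
  input_eq : ∀ (v : AntiDual Y) (x : DomSpace S.A S.β),
    extrapEval Sd.A Sd.β x.val (Sd.B v) = v (S.C x)
  output_eq : ∀ (f : DomSpace Sd.A Sd.β) (u : U),
    Sd.C f u = functionalExt S.A S.β f.val (S.B u)
  transfer_eq : ∀ z ∈ Sd.T.halfPlane, ∀ (v : AntiDual Y) (u : U),
    Sd.G z v u = v (S.G (starRingEnd ℂ z) u)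

end Nodes

end LinSys

end

open MeasureTheory Set Filter Topology
open scoped NNReal ENNReal ContDiff

noncomputable section

namespace LinSys

/-! ### Strongly continuous families of operators -/

section StrongCont

variable {X Z W : Type*} [NormedAddCommGroup X] [NormedSpace ℂ X]
  [NormedAddCommGroup Z] [NormedSpace ℂ Z] [NormedAddCommGroup W] [NormedSpace ℂ W]

/-! A system node need not have an impulse response that is a function or an operator-valued
measure, but its second antiderivative is harmless. For α in the half-plane put Φ(t) = C R(α, A)
P(t) R(α, A₋₁) B + t G(α) for t ≥ 0 and Φ(t) = 0 for t ≤ 0, where P(t) is the bounded operator on X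
that formally equals (α - A)(αJ₂(t) - J₁(t)), with J₁, J₂ the first and second time integrals of the
semigroup. This ramp response is strongly continuous, and every generalised solution with x(0) = 0
has output y = (Φ * u)'' (`IsGeneralisedSolution.output_eq`). Since A* generates the adjoint
semigroup, the ramp response of the dual node is Ψ(t) = Φ(t)*, with Φ formed at α = conj of the
reference point of the dual node (`IsDualNode.rampResponse_apply`).

Write Δ_ε for the second backward difference quotient. If (Φ * u)'' is bounded by c, then so is
Δ_ε(Φ * u) at every single time (`norm_secondDiff_le`). Evaluating at time N, with the input
reversed in time, gives ‖∫₀ᴺ (Δ_ε Φ)(s) u(s) ds‖ ≤ c for all strongly measurable u with values in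
the unit ball. Applying v ∈ Y* and taking the supremum over u turns this into ∫ ‖(Δ_ε Ψ)(s) v‖ ds ≤
c ‖v‖, uniformly in ε (`lintegral_enorm_secondDiff_rampResponse_le`). This is where L^∞ becomes L¹;
`lintegral_enorm_le_of_forall` is the duality behind it.

By Tonelli, convolution with Δ_ε Ψ maps L¹ to L¹ with norm at most c, for every ε. The function
Δ_{nε}(Ψ * v) is the mean of n² translates of Δ_ε(Ψ * v), and translations commute with convolution,
so continuity of translation in L¹ makes the quotients at the scales 2⁻ᵏ a Cauchy sequence
(`exists_tendsto_secondDiff_conv`). Its limit is the second distributional derivative of Ψ * v, with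
norm at most c ‖v‖₁. Causality localises the statement to [0, t] and glues the limits for truncated
inputs (`exists_deriv2_conv`). The constant c does not change. -/

/-- Joint continuity of `(t, x) ↦ Q t x`. -/
def StrongCont (Q : ℝ → X →L[ℂ] Z) : Prop := Continuous fun p : ℝ × X => Q p.1 p.2

theorem StrongCont.continuous_apply {Q : ℝ → X →L[ℂ] Z} (hQ : StrongCont Q) (x : X) :
    Continuous fun t => Q t x :=
  hQ.comp (continuous_id.prodMk continuous_const)

theorem StrongCont.comp_continuous {Q : ℝ → X →L[ℂ] Z} (hQ : StrongCont Q) {Ω : Type*}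
    [TopologicalSpace Ω] {f : Ω → ℝ} {g : Ω → X} (hf : Continuous f) (hg : Continuous g) :
    Continuous fun a => Q (f a) (g a) :=
  Continuous.comp (g := fun p : ℝ × X => Q p.1 p.2) hQ (hf.prodMk hg)

theorem StrongCont.exists_bound [CompleteSpace X] {Q : ℝ → X →L[ℂ] Z} (hQ : StrongCont Q)
    (a b : ℝ) : ∃ M, 0 ≤ M ∧ ∀ t ∈ Icc a b, ‖Q t‖ ≤ M := by
  obtain ⟨C, hC⟩ := banach_steinhaus (g := fun t : Icc a b => Q t) (fun x => by
    obtain ⟨C, hC⟩ := isCompact_Icc.exists_bound_of_continuousOn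
      (hQ.continuous_apply x).continuousOn (s := Icc a b)
    exact ⟨C, fun t => hC t t.2⟩)
  exact ⟨max C 0, le_max_right _ _, fun t ht => (hC ⟨t, ht⟩).trans (le_max_left _ _)⟩

theorem strongCont_of_bound {Q : ℝ → X →L[ℂ] Z} (hQ : ∀ x, Continuous fun t => Q t x)
    (hb : ∀ a, ∃ M, ∀ t, |t| ≤ a → ‖Q t‖ ≤ M) : StrongCont Q := by
  refine continuous_iff_continuousAt.2 fun ⟨t₀, x₀⟩ => ?_
  obtain ⟨M, hM⟩ := hb (|t₀| + 1)
  have h1 : Tendsto (fun p : ℝ × X => M * ‖p.2 - x₀‖ + ‖Q p.1 x₀ - Q t₀ x₀‖)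
      (𝓝 (t₀, x₀)) (𝓝 0) := by
    have hc : Continuous (fun p : ℝ × X => M * ‖p.2 - x₀‖ + ‖Q p.1 x₀ - Q t₀ x₀‖) :=
      (continuous_const.mul ((continuous_snd.sub continuous_const).norm)).add
        ((((hQ x₀).comp continuous_fst).sub continuous_const).norm)
    simpa using hc.tendsto (t₀, x₀)
  refine tendsto_iff_norm_sub_tendsto_zero.2 (squeeze_zero' (.of_forall fun _ => norm_nonneg _)
    ?_ h1)
  have hev : ∀ᶠ p : ℝ × X in 𝓝 (t₀, x₀), |p.1| < |t₀| + 1 :=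
    (continuous_fst.abs.tendsto (t₀, x₀)).eventually_lt_const (by simp)
  filter_upwards [hev] with p hp
  calc ‖Q p.1 p.2 - Q t₀ x₀‖ = ‖Q p.1 (p.2 - x₀) + (Q p.1 x₀ - Q t₀ x₀)‖ := by
        simp
    _ ≤ ‖Q p.1 (p.2 - x₀)‖ + ‖Q p.1 x₀ - Q t₀ x₀‖ := norm_add_le _ _
    _ ≤ _ := by
        gcongr
        exact (Q p.1).le_of_opNorm_le (hM _ hp.le) _

theorem StrongCont.integrable_comp [CompleteSpace X] {Q : ℝ → X →L[ℂ] Z} (hQ : StrongCont Q)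
    {μ : Measure ℝ} {w : ℝ → X} (hw : Integrable w μ) {f : ℝ → ℝ} (hf : Measurable f)
    {a b : ℝ} (hab : ∀ᵐ r ∂μ, f r ∈ Icc a b) : Integrable (fun r => Q (f r) (w r)) μ := by
  obtain ⟨M, -, hM⟩ := hQ.exists_bound a b
  refine (hw.norm.const_mul M).mono' (Continuous.comp_aestronglyMeasurable
    (g := fun p : ℝ × X => Q p.1 p.2) hQ
    (hf.aestronglyMeasurable.prodMk hw.aestronglyMeasurable)) ?_
  filter_upwards [hab] with r hr using (Q (f r)).le_of_opNorm_le (hM _ hr) _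

theorem StrongCont.intervalIntegrable [CompleteSpace X] {Q : ℝ → X →L[ℂ] Z} (hQ : StrongCont Q)
    {w : ℝ → X} {t : ℝ} (hw : IntervalIntegrable w volume 0 t) (a : ℝ) :
    IntervalIntegrable (fun r => Q (a - r) (w r)) volume 0 t := by
  rw [intervalIntegrable_iff] at hw ⊢
  refine hQ.integrable_comp hw (measurable_const.sub measurable_id)
    (a := a - max 0 t) (b := a - min 0 t) ?_
  filter_upwards [ae_restrict_mem measurableSet_uIoc] with r hr
  rw [uIoc, mem_Ioc] at hr
  exact ⟨by linarith [hr.2], by linarith [hr.1]⟩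

theorem StrongCont.clm_comp {Q : ℝ → X →L[ℂ] Z} (hQ : StrongCont Q) (L : Z →L[ℂ] W) :
    StrongCont fun t => L.comp (Q t) :=
  L.continuous.comp hQ

theorem StrongCont.comp_clm {Q : ℝ → X →L[ℂ] Z} (hQ : StrongCont Q) (L : W →L[ℂ] X) :
    StrongCont fun t => (Q t).comp L :=
  hQ.comp_continuous continuous_fst (L.continuous.comp continuous_snd)

theorem StrongCont.comp_real {Q : ℝ → X →L[ℂ] Z} (hQ : StrongCont Q) {f : ℝ → ℝ}
    (hf : Continuous f) : StrongCont fun t => Q (f t) :=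
  hQ.comp_continuous (hf.comp continuous_fst) continuous_snd

theorem StrongCont.add {Q Q' : ℝ → X →L[ℂ] Z} (hQ : StrongCont Q) (hQ' : StrongCont Q') :
    StrongCont fun t => Q t + Q' t :=
  Continuous.add (f := fun p : ℝ × X => Q p.1 p.2) (g := fun p : ℝ × X => Q' p.1 p.2) hQ hQ'

theorem StrongCont.sub {Q Q' : ℝ → X →L[ℂ] Z} (hQ : StrongCont Q) (hQ' : StrongCont Q') :
    StrongCont fun t => Q t - Q' t :=
  Continuous.sub (f := fun p : ℝ × X => Q p.1 p.2) (g := fun p : ℝ × X => Q' p.1 p.2) hQ hQ'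

theorem StrongCont.smul {Q : ℝ → X →L[ℂ] Z} (hQ : StrongCont Q) {c : ℝ → ℂ}
    (hc : Continuous c) : StrongCont fun t => c t • Q t :=
  Continuous.smul (f := fun p : ℝ × X => c p.1) (g := fun p : ℝ × X => Q p.1 p.2)
    (hc.comp continuous_fst) hQ

theorem strongCont_const (L : X →L[ℂ] Z) : StrongCont fun _ => L :=
  L.continuous.comp continuous_snd

end StrongCont

/-! ### Semigroups -/

namespace C0Semigroup

variable {X : Type*} [NormedAddCommGroup X] [NormedSpace ℂ X] (T : C0Semigroup X)

/-- The semigroup, extended by the identity to negative times. -/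
def Tm (t : ℝ) : X →L[ℂ] X := T.T (max t 0)

theorem Tm_of_nonneg {t : ℝ} (ht : 0 ≤ t) : T.Tm t = T.T t := by rw [Tm, max_eq_left ht]

theorem tendsto_Ici (x : X) : Tendsto (fun t => T.T t x) (𝓝[≥] 0) (𝓝 x) := by
  have : Tendsto (fun t => T.T t x) (𝓝[insert 0 (Ioi 0)] 0) (𝓝 x) := by
    rw [nhdsWithin_insert, tendsto_sup]
    refine ⟨?_, T.strong_cont x⟩
    rw [tendsto_pure_left]
    intro s hs
    simpa [T.T_zero] using mem_of_mem_nhds hs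
  simpa using this

theorem norm_sub_le {a M : ℝ} (hM : ∀ t ∈ Icc 0 a, ‖T.T t‖ ≤ M) {s t : ℝ} (hs : s ∈ Icc 0 a)
    (ht : t ∈ Icc 0 a) (x : X) : ‖T.T t x - T.T s x‖ ≤ M * ‖T.T |t - s| x - x‖ := by
  wlog h : s ≤ t generalizing s t
  · rw [norm_sub_rev, abs_sub_comm]
    exact this ht hs (le_of_not_ge h)
  have := T.T_add s (t - s) hs.1 (sub_nonneg.2 h)
  rw [add_sub_cancel] at this
  rw [abs_of_nonneg (sub_nonneg.2 h), this, ContinuousLinearMap.comp_apply, ← map_sub]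
  exact (T.T s).le_of_opNorm_le (hM s hs) _

theorem mem_generator_iff {x z : X} :
    Tendsto (fun t : ℝ => ((t : ℂ)⁻¹) • (T.T t x - x)) (𝓝[>] 0) (𝓝 z) ↔
      ∃ h : x ∈ T.generator.domain, T.generator ⟨x, h⟩ = z := by
  have : (x, z) ∈ T.generator.graph ↔ _ := Iff.rfl
  rw [T.generator_graph] at this
  change (x, z) ∈ T.generatorGraph ↔ _
  rw [← T.generator_graph, LinearPMap.mem_graph_iff]
  constructor
  · rintro ⟨y, h1, h2⟩
    have h1 : (y : X) = x := h1
    refine ⟨h1 ▸ y.2, ?_⟩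
    refine Eq.trans ?_ h2
    congr 1
    exact Subtype.ext h1.symm
  · rintro ⟨h, h2⟩
    exact ⟨⟨x, h⟩, rfl, h2⟩

theorem tendsto_generator (x : T.generator.domain) :
    Tendsto (fun t : ℝ => ((t : ℂ)⁻¹) • (T.T t x - x)) (𝓝[>] 0) (𝓝 (T.generator x)) :=
  T.mem_generator_iff.2 ⟨x.2, rfl⟩

theorem T_mem_domain {t : ℝ} (ht : 0 ≤ t) (x : T.generator.domain) :
    ∃ h : T.T t x ∈ T.generator.domain, T.generator ⟨T.T t x, h⟩ = T.T t (T.generator x) := by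
  refine T.mem_generator_iff.1 ?_
  have := ((T.T t).continuous.tendsto _).comp (T.tendsto_generator x)
  refine this.congr' ?_
  filter_upwards [self_mem_nhdsWithin] with h hh
  have h1 := T.T_add t h ht (le_of_lt hh)
  have h2 := T.T_add h t (le_of_lt hh) ht
  rw [add_comm, h1] at h2
  have := congrArg (fun L => L (x : X)) h2
  simp only [ContinuousLinearMap.comp_apply] at this
  simp [this]

variable [CompleteSpace X]

/-- If the norms were unbounded near 0, some t_n → 0 would have ‖T(t_n)‖ > n, although every orbit
converges along t_n; this contradicts uniform boundedness. -/
theorem exists_bound_near : ∃ δ > 0, ∃ M, ∀ t ∈ Icc 0 δ, ‖T.T t‖ ≤ M := by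
  by_contra! h
  choose t ht hM using fun n : ℕ => h (1 / ((n : ℝ) + 1)) (by positivity) n
  have h0 : Tendsto t atTop (𝓝[≥] 0) := by
    refine tendsto_nhdsWithin_iff.2 ⟨squeeze_zero (fun n => (ht n).1) (fun n => (ht n).2)
      tendsto_one_div_add_atTop_nhds_zero_nat, .of_forall fun n => (ht n).1⟩
  obtain ⟨C, hC⟩ := banach_steinhaus (g := fun n => T.T (t n)) (fun x => by
    obtain ⟨C, hC⟩ := ((T.tendsto_Ici x).comp h0).norm.bddAbove_range
    exact ⟨C, fun n => hC ⟨n, rfl⟩⟩)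
  obtain ⟨n, hn⟩ := exists_nat_gt C
  exact absurd (hC n) (not_le.2 (hn.trans (hM n)))

theorem exists_bound (a : ℝ) : ∃ M, ∀ t ∈ Icc 0 a, ‖T.T t‖ ≤ M := by
  obtain ⟨δ, hδ, M, hM⟩ := T.exists_bound_near
  have key : ∀ n : ℕ, ∃ C, ∀ t ∈ Icc 0 (n * δ), ‖T.T t‖ ≤ C := by
    intro n
    induction n with
    | zero =>
      refine ⟨M, fun t ht => hM t ⟨ht.1, ht.2.trans ?_⟩⟩
      simp [hδ.le]
    | succ n ih =>
      obtain ⟨C, hC⟩ := ih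
      have hM0 : 0 ≤ M := (norm_nonneg _).trans (hM 0 ⟨le_rfl, hδ.le⟩)
      refine ⟨max M (M * C), fun t ht => ?_⟩
      rcases le_total t δ with h | h
      · exact (hM t ⟨ht.1, h⟩).trans (le_max_left _ _)
      · have h1 : 0 ≤ t - δ := by linarith
        have h2 : t - δ ≤ n * δ := by
          have := ht.2
          push_cast at this
          linarith
        have := T.T_add δ (t - δ) hδ.le h1
        rw [add_sub_cancel] at this
        rw [this]
        refine (ContinuousLinearMap.opNorm_comp_le _ _).trans (le_trans ?_ (le_max_right _ _))
        exact mul_le_mul (hM δ ⟨hδ.le, le_rfl⟩) (hC _ ⟨h1, h2⟩) (norm_nonneg _) hM0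
  obtain ⟨n, hn⟩ := exists_nat_ge (a / δ)
  obtain ⟨C, hC⟩ := key n
  exact ⟨C, fun t ht => hC t ⟨ht.1, ht.2.trans ((div_le_iff₀ hδ).1 hn)⟩⟩

theorem continuous_Tm (x : X) : Continuous fun t => T.Tm t x := by
  refine continuous_iff_continuousAt.2 fun t₀ => ?_
  obtain ⟨M, hM⟩ := T.exists_bound (max (t₀ + 1) 0)
  have h1 : Tendsto (fun t : ℝ => |max t 0 - max t₀ 0|) (𝓝 t₀) (𝓝[≥] 0) := by
    refine tendsto_nhdsWithin_iff.2 ⟨?_, Eventually.of_forall fun n => mem_Ici.2 (abs_nonneg _)⟩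
    have : Continuous fun t : ℝ => |max t 0 - max t₀ 0| := by fun_prop
    simpa using this.tendsto t₀
  have h2 : Tendsto (fun t : ℝ => M * ‖T.T |max t 0 - max t₀ 0| x - x‖) (𝓝 t₀) (𝓝 0) := by
    have := ((((T.tendsto_Ici x).comp h1).sub_const x).norm).const_mul M
    simpa using this
  refine tendsto_iff_norm_sub_tendsto_zero.2 (squeeze_zero' (.of_forall fun _ => norm_nonneg _)
    ?_ h2)
  filter_upwards [eventually_lt_nhds (show t₀ < t₀ + 1 by linarith)] with t ht
  exact T.norm_sub_le hM ⟨le_max_right _ _, max_le_max (by linarith) le_rfl⟩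
    ⟨le_max_right _ _, max_le_max ht.le le_rfl⟩ x

theorem strongCont : StrongCont T.Tm := by
  refine strongCont_of_bound T.continuous_Tm fun a => ?_
  obtain ⟨M, hM⟩ := T.exists_bound (max a 0)
  exact ⟨M, fun t ht => hM _ ⟨le_max_right _ _, max_le_max ((le_abs_self t).trans ht) le_rfl⟩⟩

/-- `∫_0^t T(s) x ds`. -/
def J1 (t : ℝ) : X →L[ℂ] X where
  toFun x := ∫ s in (0 : ℝ)..t, T.Tm s x
  map_add' x y := by
    simp only [map_add]
    exact intervalIntegral.integral_add ((T.continuous_Tm x).intervalIntegrable _ _)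
      ((T.continuous_Tm y).intervalIntegrable _ _)
  map_smul' c x := by
    simp only [map_smul, RingHom.id_apply]
    exact intervalIntegral.integral_smul c _
  cont := intervalIntegral.continuous_parametric_intervalIntegral_of_continuous'
    (T.strongCont.comp_continuous continuous_snd continuous_fst) _ _

theorem continuous_weighted (t : ℝ) (x : X) : Continuous fun s => ((t - s : ℝ) : ℂ) • T.Tm s x :=
  (by fun_prop : Continuous fun s : ℝ => ((t - s : ℝ) : ℂ)).smul (T.continuous_Tm x)

/-- `∫_0^t (t - s) T(s) x ds`. -/
def J2 (t : ℝ) : X →L[ℂ] X where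
  toFun x := ∫ s in (0 : ℝ)..t, ((t - s : ℝ) : ℂ) • T.Tm s x
  map_add' x y := by
    simp only [map_add, smul_add]
    exact intervalIntegral.integral_add ((T.continuous_weighted t x).intervalIntegrable _ _)
      ((T.continuous_weighted t y).intervalIntegrable _ _)
  map_smul' c x := by
    simp only [map_smul, RingHom.id_apply]
    rw [← intervalIntegral.integral_smul c]
    simp only [smul_comm c]
  cont := by
    refine intervalIntegral.continuous_parametric_intervalIntegral_of_continuous' ?_ _ _
    exact (by fun_prop : Continuous fun p : X × ℝ => ((t - p.2 : ℝ) : ℂ)).smul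
      (T.strongCont.comp_continuous continuous_snd continuous_fst)

theorem J1_apply (t : ℝ) (x : X) : T.J1 t x = ∫ s in (0 : ℝ)..t, T.Tm s x := rfl

theorem J2_apply (t : ℝ) (x : X) :
    T.J2 t x = ∫ s in (0 : ℝ)..t, ((t - s : ℝ) : ℂ) • T.Tm s x := rfl

theorem strongCont_J1 : StrongCont T.J1 :=
  intervalIntegral.continuous_parametric_intervalIntegral_of_continuous
    (f := fun (p : ℝ × X) s => T.Tm s p.2)
    (T.strongCont.comp_continuous continuous_snd (continuous_snd.comp continuous_fst))
    continuous_fst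

theorem strongCont_J2 : StrongCont T.J2 := by
  refine intervalIntegral.continuous_parametric_intervalIntegral_of_continuous
    (f := fun (p : ℝ × X) s => ((p.1 - s : ℝ) : ℂ) • T.Tm s p.2) ?_ continuous_fst
  exact (by fun_prop : Continuous fun p : (ℝ × X) × ℝ => ((p.1.1 - p.2 : ℝ) : ℂ)).smul
      (T.strongCont.comp_continuous continuous_snd (continuous_snd.comp continuous_fst))

theorem hasDerivAt_J1 (t : ℝ) (x : X) : HasDerivAt (fun t => T.J1 t x) (T.Tm t x) t :=
  (T.continuous_Tm x).integral_hasStrictDerivAt 0 t |>.hasDerivAt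

/-- Integration by parts, with t - s as the other factor. -/
theorem J2_eq (t : ℝ) (x : X) : T.J2 t x = ∫ s in (0 : ℝ)..t, T.J1 s x := by
  have hd : ∀ s : ℝ, HasDerivAt (fun s => ((t - s : ℝ) : ℂ) • T.J1 s x)
      (((t - s : ℝ) : ℂ) • T.Tm s x - T.J1 s x) s := by
    intro s
    have h1 : HasDerivAt (fun s : ℝ => ((t - s : ℝ) : ℂ)) (-1 : ℂ) s := by
      have := ((hasDerivAt_id s).const_sub t).ofReal_comp
      simpa using this
    convert! h1.smul (T.hasDerivAt_J1 s x) using 1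
    simp [sub_eq_add_neg]
  have := intervalIntegral.integral_eq_sub_of_hasDerivAt (a := 0) (b := t) (fun s _ => hd s)
    (((T.continuous_weighted t x).sub
      (T.strongCont_J1.continuous_apply x)).intervalIntegrable _ _)
  rw [intervalIntegral.integral_sub ((T.continuous_weighted t x).intervalIntegrable _ _)
      ((T.strongCont_J1.continuous_apply x).intervalIntegrable _ _)] at this
  have h0 : T.J1 0 x = 0 := by simp [J1_apply]
  simp only [sub_self, Complex.ofReal_zero, zero_smul, h0, smul_zero] at this
  exact sub_eq_zero.1 this

/-! ### The generator -/

theorem J1_mem_domain {t : ℝ} (ht : 0 ≤ t) (x : X) :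
    ∃ h : T.J1 t x ∈ T.generator.domain, T.generator ⟨T.J1 t x, h⟩ = T.T t x - x := by
  refine T.mem_generator_iff.1 ?_
  have h1 := (T.hasDerivAt_J1 t x).tendsto_slope_zero_right
  have h2 := (T.hasDerivAt_J1 0 x).tendsto_slope_zero_right
  rw [T.Tm_of_nonneg ht] at h1
  rw [T.Tm_of_nonneg le_rfl, T.T_zero] at h2
  refine (h1.sub h2).congr' ?_
  filter_upwards [self_mem_nhdsWithin] with h hh
  have hh : 0 < h := hh
  have h3 : T.T h (T.J1 t x) = T.J1 (t + h) x - T.J1 h x := by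
    rw [J1_apply, ← ContinuousLinearMap.intervalIntegral_comp_comm _
      ((T.continuous_Tm x).intervalIntegrable _ _), J1_apply, J1_apply,
      intervalIntegral.integral_interval_sub_left ((T.continuous_Tm x).intervalIntegrable _ _)
      ((T.continuous_Tm x).intervalIntegrable _ _)]
    rw [← zero_add h, ← add_assoc, add_zero, ← intervalIntegral.integral_comp_add_right]
    refine intervalIntegral.integral_congr fun s hs => ?_
    rw [uIcc_of_le ht] at hs
    have := T.T_add h s hh.le hs.1
    simp only [zero_add]
    rw [T.Tm_of_nonneg hs.1, T.Tm_of_nonneg (by linarith [hs.1]), add_comm s h, this]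
    rfl
  have h4 : T.J1 0 x = 0 := by simp [J1_apply]
  rw [h3, h4, zero_add, ← Complex.ofReal_inv, Complex.coe_smul, ← smul_sub]
  congr 1
  abel

theorem dense_domain : Dense (T.generator.domain : Set X) := by
  intro x
  have h2 := (T.hasDerivAt_J1 0 x).tendsto_slope_zero_right
  rw [T.Tm_of_nonneg le_rfl, T.T_zero] at h2
  refine mem_closure_of_tendsto h2 ?_
  filter_upwards [self_mem_nhdsWithin] with h hh
  have h4 : T.J1 0 x = 0 := by simp [J1_apply]
  rw [zero_add, h4, sub_zero, ← Complex.coe_smul]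
  exact T.generator.domain.smul_mem _ (T.J1_mem_domain (le_of_lt hh) x).1

/-- The semigroup law gives the orbit only a right derivative at first. For a continuous function
this is enough for the fundamental theorem of calculus; two-sided differentiability is then read off
from the integral formula in `hasDerivAt_Tm`. -/
theorem T_sub_eq_integral {t : ℝ} (ht : 0 ≤ t) (x : T.generator.domain) :
    T.T t x - x = ∫ s in (0 : ℝ)..t, T.Tm s (T.generator x) := by
  have := intervalIntegral.integral_eq_sub_of_hasDeriv_right_of_le (a := 0) (b := t) ht
    (f := fun s => T.Tm s x) (f' := fun s => T.Tm s (T.generator x))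
    (T.continuous_Tm x).continuousOn (fun s hs => ?_)
    ((T.continuous_Tm _).intervalIntegrable _ _)
  · rw [this, T.Tm_of_nonneg ht, T.Tm_of_nonneg le_rfl, T.T_zero]
    rfl
  · rw [hasDerivWithinAt_iff_tendsto_slope' (by simp)]
    have h1 := ((T.T s).continuous.tendsto _).comp (T.tendsto_generator x)
    have h2 : Tendsto (fun r : ℝ => r - s) (𝓝[>] s) (𝓝[>] 0) := by
      refine tendsto_nhdsWithin_iff.2 ⟨?_, ?_⟩
      · have : Continuous fun r : ℝ => r - s := by fun_prop
        simpa using (this.tendsto s).mono_left nhdsWithin_le_nhds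
      · filter_upwards [self_mem_nhdsWithin] with r hr using mem_Ioi.2 (sub_pos.2 (mem_Ioi.1 hr))
    rw [T.Tm_of_nonneg hs.1.le]
    refine (h1.comp h2).congr' ?_
    filter_upwards [self_mem_nhdsWithin] with r hr
    have hr : s < r := hr
    have h3 := T.T_add s (r - s) hs.1.le (by linarith)
    rw [add_sub_cancel] at h3
    simp only [Function.comp_apply, slope_def_module]
    rw [T.Tm_of_nonneg hs.1.le, T.Tm_of_nonneg (hs.1.trans hr).le, h3, map_smul, map_sub,
      ← Complex.ofReal_inv, Complex.coe_smul]
    rfl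

theorem hasDerivAt_Tm {t : ℝ} (ht : 0 < t) (x : T.generator.domain) :
    HasDerivAt (fun s => T.Tm s x) (T.Tm t (T.generator x)) t := by
  have h := (T.hasDerivAt_J1 t (T.generator x)).const_add (x : X)
  refine h.congr_of_eventuallyEq ?_
  filter_upwards [eventually_gt_nhds ht] with s hs
  rw [J1_apply, ← T.T_sub_eq_integral hs.le, T.Tm_of_nonneg hs.le]
  abel

end C0Semigroup

/-! ### Resolvents -/

section Resolvent

variable {X : Type*} [NormedAddCommGroup X] [NormedSpace ℂ X] {A : X →ₗ.[ℂ] X}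

theorem IsResolvent.eq {α : ℂ} {R R' : X →L[ℂ] X} (h : IsResolvent A α R)
    (h' : IsResolvent A α R') : R = R' := by
  ext x
  have := h'.left_inv ⟨R x, h.mem_domain x⟩
  rw [h.right_inv] at this
  exact this.symm

theorem IsResolvent.resolvent_eq {α : ℂ} {R : X →L[ℂ] X} (h : IsResolvent A α R) :
    resolvent A α = R := by
  have hex : ∃ R, IsResolvent A α R := ⟨R, h⟩
  rw [resolvent, dif_pos hex]
  exact hex.choose_spec.eq h

theorem IsResolvent.resolvent {α : ℂ} {R : X →L[ℂ] X} (h : IsResolvent A α R) :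
    IsResolvent A α (resolvent A α) := h.resolvent_eq ▸ h

theorem IsResolvent.apply_eq {α : ℂ} {R : X →L[ℂ] X} (h : IsResolvent A α R) (x : X) :
    A ⟨R x, h.mem_domain x⟩ = α • R x - x := by
  conv_rhs => rw [← h.right_inv x]
  rw [h.right_inv x, ← h.right_inv x, h.right_inv x, sub_eq_iff_eq_add.1 (h.right_inv x)]
  abel

theorem IsResolvent.injective {α : ℂ} {R : X →L[ℂ] X} (h : IsResolvent A α R) :
    Function.Injective R := by
  intro x y hxy
  rw [← h.right_inv x, ← h.right_inv y]
  congr 3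

theorem IsResolvent.sub_apply {α γ : ℂ} {R R' : X →L[ℂ] X} (h : IsResolvent A α R)
    (h' : IsResolvent A γ R') (x : X) : R x = R' x + (γ - α) • R (R' x) := by
  have h1 := h.left_inv ⟨R' x, h'.mem_domain x⟩
  rw [h'.apply_eq] at h1
  simp only [map_sub, map_smul] at h1
  rw [sub_smul]
  linear_combination (norm := module) h1

end Resolvent

/-! ### The resolvent as a Laplace transform, and its relations with J₁ and J₂ -/

namespace C0Semigroup

variable {X : Type*} [NormedAddCommGroup X] [NormedSpace ℂ X] (T : C0Semigroup X)

theorem exists_bound_of_mem {α : ℂ} (hα : α ∈ T.halfPlane) :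
    ∃ r < α.re, ∃ M : ℝ, ∀ t : ℝ, 0 ≤ t → ‖T.T t‖ ≤ M * Real.exp (r * t) := by
  obtain ⟨w, ⟨r, rfl, M, hM⟩, hw⟩ := sInf_lt_iff.1 (show T.growthBound < (α.re : EReal) from hα)
  exact ⟨r, EReal.coe_lt_coe_iff.1 hw, M, hM⟩

theorem norm_laplace_le {α : ℂ} {r M : ℝ}
    (hM : ∀ t : ℝ, 0 ≤ t → ‖T.T t‖ ≤ M * Real.exp (r * t)) (x : X) {t : ℝ} (ht : 0 ≤ t) :
    ‖Complex.exp (-α * t) • T.Tm t x‖ ≤ (M * ‖x‖) * Real.exp (-(α.re - r) * t) := by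
  rw [norm_smul, Complex.norm_exp, T.Tm_of_nonneg ht]
  have h1 := (T.T t).le_of_opNorm_le (hM t ht) x
  have h2 : (-α * (t : ℂ)).re = -α.re * t := by simp
  calc _ ≤ Real.exp (-α.re * t) * (M * Real.exp (r * t) * ‖x‖) := by
        rw [h2]; gcongr
    _ = _ := by
        rw [show -(α.re - r) * t = -α.re * t + r * t by ring, Real.exp_add]
        ring

variable [CompleteSpace X]

theorem continuous_laplace (α : ℂ) (x : X) :
    Continuous fun t : ℝ => Complex.exp (-α * t) • T.Tm t x :=
  (by fun_prop : Continuous fun t : ℝ => Complex.exp (-α * t)).smul (T.continuous_Tm x)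

theorem integrableOn_laplace {α : ℂ} (hα : α ∈ T.halfPlane) (x : X) (a : ℝ) (ha : 0 ≤ a) :
    IntegrableOn (fun t : ℝ => Complex.exp (-α * t) • T.Tm t x) (Ioi a) := by
  obtain ⟨r, hr, M, hM⟩ := T.exists_bound_of_mem hα
  refine ((exp_neg_integrableOn_Ioi a (sub_pos.2 hr)).const_mul (M * ‖x‖)).mono'
    (T.continuous_laplace α x).aestronglyMeasurable ?_
  filter_upwards [ae_restrict_mem measurableSet_Ioi] with t ht
  exact T.norm_laplace_le hM x (ha.trans (le_of_lt ht))

/-- The Laplace transform of the semigroup. -/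
def laplace {α : ℂ} (hα : α ∈ T.halfPlane) : X →L[ℂ] X :=
  LinearMap.mkContinuousOfExistsBound
    { toFun := fun x => ∫ t in Ioi (0 : ℝ), Complex.exp (-α * t) • T.Tm t x
      map_add' := fun x y => by
        simp only [map_add, smul_add]
        exact integral_add (T.integrableOn_laplace hα x 0 le_rfl)
          (T.integrableOn_laplace hα y 0 le_rfl)
      map_smul' := fun c x => by
        simp only [map_smul, RingHom.id_apply, smul_comm _ c]
        exact integral_smul c _ } (by
    obtain ⟨r, hr, M, hM⟩ := T.exists_bound_of_mem hα
    refine ⟨M * ∫ t in Ioi (0 : ℝ), Real.exp (-(α.re - r) * t), fun x => ?_⟩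
    refine (norm_integral_le_of_norm_le
      ((exp_neg_integrableOn_Ioi 0 (sub_pos.2 hr)).const_mul (M * ‖x‖)) ?_).trans_eq ?_
    · filter_upwards [ae_restrict_mem measurableSet_Ioi] with t ht
      exact T.norm_laplace_le hM x (le_of_lt ht)
    · rw [integral_const_mul]
      ring)

theorem laplace_apply {α : ℂ} (hα : α ∈ T.halfPlane) (x : X) :
    T.laplace hα x = ∫ t in Ioi (0 : ℝ), Complex.exp (-α * t) • T.Tm t x := rfl

/-- Shifting the integration variable by h removes the piece over [0, h] and leaves the factor
e^{αh}. Differentiating the right-hand side at h = 0 computes A on the range of the Laplace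
transform. -/
theorem T_laplace {α : ℂ} (hα : α ∈ T.halfPlane) (x : X) {h : ℝ} (hh : 0 ≤ h) :
    T.T h (T.laplace hα x) = Complex.exp (α * h) •
      (T.laplace hα x - ∫ t in (0 : ℝ)..h, Complex.exp (-α * t) • T.Tm t x) := by
  have h1 : T.laplace hα x - ∫ t in (0 : ℝ)..h, Complex.exp (-α * t) • T.Tm t x =
      ∫ t in Ioi h, Complex.exp (-α * t) • T.Tm t x := by
    rw [laplace_apply, sub_eq_iff_eq_add']
    exact (intervalIntegral.integral_interval_add_Ioi (T.integrableOn_laplace hα x 0 le_rfl)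
      (T.integrableOn_laplace hα x h hh)).symm
  rw [h1, laplace_apply, ← ContinuousLinearMap.integral_comp_comm _
    (T.integrableOn_laplace hα x 0 le_rfl), ← integral_smul]
  have h2 := (measurePreserving_add_right volume h).setIntegral_preimage_emb
    (MeasurableEquiv.addRight h).measurableEmbedding
    (fun t : ℝ => Complex.exp (α * h) • Complex.exp (-α * t) • T.Tm t x) (Ioi h)
  rw [preimage_add_const_Ioi, sub_self] at h2
  rw [← h2]
  refine setIntegral_congr_fun measurableSet_Ioi fun t ht => ?_
  have ht : 0 < t := ht
  have h3 := T.T_add h t hh ht.le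
  simp only [map_smul]
  rw [T.Tm_of_nonneg ht.le, T.Tm_of_nonneg (by linarith), add_comm t h, h3, smul_smul,
    ← Complex.exp_add]
  congr 2
  push_cast
  ring

/-- The right inverse comes from differentiating `T_laplace` at h = 0; the left inverse from
integrating the derivative of e^{-αt} T(t) x over (0, ∞), whose boundary term at infinity vanishes
as Re α exceeds an exponential growth rate of the semigroup. -/
theorem isResolvent_laplace {α : ℂ} (hα : α ∈ T.halfPlane) :
    IsResolvent T.generator α (T.laplace hα) := by
  have key : ∀ x, ∃ h : T.laplace hα x ∈ T.generator.domain,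
      T.generator ⟨T.laplace hα x, h⟩ = α • T.laplace hα x - x := by
    intro x
    refine T.mem_generator_iff.1 ?_
    set y := T.laplace hα x
    have h1 : HasDerivAt (fun h : ℝ => Complex.exp (α * h)) α 0 := by
      have := (((hasDerivAt_id (0 : ℂ)).const_mul α).cexp).comp_ofReal
      simpa using this
    have h2 : HasDerivAt (fun h : ℝ => ∫ t in (0 : ℝ)..h, Complex.exp (-α * t) • T.Tm t x) x 0 := by
      have := ((T.continuous_laplace α x).integral_hasStrictDerivAt 0 0).hasDerivAt
      simpa [T.Tm_of_nonneg le_rfl, T.T_zero] using this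
    have h3 : HasDerivAt (fun h : ℝ => Complex.exp (α * h) •
        (y - ∫ t in (0 : ℝ)..h, Complex.exp (-α * t) • T.Tm t x)) (α • y - x) 0 := by
      convert! h1.smul (h2.const_sub y) using 1
      simp
      abel
    refine h3.tendsto_slope_zero_right.congr' ?_
    filter_upwards [self_mem_nhdsWithin] with h hh
    rw [zero_add, ← T.T_laplace hα x (le_of_lt hh), ← Complex.ofReal_inv, Complex.coe_smul]
    simp [y]
  refine ⟨fun x => (key x).1, fun x => ?_, fun x => ?_⟩
  · rw [(key x).2]
    abel
  · have h1 : ∀ t ∈ Ioi (0 : ℝ), HasDerivAt (fun t : ℝ => Complex.exp (-α * t) • T.Tm t (x : X))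
        (-(Complex.exp (-α * t) • T.Tm t (α • (x : X) - T.generator x))) t := by
      intro t ht
      have h2 : HasDerivAt (fun t : ℝ => Complex.exp (-α * t)) (Complex.exp (-α * t) * -α) t := by
        have := (((hasDerivAt_id (t : ℂ)).const_mul (-α)).cexp).comp_ofReal
        simpa using this
      convert! h2.smul (T.hasDerivAt_Tm ht x) using 1
      simp only [map_sub, map_smul, smul_sub, mul_smul, neg_smul, smul_neg]
      abel
    obtain ⟨r, hr, M, hM⟩ := T.exists_bound_of_mem hα
    have h3 : Tendsto (fun t : ℝ => Complex.exp (-α * t) • T.Tm t (x : X)) atTop (𝓝 0) := by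
      refine squeeze_zero_norm' (a := fun t => (M * ‖(x : X)‖) * Real.exp (-(α.re - r) * t)) ?_ ?_
      · filter_upwards [eventually_ge_atTop 0] with t ht using T.norm_laplace_le hM _ ht
      · have : Tendsto (fun t : ℝ => (α.re - r) * t) atTop atTop :=
          tendsto_id.const_mul_atTop (sub_pos.2 hr)
        have := (Real.tendsto_exp_neg_atTop_nhds_zero.comp this).const_mul (M * ‖(x : X)‖)
        simpa only [Function.comp_def, neg_mul, mul_zero] using this
    have h4 := integral_Ioi_of_hasDerivAt_of_tendsto
      (T.continuous_laplace α (x : X)).continuousWithinAt h1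
      (T.integrableOn_laplace hα _ 0 le_rfl).neg h3
    rw [integral_neg, ← laplace_apply T hα] at h4
    simpa [T.Tm_of_nonneg le_rfl, T.T_zero] using congrArg Neg.neg h4

theorem isResolvent {α : ℂ} (hα : α ∈ T.halfPlane) :
    IsResolvent T.generator α (resolvent T.generator α) :=
  (T.isResolvent_laplace hα).resolvent

variable {T}

theorem resolvent_T {α : ℂ} (hα : α ∈ T.halfPlane) {t : ℝ} (ht : 0 ≤ t) (x : X) :
    resolvent T.generator α (T.T t x) = T.T t (resolvent T.generator α x) := by
  have hR := T.isResolvent hα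
  obtain ⟨h1, h2⟩ := T.T_mem_domain ht ⟨_, hR.mem_domain x⟩
  have h3 := hR.left_inv ⟨_, h1⟩
  rw [h2, hR.apply_eq] at h3
  simpa using h3

theorem resolvent_Tm {α : ℂ} (hα : α ∈ T.halfPlane) (t : ℝ) (x : X) :
    resolvent T.generator α (T.Tm t x) = T.Tm t (resolvent T.generator α x) :=
  resolvent_T hα (le_max_right _ _) x

/-- This is A J₁(t) = T(t) - 1 with the resolvent applied. Integrated in t it becomes
`resolvent_J1_sub`, the counterpart of A J₂(t) = J₁(t) - t. -/
theorem resolvent_T_sub {α : ℂ} (hα : α ∈ T.halfPlane) {t : ℝ} (ht : 0 ≤ t) (x : X) :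
    resolvent T.generator α (T.T t x) - resolvent T.generator α x =
      α • resolvent T.generator α (T.J1 t x) - T.J1 t x := by
  obtain ⟨h1, h2⟩ := T.J1_mem_domain ht x
  have h3 := (T.isResolvent hα).left_inv ⟨_, h1⟩
  rw [h2] at h3
  simp only [map_sub, map_smul] at h3
  linear_combination (norm := module) -h3

theorem resolvent_J1_sub {α : ℂ} (hα : α ∈ T.halfPlane) {t : ℝ} (ht : 0 ≤ t) (x : X) :
    resolvent T.generator α (T.J1 t x) - (t : ℂ) • resolvent T.generator α x =
      α • resolvent T.generator α (T.J2 t x) - T.J2 t x := by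
  have hJ := T.strongCont_J1.continuous_apply x
  have hc := (T.continuous_Tm x)
  set R := resolvent T.generator α
  have h1 : R (T.J1 t x) = ∫ s in (0 : ℝ)..t, R (T.Tm s x) :=
    (R.intervalIntegral_comp_comm (hc.intervalIntegrable _ _)).symm
  have h2 : R (T.J2 t x) = ∫ s in (0 : ℝ)..t, R (T.J1 s x) := by
    rw [J2_eq]
    exact (R.intervalIntegral_comp_comm (hJ.intervalIntegrable _ _)).symm
  have h3 : (t : ℂ) • R x = ∫ s in (0 : ℝ)..t, R x := by
    rw [intervalIntegral.integral_const, sub_zero, Complex.coe_smul]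
  have hRT : Continuous fun s => R (T.Tm s x) := R.continuous.comp hc
  have hRJ : Continuous fun s => α • R (T.J1 s x) := (R.continuous.comp hJ).const_smul α
  rw [h1, h2, h3, T.J2_eq t x, ← intervalIntegral.integral_sub
      (hRT.intervalIntegrable _ _) (by simp),
    ← intervalIntegral.integral_smul, ← intervalIntegral.integral_sub
      (hRJ.intervalIntegrable _ _) (hJ.intervalIntegrable _ _)]
  refine intervalIntegral.integral_congr fun s hs => ?_
  rw [uIcc_of_le ht] at hs
  rw [T.Tm_of_nonneg hs.1]
  exact resolvent_T_sub hα hs.1 x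

theorem resolvent_J2 {α : ℂ} (hα : α ∈ T.halfPlane) (t : ℝ) (x : X) :
    resolvent T.generator α (T.J2 t x) = T.J2 t (resolvent T.generator α x) := by
  rw [J2_apply, J2_apply, ← ContinuousLinearMap.intervalIntegral_comp_comm _
    ((T.continuous_weighted t x).intervalIntegrable _ _)]
  simp only [map_smul, resolvent_Tm hα]

/-- The operator family `P` for which `R(α, A) P(t) = α J₂(t) - J₁(t)`. -/
def P (T : C0Semigroup X) (α : ℂ) (t : ℝ) : X →L[ℂ] X :=
  α ^ 2 • T.J2 t - (2 * α) • T.J1 t + (α * t) • ContinuousLinearMap.id ℂ X + T.Tm t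
    - ContinuousLinearMap.id ℂ X

theorem strongCont_P (T : C0Semigroup X) (α : ℂ) : StrongCont (T.P α) :=
  ((((T.strongCont_J2.smul continuous_const).sub (T.strongCont_J1.smul continuous_const)).add
    ((strongCont_const _).smul (by fun_prop))).add T.strongCont).sub (strongCont_const _)

theorem P_zero (T : C0Semigroup X) (α : ℂ) : T.P α 0 = 0 := by
  ext x
  simp [P, J1_apply, J2_apply, T.Tm_of_nonneg le_rfl, T.T_zero]

/-- Expanding (α - A)(αJ₂ - J₁) by A J₁ = T - 1 and A J₂ = J₁ - t gives exactly the bounded operator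
`P`. Thus αJ₂ - J₁ maps into D(A), and C can be applied to it through the bounded operator C R(α,
A). -/
theorem resolvent_P {α : ℂ} (hα : α ∈ T.halfPlane) {t : ℝ} (ht : 0 ≤ t) (x : X) :
    resolvent T.generator α (T.P α t x) = α • T.J2 t x - T.J1 t x := by
  have h1 := resolvent_T_sub hα ht x
  have h2 := resolvent_J1_sub hα ht x
  simp only [P, sub_apply, add_apply, smul_apply, ContinuousLinearMap.id_apply, map_sub, map_add, map_smul,
    T.Tm_of_nonneg ht]
  linear_combination (norm := module) h1 - α • h2

end C0Semigroup

/-! ### Adjoint semigroups -/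

section Adjoint

variable {X : Type*} [NormedAddCommGroup X] [NormedSpace ℂ X]

theorem exists_antiDual_vector (x : X) : ∃ f : AntiDual X, ‖f‖ ≤ 1 ∧ f x = ‖x‖ := by
  obtain ⟨g, hg, hgx⟩ := exists_dual_vector'' ℂ x
  refine ⟨(starL ℂ : ℂ ≃L⋆[ℂ] ℂ).toContinuousLinearMap.comp g, ?_, ?_⟩
  · refine ContinuousLinearMap.opNorm_le_bound _ zero_le_one fun y => ?_
    simpa using g.le_of_opNorm_le hg y
  · simp [hgx]

variable {T : C0Semigroup X} {T' : C0Semigroup (AntiDual X)}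

theorem dual_mem_generator_iff [CompleteSpace X] (h : T'.generator = adjoint T.generator)
    {f g : AntiDual X} : (∃ hf : f ∈ T'.generator.domain, T'.generator ⟨f, hf⟩ = g) ↔
      ∀ x : T.generator.domain, g x = f (T.generator x) := by
  have h1 : (f, g) ∈ T'.generator.graph ↔ (f, g) ∈ adjointGraph T.generator := by
    rw [h, adjoint_graph _ T.dense_domain]
  rw [LinearPMap.mem_graph_iff] at h1
  refine Iff.trans ⟨?_, ?_⟩ h1
  · rintro ⟨hf, h2⟩
    exact ⟨⟨f, hf⟩, rfl, h2⟩
  · rintro ⟨y, h2, h3⟩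
    have h2 : (y : AntiDual X) = f := h2
    subst h2
    exact ⟨y.2, h3⟩

theorem dual_generator_apply [CompleteSpace X] (h : T'.generator = adjoint T.generator)
    (f : T'.generator.domain) (x : T.generator.domain) :
    T'.generator f x = (f : AntiDual X) (T.generator x) :=
  (dual_mem_generator_iff h).1 ⟨f.2, rfl⟩ x

/-- The pairing between `X*` and `X` as a real bilinear map. -/
def pairing (X : Type*) [NormedAddCommGroup X] [NormedSpace ℂ X] :
    AntiDual X →L[ℝ] X →L[ℝ] ℂ :=
  LinearMap.mkContinuous₂ (LinearMap.mk₂ ℝ (fun (f : AntiDual X) (x : X) => f x)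
    (fun _ _ _ => rfl) (fun _ _ _ => rfl) (fun _ _ _ => map_add _ _ _)
    (fun c f x => by
      rw [← Complex.coe_smul, map_smulₛₗ, Complex.conj_ofReal, Complex.coe_smul])) 1
    (fun f x => by simpa using f.le_opNorm x)

theorem pairing_apply (f : AntiDual X) (x : X) : pairing X f x = f x := rfl

/-- For f ∈ D(A*) and x ∈ D(A) the function s ↦ ⟨T'(t - s) f, T(s) x⟩ has derivative zero on (0, t),
so its values at 0 and t agree. Density of D(A), and then of D(A*), removes the restrictions; the
latter is dense because A* is a generator. -/
theorem dual_T_apply [CompleteSpace X] (h : T'.generator = adjoint T.generator) {t : ℝ}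
    (ht : 0 ≤ t) (f : AntiDual X) (x : X) : T'.T t f x = f (T.T t x) := by
  have key : ∀ (f : T'.generator.domain) (x : T.generator.domain),
      T'.T t f x = (f : AntiDual X) (T.T t x) := by
    intro f x
    have hc : Continuous fun s => pairing X (T'.Tm (t - s) f) (T.Tm s x) :=
      (pairing X).continuous₂.comp (((T'.continuous_Tm (f : AntiDual X)).comp
        (continuous_const.sub continuous_id)).prodMk (T.continuous_Tm (x : X)))
    have := intervalIntegral.integral_eq_sub_of_hasDeriv_right_of_le (a := 0) (b := t) ht
      hc.continuousOn (f' := fun _ => 0) (fun s hs => ?_) (by simp)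
    · simp only [intervalIntegral.integral_zero, sub_self, sub_zero, pairing_apply] at this
      rw [T.Tm_of_nonneg ht, T'.Tm_of_nonneg ht, T.Tm_of_nonneg le_rfl,
        T'.Tm_of_nonneg le_rfl, T.T_zero, T'.T_zero] at this
      exact (sub_eq_zero.1 this.symm).symm
    · have hts : 0 < t - s := sub_pos.2 hs.2
      have h1 := T.hasDerivAt_Tm hs.1 x
      have h2 := (T'.hasDerivAt_Tm hts f).scomp s ((hasDerivAt_id s).const_sub t)
      have h3 := (pairing X).hasDerivAt_of_bilinear (fun _ => h2) (fun _ => h1)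
      refine HasDerivAt.hasDerivWithinAt ?_
      convert! h3 using 1
      obtain ⟨m1, e1⟩ := T.T_mem_domain hs.1.le x
      obtain ⟨m2, e2⟩ := T'.T_mem_domain hts.le f
      have e3 := dual_generator_apply h ⟨_, m2⟩ ⟨_, m1⟩
      rw [e1, e2] at e3
      rw [T'.Tm_of_nonneg hts.le, T.Tm_of_nonneg hs.1.le]
      simp only [Function.comp_apply, T'.Tm_of_nonneg hts.le, neg_smul, one_smul, map_neg,
        neg_apply, pairing_apply]
      rw [e3]
      simp
  have key2 : ∀ (f : T'.generator.domain) (x : X), T'.T t f x = (f : AntiDual X) (T.T t x) := by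
    intro f x
    exact congrFun (Continuous.ext_on T.dense_domain (T'.T t f).continuous
      ((f : AntiDual X).continuous.comp (T.T t).continuous) fun x hx => key f ⟨x, hx⟩) x
  have hev : ∀ y : X, Continuous fun f : AntiDual X => f y := fun y => by fun_prop
  exact congrFun (Continuous.ext_on T'.dense_domain ((hev x).comp (T'.T t).continuous)
    (hev (T.T t x)) fun f hf => key2 ⟨f, hf⟩ x) f

/-- Equality of norms, with norming functionals for the lower bound, makes the two growth bounds
equal. Hence both nodes live on the same half-plane, which is invariant under conjugation. -/
theorem dual_norm_T [CompleteSpace X] (h : T'.generator = adjoint T.generator) {t : ℝ}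
    (ht : 0 ≤ t) : ‖T'.T t‖ = ‖T.T t‖ := by
  refine le_antisymm ?_ ?_
  · refine ContinuousLinearMap.opNorm_le_bound _ (norm_nonneg _) fun f =>
      ContinuousLinearMap.opNorm_le_bound _ (by positivity) fun x => ?_
    rw [dual_T_apply h ht]
    calc ‖f (T.T t x)‖ ≤ ‖f‖ * (‖T.T t‖ * ‖x‖) := f.le_opNorm_of_le ((T.T t).le_opNorm x)
      _ = _ := by ring
  · refine ContinuousLinearMap.opNorm_le_bound _ (norm_nonneg _) fun x => ?_
    obtain ⟨f, hf, hfx⟩ := exists_antiDual_vector (T.T t x)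
    rw [← dual_T_apply h ht] at hfx
    have h1 : ‖T.T t x‖ = ‖T'.T t f x‖ := by rw [hfx]; simp
    rw [h1]
    calc _ ≤ ‖T'.T t f‖ * ‖x‖ := (T'.T t f).le_opNorm x
      _ ≤ _ := by
        gcongr
        simpa using (T'.T t).le_opNorm_of_le hf

theorem dual_halfPlane [CompleteSpace X] (h : T'.generator = adjoint T.generator) :
    T'.halfPlane = T.halfPlane := by
  have : T'.growthBound = T.growthBound := by
    unfold C0Semigroup.growthBound
    congr 1
    ext w
    refine exists_congr fun r => and_congr_right fun _ => exists_congr fun M =>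
      forall₂_congr fun t ht => ?_
    rw [dual_norm_T h ht]
  simp only [C0Semigroup.halfPlane, this]

theorem conj_mem_halfPlane {T : C0Semigroup X} {z : ℂ} (hz : z ∈ T.halfPlane) :
    starRingEnd ℂ z ∈ T.halfPlane := by
  simpa [C0Semigroup.halfPlane] using hz

/-- The functional f ∘ R(conj z, A) lies in D(A*), and z - A* maps it to f; uniqueness of the
resolvent does the rest. The conjugate appears because functionals are conjugate-linear. -/
theorem dual_resolvent_apply [CompleteSpace X] (h : T'.generator = adjoint T.generator) {z : ℂ}
    (hz : z ∈ T'.halfPlane) (f : AntiDual X) (x : X) :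
    resolvent T'.generator z f x = f (resolvent T.generator (starRingEnd ℂ z) x) := by
  have hz' : starRingEnd ℂ z ∈ T.halfPlane := conj_mem_halfPlane (dual_halfPlane h ▸ hz)
  have hR := T.isResolvent hz'
  obtain ⟨h1, h2⟩ := (dual_mem_generator_iff h
    (f := f.comp (resolvent T.generator (starRingEnd ℂ z)))
    (g := z • f.comp (resolvent T.generator (starRingEnd ℂ z)) - f)).2 (fun y => by
      have h3 := congrArg f (hR.left_inv y)
      simp only [map_sub, map_smul, map_smulₛₗ, RingHomCompTriple.comp_apply] at h3
      simp only [sub_apply, smul_apply, ContinuousLinearMap.comp_apply]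
      rw [← h3]
      simp)
  have h4 := (T'.isResolvent hz).left_inv ⟨_, h1⟩
  rw [h2, sub_sub_cancel] at h4
  rw [h4]
  rfl

end Adjoint

/-! ### The extrapolation space -/

section Extrap

variable {X : Type*} [NormedAddCommGroup X] [NormedSpace ℂ X]

theorem denseRange_incl (A : X →ₗ.[ℂ] X) (β : ℂ) : DenseRange (incl A β) :=
  UniformSpace.Completion.denseRange_coe (α := PreExtrap A β)

theorem norm_incl (A : X →ₗ.[ℂ] X) (β : ℂ) (x : X) : ‖incl A β x‖ = ‖resolvent A β x‖ :=
  UniformSpace.Completion.norm_coe (E := PreExtrap A β) x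

@[elab_as_elim]
theorem extrap_induction {A : X →ₗ.[ℂ] X} {β : ℂ} {p : Extrap A β → Prop} (ξ : Extrap A β)
    (hp : IsClosed {ξ | p ξ}) (h : ∀ x, p (incl A β x)) : p ξ :=
  UniformSpace.Completion.induction_on ξ hp h

variable [CompleteSpace X] {T : C0Semigroup X} {α β : ℂ}

/-- The estimate that allows the extension from X to X₋₁ comes from the resolvent identity: R(α, A)
x is R(β, A) x plus a bounded operator applied to R(β, A) x. -/
theorem resExt_incl (hβ : β ∈ T.halfPlane) (hα : α ∈ T.halfPlane) (x : X) :
    resExt T.generator β α (incl T.generator β x) = resolvent T.generator α x := by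
  refine LinearMap.extendOfNorm_eq (f := (resolvent T.generator α).toLinearMap)
    (e := incl T.generator β) (denseRange_incl _ _) ⟨1 + ‖β - α‖ * ‖resolvent T.generator α‖,
    fun x => ?_⟩ x
  rw [norm_incl]
  have := (T.isResolvent hα).sub_apply (T.isResolvent hβ) x
  simp only [ContinuousLinearMap.coe_coe]
  rw [this, add_mul, one_mul, mul_assoc]
  refine (norm_add_le _ _).trans ?_
  rw [norm_smul]
  gcongr
  exact (resolvent T.generator α).le_opNorm _

/-- Every later identity in X₋₁ is checked by applying this isometry and computing in X. -/
theorem norm_resExt (hβ : β ∈ T.halfPlane) (ξ : Extrap T.generator β) :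
    ‖resExt T.generator β β ξ‖ = ‖ξ‖ :=
  extrap_induction ξ (isClosed_eq (resExt T.generator β β).continuous.norm continuous_norm)
    (fun x => by rw [resExt_incl hβ hβ, norm_incl])

/-- `R(β, A₋₁)` as an isometry from `X₋₁` to `X`. -/
def resIso (hβ : β ∈ T.halfPlane) : Extrap T.generator β →ₗᵢ[ℂ] X where
  toLinearMap := (resExt T.generator β β).toLinearMap
  norm_map' := norm_resExt hβ

theorem resIso_apply (hβ : β ∈ T.halfPlane) (ξ : Extrap T.generator β) :
    resIso hβ ξ = resExt T.generator β β ξ := rfl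

theorem resExt_sub (hβ : β ∈ T.halfPlane) (hα : α ∈ T.halfPlane) {γ : ℂ}
    (hγ : γ ∈ T.halfPlane) (ξ : Extrap T.generator β) :
    resExt T.generator β α ξ =
      resExt T.generator β γ ξ + (γ - α) • resolvent T.generator α (resExt T.generator β γ ξ) := by
  refine extrap_induction ξ (isClosed_eq (by fun_prop) (by fun_prop)) fun x => ?_
  rw [resExt_incl hβ hα, resExt_incl hβ hγ]
  exact (T.isResolvent hα).sub_apply (T.isResolvent hγ) x

theorem resExt_sub_mem (hβ : β ∈ T.halfPlane) (hα : α ∈ T.halfPlane) {γ : ℂ}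
    (hγ : γ ∈ T.halfPlane) (ξ : Extrap T.generator β) :
    resExt T.generator β α ξ - resExt T.generator β γ ξ ∈ T.generator.domain := by
  rw [resExt_sub hβ hα hγ, add_sub_cancel_left]
  exact T.generator.domain.smul_mem _ ((T.isResolvent hα).mem_domain _)

theorem ext_incl (hβ : β ∈ T.halfPlane) {t : ℝ} (ht : 0 ≤ t) (x : X) :
    T.ext β t (incl T.generator β x) = incl T.generator β (T.T t x) := by
  refine LinearMap.extendOfNorm_eq
    (f := (incl T.generator β).comp (T.T t).toLinearMap) (e := incl T.generator β)
    (denseRange_incl _ _) ⟨‖T.T t‖, fun x => ?_⟩ x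
  rw [LinearMap.comp_apply, norm_incl, norm_incl, ContinuousLinearMap.coe_coe, C0Semigroup.resolvent_T hβ ht]
  exact (T.T t).le_opNorm _

theorem resExt_ext (hβ : β ∈ T.halfPlane) {t : ℝ} (ht : 0 ≤ t) (ξ : Extrap T.generator β) :
    resExt T.generator β β (T.ext β t ξ) = T.T t (resExt T.generator β β ξ) := by
  refine extrap_induction ξ (isClosed_eq (by fun_prop) (by fun_prop)) fun x => ?_
  rw [ext_incl hβ ht, resExt_incl hβ hβ, resExt_incl hβ hβ, C0Semigroup.resolvent_T hβ ht]

theorem resExt_genExt (hβ : β ∈ T.halfPlane) (x : X) :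
    resExt T.generator β β (genExt T.generator β x) = β • resolvent T.generator β x - x := by
  have hR := T.isResolvent hβ
  have h0 : ∀ x : T.generator.domain, resolvent T.generator β (T.generator x) =
      β • resolvent T.generator β x - x := fun x => by
    have := hR.left_inv x
    simp only [map_sub, map_smul] at this
    linear_combination (norm := module) -this
  have h1 : ∀ x : T.generator.domain, genExt T.generator β x =
      incl T.generator β (T.generator x) := by
    refine LinearMap.extendOfNorm_eq (e := T.generator.domain.subtype) ?_
      ⟨‖β‖ * ‖resolvent T.generator β‖ + 1, fun x => ?_⟩
    · simpa [DenseRange] using T.dense_domain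
    · have : ((incl T.generator β).comp T.generator.toFun) x =
        incl T.generator β (T.generator x) := rfl
      rw [this, norm_incl, h0, add_mul, one_mul, mul_assoc]
      refine (norm_sub_le _ _).trans ?_
      rw [norm_smul]
      gcongr
      · exact (resolvent T.generator β).le_opNorm _
      · simp
  refine congrFun (Continuous.ext_on T.dense_domain
    (f := fun x => resExt T.generator β β (genExt T.generator β x))
    (g := fun x => β • resolvent T.generator β x - x) (by fun_prop) (by fun_prop)
    fun x hx => ?_) x
  simp only
  rw [h1 ⟨x, hx⟩, resExt_incl hβ hβ, h0]

theorem incl_injective (hβ : β ∈ T.halfPlane) : Function.Injective (incl T.generator β) := by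
  intro x y h
  have := congrArg (resExt T.generator β β) h
  rw [resExt_incl hβ hβ, resExt_incl hβ hβ] at this
  exact (T.isResolvent hβ).injective this

end Extrap

/-! ### The pairings that identify (X*)₋₁ with (X₁)* and (X*)₁ with (X₋₁)* -/

section Duality

variable {X : Type*} [NormedAddCommGroup X] [NormedSpace ℂ X] [CompleteSpace X]
  {T : C0Semigroup X} {T' : C0Semigroup (AntiDual X)} {β : ℂ}

/-- The functional extension of `f ∈ D(A*)` in terms of any representation `f = g ∘ R(α, A)`. -/
theorem functionalExt_apply (hβ : β ∈ T.halfPlane) {α : ℂ} (hα : α ∈ T.halfPlane)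
    (g : AntiDual X) (ξ : Extrap T.generator β) :
    functionalExt T.generator β (g.comp (resolvent T.generator α)) ξ =
      g (resExt T.generator β α ξ) := by
  have h1 : ∀ x, functionalExt T.generator β (g.comp (resolvent T.generator α))
      (incl T.generator β x) = g (resolvent T.generator α x) := by
    refine LinearMap.extendOfNorm_eq (denseRange_incl _ _)
      ⟨‖g‖ * ‖resExt T.generator β α‖, fun x => ?_⟩
    change ‖g (resolvent T.generator α x)‖ ≤ _
    rw [← resExt_incl hβ hα, mul_assoc]
    exact g.le_opNorm_of_le (ContinuousLinearMap.le_opNorm _ _)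
  refine extrap_induction ξ (isClosed_eq (by fun_prop) (by fun_prop)) fun x => ?_
  rw [h1, resExt_incl hβ hα]

/-- On X* itself, f(x) = (R(γ, A*) f)((conj γ - A) x). The right-hand side is bounded by the norm of
f in (X*)₋₁, which gives the extension and its formula at once. -/
theorem extrapEval_apply (h : T'.generator = adjoint T.generator) {γ : ℂ}
    (hγ : γ ∈ T'.halfPlane) (x : T.generator.domain) (ζ : Extrap T'.generator γ) :
    extrapEval T'.generator γ (x : X) ζ =
      resExt T'.generator γ γ ζ (starRingEnd ℂ γ • (x : X) - T.generator x) := by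
  have hγ' : starRingEnd ℂ γ ∈ T.halfPlane := conj_mem_halfPlane (dual_halfPlane h ▸ hγ)
  have h0 : ∀ f : AntiDual X, f x = resExt T'.generator γ γ (incl T'.generator γ f)
      (starRingEnd ℂ γ • (x : X) - T.generator x) := by
    intro f
    rw [resExt_incl hγ hγ, dual_resolvent_apply h hγ, (T.isResolvent hγ').left_inv]
  have h1 : ∀ f, extrapEval T'.generator γ (x : X) (incl T'.generator γ f) = f x := by
    refine LinearMap.extendOfNorm_eq (denseRange_incl _ _)
      ⟨‖starRingEnd ℂ γ • (x : X) - T.generator x‖, fun f => ?_⟩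
    change ‖f x‖ ≤ _
    rw [h0, mul_comm]
    refine (ContinuousLinearMap.le_opNorm _ _).trans ?_
    rw [norm_resExt hγ]
  refine extrap_induction ζ (isClosed_eq (by fun_prop) (by fun_prop)) fun f => ?_
  rw [h1, h0]

end Duality

/-! ### Convolutions with strongly continuous families -/

section Convolution

variable {X Z : Type*} [NormedAddCommGroup X] [NormedAddCommGroup Z] [NormedSpace ℂ Z]

theorem MemLpLoc.intervalIntegrable {w : ℝ → X} (hw : MemLpLoc 1 w) {t : ℝ} (ht : 0 ≤ t) :
    IntervalIntegrable w volume 0 t := by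
  rcases ht.eq_or_lt with rfl | ht
  · simp
  · rw [intervalIntegrable_iff_integrableOn_Icc_of_le ht.le]
    exact memLp_one_iff_integrable.1 (hw t ht)

variable [NormedSpace ℂ X] [CompleteSpace X]

theorem StrongCont.continuousOn_convolution {Q : ℝ → X →L[ℂ] Z} (hQ : StrongCont Q)
    {w : ℝ → X} (hw : MemLpLoc 1 w) :
    ContinuousOn (fun t => ∫ r in (0 : ℝ)..t, Q (t - r) (w r)) (Ici 0) := by
  intro t₀ ht₀
  have ht₀ : 0 ≤ t₀ := ht₀
  -- Extending w by zero to the left allows two-sided continuity to be used even at t₀ = 0.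
  let w' := (Ici (0 : ℝ)).indicator w
  have hw' : IntegrableOn w' (uIoc (-1) (t₀ + 1)) := by
    rw [uIoc_of_le (by linarith)]
    have h1 : IntegrableOn w (Icc 0 (t₀ + 1)) :=
      memLp_one_iff_integrable.1 (hw _ (by linarith))
    rw [integrableOn_indicator_iff measurableSet_Ici]
    exact h1.mono_set fun x hx => ⟨hx.1, hx.2.2⟩
  obtain ⟨M, -, hM⟩ := hQ.exists_bound (-(t₀ + 2)) (t₀ + 2)
  have key := intervalIntegral.continuousAt_parametric_primitive_of_dominated
    (F := fun t r => Q (t - r) (w' r)) (fun r => M * ‖w' r‖) (-1) (t₀ + 1)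
    (a₀ := 0) (b₀ := t₀) (x₀ := t₀) (μ := volume)
    (fun t => Continuous.comp_aestronglyMeasurable
      (g := fun p : ℝ × X => Q p.1 p.2) hQ
      ((measurable_const.sub measurable_id).aestronglyMeasurable.prodMk
        hw'.aestronglyMeasurable)) (by
      filter_upwards [Ioo_mem_nhds (show t₀ - 1 < t₀ by linarith)
        (show t₀ < t₀ + 1 by linarith)] with t ht
      filter_upwards [ae_restrict_mem measurableSet_uIoc] with r hr
      rw [uIoc_of_le (by linarith)] at hr
      exact (Q (t - r)).le_of_opNorm_le
        (hM _ ⟨by linarith [ht.1, hr.2], by linarith [ht.2, hr.1]⟩) _)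
    (by rw [intervalIntegrable_iff]; exact hw'.norm.const_mul M)
    (.of_forall fun r => (hQ.comp_continuous (by fun_prop) continuous_const).continuousAt)
    ⟨by linarith, by linarith⟩ ⟨by linarith, by linarith⟩ (by simp)
  have h2 : ContinuousAt (fun t => ∫ r in (0 : ℝ)..t, Q (t - r) (w' r)) t₀ :=
    ContinuousAt.comp (f := fun t : ℝ => (t, t)) (x := t₀) key
      (continuous_id.prodMk continuous_id).continuousAt
  refine h2.continuousWithinAt.congr (fun t ht => ?_) ?_
  all_goals
    refine intervalIntegral.integral_congr fun r hr => ?_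
    rw [uIcc_of_le (by assumption)] at hr
    simp only [w']
    rw [indicator_of_mem (show r ∈ Ici (0 : ℝ) from hr.1)]

end Convolution

namespace C0Semigroup

variable {X : Type*} [NormedAddCommGroup X] [NormedSpace ℂ X] [CompleteSpace X]

theorem J2_sub_eq_setIntegral (T : C0Semigroup X) {r t : ℝ} (hr : r ≤ t) (x : X) :
    T.J2 (t - r) x = ∫ s in Ioc r t, ((t - s : ℝ) : ℂ) • T.Tm (s - r) x := by
  rw [J2_apply, ← intervalIntegral.integral_of_le hr]
  have := intervalIntegral.integral_comp_sub_right (a := r) (b := t)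
    (fun s => ((t - r - s : ℝ) : ℂ) • T.Tm s x) r
  rw [sub_self] at this
  rw [← this]
  refine intervalIntegral.integral_congr fun s _ => ?_
  simp

theorem integral_weighted_convolution (T : C0Semigroup X) {t : ℝ} (ht : 0 ≤ t) {w : ℝ → X}
    (hw : IntervalIntegrable w volume 0 t) :
    ∫ s in (0 : ℝ)..t, ((t - s : ℝ) : ℂ) • ∫ r in (0 : ℝ)..s, T.T (s - r) (w r) =
      ∫ r in (0 : ℝ)..t, T.J2 (t - r) (w r) := by
  -- The integrand on the triangle r < s, extended by zero to the square (0, t]²; integrating it in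
  -- the two orders gives the two sides.
  let F : ℝ → ℝ → X := fun s r =>
    (Ioi r).indicator (fun s => ((t - s : ℝ) : ℂ) • T.Tm (s - r) (w r)) s
  rw [intervalIntegrable_iff_integrableOn_Ioc_of_le ht] at hw
  have h1 : ∀ s ∈ Ioc 0 t, ((t - s : ℝ) : ℂ) • ∫ r in (0 : ℝ)..s, T.T (s - r) (w r) =
      ∫ r in Ioc 0 t, F s r := by
    intro s hs
    rw [intervalIntegral.integral_of_le hs.1.le, ← integral_smul, integral_Ioc_eq_integral_Ioo]
    have : ∀ r, F s r =
        (Iio s).indicator (fun r => ((t - s : ℝ) : ℂ) • T.Tm (s - r) (w r)) r := by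
      intro r
      by_cases h : r < s
      · simp [F, h]
      · simp [F, h]
    simp only [this]
    rw [setIntegral_indicator measurableSet_Iio]
    have h2 : Ioc 0 t ∩ Iio s = Ioo 0 s := by
      ext r
      simp only [mem_inter_iff, mem_Ioc, mem_Iio, mem_Ioo]
      exact ⟨fun h => ⟨h.1.1, h.2⟩, fun h => ⟨⟨h.1, h.2.le.trans hs.2⟩, h.2⟩⟩
    rw [h2]
    refine setIntegral_congr_fun measurableSet_Ioo fun r hr => ?_
    rw [T.Tm_of_nonneg (by linarith [hr.2])]
  have h3 : ∀ r ∈ Ioc 0 t, T.J2 (t - r) (w r) = ∫ s in Ioc 0 t, F s r := by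
    intro r hr
    rw [T.J2_sub_eq_setIntegral hr.2, setIntegral_indicator measurableSet_Ioi]
    congr 2
    ext s
    simp only [mem_inter_iff, mem_Ioc, mem_Ioi]
    exact ⟨fun h => ⟨⟨hr.1.trans h.1, h.2⟩, h.1⟩, fun h => ⟨h.2, h.1.2⟩⟩
  rw [intervalIntegral.integral_of_le ht, intervalIntegral.integral_of_le ht,
    setIntegral_congr_fun measurableSet_Ioc h1, setIntegral_congr_fun measurableSet_Ioc h3]
  obtain ⟨M, hM0, hM⟩ := T.strongCont.exists_bound (-t) t
  refine integral_integral_swap ?_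
  refine Integrable.mono' (g := fun p : ℝ × ℝ => t * M * ‖w p.2‖)
    ((hw.norm.const_mul (t * M)).comp_snd (μ := volume.restrict (Ioc 0 t))) ?_ ?_
  · have hm : AEStronglyMeasurable (fun p : ℝ × ℝ => ((t - p.1 : ℝ) : ℂ) • T.Tm (p.1 - p.2) (w p.2))
        ((volume.restrict (Ioc 0 t)).prod (volume.restrict (Ioc 0 t))) := by
      refine (by fun_prop : Continuous fun p : ℝ × ℝ =>
        ((t - p.1 : ℝ) : ℂ)).aestronglyMeasurable.smul ?_
      exact Continuous.comp_aestronglyMeasurable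
        (g := fun p : ℝ × X => T.Tm p.1 p.2) T.strongCont
        ((by fun_prop : Continuous fun p : ℝ × ℝ => p.1 - p.2).aestronglyMeasurable.prodMk
          hw.aestronglyMeasurable.comp_snd)
    refine (hm.indicator (measurableSet_lt measurable_snd measurable_fst)).congr
      (.of_forall fun p => ?_)
    by_cases h : p.2 < p.1
    · simp [F, Function.uncurry, h]
    · simp [F, Function.uncurry, h]
  · rw [Measure.prod_restrict]
    filter_upwards [ae_restrict_mem (measurableSet_Ioc.prod measurableSet_Ioc)] with p hp
    obtain ⟨⟨h1, h2⟩, h3, h4⟩ := hp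
    refine (norm_indicator_le_norm_self (s := Ioi p.2)
      (fun s => ((t - s : ℝ) : ℂ) • T.Tm (s - p.2) (w p.2)) p.1).trans ?_
    rw [norm_smul, mul_assoc]
    refine mul_le_mul ?_ ((T.Tm _).le_of_opNorm_le
      (hM _ ⟨by linarith, by linarith⟩) _) (norm_nonneg _) ht
    rw [Complex.norm_real, Real.norm_eq_abs, abs_of_nonneg (by linarith)]
    linarith

theorem resolvent_J1 {T : C0Semigroup X} {α : ℂ} (hα : α ∈ T.halfPlane) (t : ℝ) (x : X) :
    resolvent T.generator α (T.J1 t x) = T.J1 t (resolvent T.generator α x) := by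
  rw [J1_apply, J1_apply, ← ContinuousLinearMap.intervalIntegral_comp_comm _
    ((T.continuous_Tm x).intervalIntegrable _ _)]
  simp only [resolvent_Tm hα]

/-- The operator family for which `D(t) R(α, A) = J₂(t)`. -/
def rampState (T : C0Semigroup X) (α : ℂ) (t : ℝ) : X →L[ℂ] X :=
  (t : ℂ) • ContinuousLinearMap.id ℂ X + α • T.J2 t - T.J1 t

theorem strongCont_rampState (T : C0Semigroup X) (α : ℂ) : StrongCont (T.rampState α) :=
  (((strongCont_const _).smul (by fun_prop)).add
    (T.strongCont_J2.smul continuous_const)).sub T.strongCont_J1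

theorem rampState_resolvent {T : C0Semigroup X} {α : ℂ} (hα : α ∈ T.halfPlane) {t : ℝ}
    (ht : 0 ≤ t) (x : X) : T.rampState α t (resolvent T.generator α x) = T.J2 t x := by
  have h := resolvent_J1_sub hα ht x
  simp only [rampState, add_apply, sub_apply, smul_apply, ContinuousLinearMap.id_apply]
  rw [← resolvent_J2 hα, ← resolvent_J1 hα]
  linear_combination (norm := module) -h

/-- The family `rampState` composed with R(α, A₋₁) is the extension of J₂(t) to X₋₁, with values in
X. The equation is stated after applying R(β, A), so that only J₂ on X occurs. -/
theorem resolvent_rampState {T : C0Semigroup X} {α β : ℂ} (hβ : β ∈ T.halfPlane)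
    (hα : α ∈ T.halfPlane) {t : ℝ} (ht : 0 ≤ t) (ξ : Extrap T.generator β) :
    resolvent T.generator β (T.rampState α t (resExt T.generator β α ξ)) =
      T.J2 t (resExt T.generator β β ξ) := by
  refine extrap_induction ξ (isClosed_eq (by fun_prop) (by fun_prop)) fun x => ?_
  rw [resExt_incl hβ hα, rampState_resolvent hα ht, resExt_incl hβ hβ, resolvent_J2 hβ]

end C0Semigroup

/-! ### The ramp response of a system node -/

theorem norm_domSpace {X : Type*} [NormedAddCommGroup X] [NormedSpace ℂ X] {A : X →ₗ.[ℂ] X}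
    (β : ℂ) (x : X) (h : x ∈ A.domain) : ‖DomSpace.mk β x h‖ = ‖β • x - A ⟨x, h⟩‖ := rfl

/-- The resolvent as an operator into `X₁`. -/
def resDom {X : Type*} [NormedAddCommGroup X] [NormedSpace ℂ X] [CompleteSpace X]
    (T : C0Semigroup X) (β : ℂ) {α : ℂ} (hα : α ∈ T.halfPlane) :
    X →L[ℂ] DomSpace T.generator β :=
  LinearMap.mkContinuousOfExistsBound
    { toFun := fun x => DomSpace.mk β _ ((T.isResolvent hα).mem_domain x)
      map_add' := fun x y => Subtype.ext (map_add _ _ _)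
      map_smul' := fun c x => Subtype.ext (map_smul _ _ _) }
    ⟨‖β - α‖ * ‖resolvent T.generator α‖ + 1, fun x => by
      change ‖DomSpace.mk β _ ((T.isResolvent hα).mem_domain x)‖ ≤ _
      rw [norm_domSpace, (T.isResolvent hα).apply_eq, add_mul, one_mul, mul_assoc,
        ← sub_add, ← sub_smul]
      refine (norm_add_le _ _).trans ?_
      rw [norm_smul]
      gcongr
      exact ContinuousLinearMap.le_opNorm _ _⟩

namespace SystemNode

variable {U X Y : Type*}
  [NormedAddCommGroup U] [NormedSpace ℂ U]
  [NormedAddCommGroup X] [NormedSpace ℂ X] [CompleteSpace X]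
  [NormedAddCommGroup Y] [NormedSpace ℂ Y]
  (S : SystemNode U X Y) {α : ℂ} (hα : α ∈ S.T.halfPlane)

/-- `C R(α, A)`. -/
def CR : X →L[ℂ] Y := S.C.comp (resDom S.T S.β hα)

theorem CR_apply (x : X) :
    S.CR hα x = S.C (DomSpace.mk S.β _ ((S.T.isResolvent hα).mem_domain x)) := rfl

/-- `R(α, A₋₁) B`. -/
def RB (α : ℂ) : U →L[ℂ] X := (resExt S.A S.β α).comp S.B

/-- The output at time `t` with zero initial state and input `t u`. -/
def rampResponse (t : ℝ) : U →L[ℂ] Y :=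
  (S.CR hα).comp ((S.T.P α (max t 0)).comp (S.RB α)) + ((max t 0 : ℝ) : ℂ) • S.G α

theorem strongCont_rampResponse : StrongCont (S.rampResponse hα) :=
  ((((S.T.strongCont_P α).comp_real (continuous_id.max continuous_const)).comp_clm _).clm_comp
    _).add ((strongCont_const _).smul (by fun_prop))

theorem rampResponse_of_nonpos {t : ℝ} (ht : t ≤ 0) : S.rampResponse hα t = 0 := by
  rw [rampResponse, max_eq_right ht, C0Semigroup.P_zero]
  simp

/-- C&D does not depend on the reference point: replacing β by α changes the C term by exactly what
the functional equation of G compensates. The freedom in α is needed because a dual node brings its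
own reference point, unrelated to that of S. -/
theorem cd_eq {p : X × U} {q : X}
    (h : p.1 - resExt S.A S.β α (S.B p.2) = resolvent S.A α q) :
    S.cd p = S.CR hα q + S.G α p.2 := by
  obtain ⟨h1, h2⟩ := S.G_sub α hα S.β S.β_mem p.2
  have hq := (S.T.isResolvent hα).mem_domain q
  have h3 : p.1 - resExt S.A S.β S.β (S.B p.2) = resolvent S.A α q +
      (resExt S.A S.β α (S.B p.2) - resExt S.A S.β S.β (S.B p.2)) := by
    rw [← h]; abel
  have h4 : p.1 - resExt S.A S.β S.β (S.B p.2) ∈ S.A.domain :=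
    h3 ▸ S.A.domain.add_mem hq h1
  rw [cd, dif_pos h4, S.CR_apply hα]
  have h5 : DomSpace.mk S.β _ h4 = DomSpace.mk S.β _ hq + DomSpace.mk S.β _ h1 := Subtype.ext h3
  rw [h5, map_add, ← h2]
  abel

variable [CompleteSpace U] {u : ℝ → U}

theorem ramp_intervalIntegrable (hu : MemLpLoc 1 u) {t : ℝ} (ht : 0 ≤ t) :
    IntervalIntegrable (fun s => ((t - s : ℝ) : ℂ) • u s) volume 0 t :=
  ((strongCont_const (ContinuousLinearMap.id ℂ U)).smul
    (c := fun s => (s : ℂ)) (by fun_prop)).intervalIntegrable (hu.intervalIntegrable ht) t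

/-- Here `rampState` minus t is αJ₂ - J₁ = R(α, A) P, so `cd_eq` applies with an explicit q, and C
R(α, A), being bounded, passes under the integral. -/
theorem cd_integral [CompleteSpace Y] (hu : MemLpLoc 1 u) {t : ℝ} (ht : 0 ≤ t) :
    S.cd (∫ r in (0 : ℝ)..t, S.T.rampState α (t - r) (S.RB α (u r)),
      ∫ s in (0 : ℝ)..t, ((t - s : ℝ) : ℂ) • u s) =
    ∫ r in (0 : ℝ)..t, S.rampResponse hα (t - r) (u r) := by
  have hi := hu.intervalIntegrable ht
  have hr := ramp_intervalIntegrable hu ht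
  have hP : IntervalIntegrable (fun r => S.T.P α (t - r) (S.RB α (u r))) volume 0 t :=
    (((S.T.strongCont_P α).comp_clm (S.RB α))).intervalIntegrable hi t
  have hs : IntervalIntegrable (fun r => S.T.rampState α (t - r) (S.RB α (u r))) volume 0 t :=
    ((S.T.strongCont_rampState α).comp_clm (S.RB α)).intervalIntegrable hi t
  have hB : IntervalIntegrable (fun r => ((t - r : ℝ) : ℂ) • S.RB α (u r)) volume 0 t :=
    ((strongCont_const (S.RB α)).smul (c := fun s => (s : ℂ)) (by fun_prop)).intervalIntegrable
      hi t
  have hCP : IntervalIntegrable (fun r => S.CR hα (S.T.P α (t - r) (S.RB α (u r)))) volume 0 t :=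
    (((S.T.strongCont_P α).comp_clm (S.RB α)).clm_comp (S.CR hα)).intervalIntegrable hi t
  have hG : IntervalIntegrable (fun r => S.G α (((t - r : ℝ) : ℂ) • u r)) volume 0 t := by
    simp only [map_smul]
    exact ((strongCont_const (S.G α)).smul (c := fun s => (s : ℂ)) (by fun_prop)).intervalIntegrable
      hi t
  rw [S.cd_eq hα (q := ∫ r in (0 : ℝ)..t, S.T.P α (t - r) (S.RB α (u r)))]
  · rw [← ContinuousLinearMap.intervalIntegral_comp_comm _ hP,
      ← ContinuousLinearMap.intervalIntegral_comp_comm _ hr, ← intervalIntegral.integral_add hCP hG]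
    refine intervalIntegral.integral_congr fun r hr => ?_
    rw [uIcc_of_le ht] at hr
    simp [rampResponse, max_eq_left (sub_nonneg.2 hr.2)]
  · have h1 : resExt S.A S.β α (S.B (∫ s in (0 : ℝ)..t, ((t - s : ℝ) : ℂ) • u s)) =
        ∫ r in (0 : ℝ)..t, ((t - r : ℝ) : ℂ) • S.RB α (u r) := by
      have := (S.RB α).intervalIntegral_comp_comm hr
      simp only [map_smul] at this
      exact this.symm
    rw [h1, ← ContinuousLinearMap.intervalIntegral_comp_comm _ hP,
      ← intervalIntegral.integral_sub hs hB]
    refine intervalIntegral.integral_congr fun r hr => ?_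
    rw [uIcc_of_le ht] at hr
    rw [C0Semigroup.resolvent_P hα (sub_nonneg.2 hr.2)]
    simp only [C0Semigroup.rampState, add_apply, sub_apply, smul_apply,
      ContinuousLinearMap.id_apply]
    abel

end SystemNode

/-! ### Generalised solutions -/

theorem distrOf_congr {E : Type*} [NormedAddCommGroup E] [NormedSpace ℂ E] {f g : ℝ → E}
    (h : ∀ t, 0 ≤ t → f t = g t) : distrOf f = distrOf g := by
  have : (Ici (0 : ℝ)).indicator f = (Ici (0 : ℝ)).indicator g := indicator_congr h
  rw [distrOf, this, distrOf]

/-- An isometry commutes with the Bochner integral even without integrability, so integrability in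
X₋₁ never has to be established. -/
theorem map_intervalIntegral_linearIsometry {E F : Type*} [NormedAddCommGroup E]
    [NormedSpace ℂ E] [CompleteSpace E] [NormedAddCommGroup F] [NormedSpace ℂ F] [CompleteSpace F]
    (L : E →ₗᵢ[ℂ] F) (f : ℝ → E) {t : ℝ} (ht : 0 ≤ t) :
    L (∫ s in (0 : ℝ)..t, f s) = ∫ s in (0 : ℝ)..t, L (f s) := by
  rw [intervalIntegral.integral_of_le ht, intervalIntegral.integral_of_le ht,
    LinearIsometry.integral_comp_comm]

namespace SystemNode

variable {U X Y : Type*}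
  [NormedAddCommGroup U] [NormedSpace ℂ U]
  [NormedAddCommGroup X] [NormedSpace ℂ X] [CompleteSpace X]
  [NormedAddCommGroup Y] [NormedSpace ℂ Y]
  (S : SystemNode U X Y) {α : ℂ} (hα : α ∈ S.T.halfPlane) {u : ℝ → U}

theorem resIso_mild {t : ℝ} (ht : 0 ≤ t) :
    resIso S.β_mem (∫ s in (0 : ℝ)..t, S.T.ext S.β (t - s) (S.B (u s))) =
      ∫ s in (0 : ℝ)..t, S.T.T (t - s) (S.RB S.β (u s)) := by
  rw [map_intervalIntegral_linearIsometry _ _ ht]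
  refine intervalIntegral.integral_congr fun s hs => ?_
  rw [uIcc_of_le ht] at hs
  exact resExt_ext S.β_mem (sub_nonneg.2 hs.2) _

theorem RB_memLpLoc (hu : MemLpLoc 1 u) (α : ℂ) : MemLpLoc 1 fun r => S.RB α (u r) :=
  fun t ht => (S.RB α).comp_memLp' (hu t ht)

variable [CompleteSpace U]

/-- After applying R(β, A₋₁) both sides lie in X. Exchanging the order of integration turns the
twice integrated mild solution into a convolution with J₂, which `resolvent_rampState` identifies.
-/
theorem incl_rampState_eq {x : ℝ → S.XExt} (hu : MemLpLoc 1 u)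
    (hx : ∀ t, 0 ≤ t → x t = ∫ s in (0 : ℝ)..t, S.T.ext S.β (t - s) (S.B (u s)))
    (hα : α ∈ S.T.halfPlane) {t : ℝ} (ht : 0 ≤ t) :
    incl S.A S.β (∫ r in (0 : ℝ)..t, S.T.rampState α (t - r) (S.RB α (u r))) =
      ∫ s in (0 : ℝ)..t, ((t - s : ℝ) : ℂ) • x s := by
  apply (resIso S.β_mem).injective
  have hi := hu.intervalIntegrable ht
  have hs : IntervalIntegrable (fun r => S.T.rampState α (t - r) (S.RB α (u r))) volume 0 t :=
    ((S.T.strongCont_rampState α).comp_clm (S.RB α)).intervalIntegrable hi t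
  rw [map_intervalIntegral_linearIsometry _ _ ht, resIso_apply,
    resExt_incl S.β_mem S.β_mem, ← ContinuousLinearMap.intervalIntegral_comp_comm _ hs]
  have h1 := S.T.integral_weighted_convolution ht
    ((S.RB_memLpLoc hu S.β).intervalIntegrable ht)
  trans ∫ r in (0 : ℝ)..t, S.T.J2 (t - r) (S.RB S.β (u r))
  · refine intervalIntegral.integral_congr fun r hr => ?_
    rw [uIcc_of_le ht] at hr
    exact C0Semigroup.resolvent_rampState S.β_mem hα (sub_nonneg.2 hr.2) _
  · rw [← h1]
    refine intervalIntegral.integral_congr fun r hr => ?_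
    rw [uIcc_of_le ht] at hr
    simp only [map_smul]
    rw [hx r hr.1, S.resIso_mild hr.1]

theorem rampState_mem_cdDomain (hu : MemLpLoc 1 u) {t : ℝ} (ht : 0 ≤ t) :
    (∫ r in (0 : ℝ)..t, S.T.rampState S.β (t - r) (S.RB S.β (u r)),
      ∫ s in (0 : ℝ)..t, ((t - s : ℝ) : ℂ) • u s) ∈ S.cdDomain := by
  have hβ := S.β_mem
  have hi := hu.intervalIntegrable ht
  have hw := (S.RB_memLpLoc hu S.β).intervalIntegrable ht
  have hr := ramp_intervalIntegrable hu ht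
  have hs : IntervalIntegrable (fun r => S.T.rampState S.β (t - r) (S.RB S.β (u r))) volume 0 t :=
    (S.T.strongCont_rampState S.β).intervalIntegrable hw t
  have hR : IntervalIntegrable (fun r => S.β • resolvent S.A S.β
      (S.T.rampState S.β (t - r) (S.RB S.β (u r)))) volume 0 t :=
    (((S.T.strongCont_rampState S.β).clm_comp (resolvent S.A S.β)).smul
      (continuous_const (y := S.β))).intervalIntegrable hw t
  have hB : IntervalIntegrable (fun r => ((t - r : ℝ) : ℂ) • S.RB S.β (u r)) volume 0 t :=
    ((strongCont_const (S.RB S.β)).smul (c := fun s => (s : ℂ)) (by fun_prop)).intervalIntegrable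
      hi t
  have hz : IntervalIntegrable (fun r => S.RB S.β (u r) + S.β • S.T.J1 (t - r) (S.RB S.β (u r))
      - S.T.Tm (t - r) (S.RB S.β (u r))) volume 0 t :=
    (((strongCont_const (ContinuousLinearMap.id ℂ X)).add
      (S.T.strongCont_J1.smul (continuous_const (y := S.β)))).sub
        S.T.strongCont).intervalIntegrable hw t
  -- The witness is the integrated state ∫ J₁(t - r) B u(r) dr, formally A₋₁ ∫ J₂(t - r) B u(r) dr +
  -- B ∫ (t - r) u(r) dr. Writing B = (β - A₋₁) R(β, A₋₁) B and using A J₁ = T - 1 brings it into X.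
  refine ⟨∫ r in (0 : ℝ)..t, (S.RB S.β (u r) + S.β • S.T.J1 (t - r) (S.RB S.β (u r))
      - S.T.Tm (t - r) (S.RB S.β (u r))), (resIso hβ).injective ?_⟩
  have h1 : resExt S.A S.β S.β (S.B (∫ s in (0 : ℝ)..t, ((t - s : ℝ) : ℂ) • u s)) =
      ∫ r in (0 : ℝ)..t, ((t - r : ℝ) : ℂ) • S.RB S.β (u r) := by
    have := (S.RB S.β).intervalIntegral_comp_comm hr
    simp only [map_smul] at this
    exact this.symm
  rw [map_add]
  simp only [resIso_apply]
  rw [h1, resExt_incl hβ hβ, resExt_genExt hβ, ← ContinuousLinearMap.intervalIntegral_comp_comm _ hs,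
    ← ContinuousLinearMap.intervalIntegral_comp_comm _ hz, ← intervalIntegral.integral_smul,
    ← intervalIntegral.integral_sub hR hs, ← intervalIntegral.integral_add (hR.sub hs) hB]
  refine intervalIntegral.integral_congr fun r hr => ?_
  rw [uIcc_of_le ht] at hr
  have htr := sub_nonneg.2 hr.2
  have h2 := C0Semigroup.resolvent_rampState hβ hβ htr (S.B (u r))
  have h3 := C0Semigroup.resolvent_T_sub hβ htr (S.RB S.β (u r))
  have h4 : resExt S.A S.β S.β (S.B (u r)) = S.RB S.β (u r) := rfl
  rw [h4] at h2
  rw [h2]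
  simp only [map_add, map_sub, map_smul, C0Semigroup.rampState, add_apply, sub_apply, smul_apply,
    ContinuousLinearMap.id_apply, S.T.Tm_of_nonneg htr]
  linear_combination (norm := module) h3

/-- Stability only speaks about given solutions; this supplies one for each input, so that the
hypothesis can be applied. -/
theorem exists_isGeneralisedSolution (hu : MemLpLoc 1 u) :
    ∃ (x : ℝ → S.XExt) (y : Distr Y), IsGeneralisedSolution S u x y ∧ x 0 = 0 := by
  let x : ℝ → S.XExt := fun t => ∫ s in (0 : ℝ)..t, S.T.ext S.β (t - s) (S.B (u s))
  refine ⟨x, LineDeriv.lineDerivOp (1 : ℝ) (LineDeriv.lineDerivOp (1 : ℝ) (distrOf fun t =>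
    S.cd (∫ r in (0 : ℝ)..t, S.T.rampState S.β (t - r) (S.RB S.β (u r)),
      ∫ s in (0 : ℝ)..t, ((t - s : ℝ) : ℂ) • u s))), ⟨hu, ?_, ⟨0, fun t ht => ?_⟩, ?_⟩, ?_⟩
  rotate_left 2
  · refine ⟨fun t => ∫ r in (0 : ℝ)..t, S.T.rampState S.β (t - r) (S.RB S.β (u r)),
      fun t ht => S.incl_rampState_eq hu (fun _ _ => rfl) S.β_mem ht,
      fun t ht => S.rampState_mem_cdDomain hu ht, rfl⟩
  · simp [x]
  · rw [(resIso S.β_mem).isometry.isEmbedding.continuousOn_iff]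
    refine (S.T.strongCont.continuousOn_convolution (S.RB_memLpLoc hu S.β)).congr fun t ht => ?_
    simp only [Function.comp_apply, x]
    rw [S.resIso_mild ht]
    refine intervalIntegral.integral_congr fun r hr => ?_
    rw [uIcc_of_le ht] at hr
    rw [S.T.Tm_of_nonneg (sub_nonneg.2 hr.2)]
  · simp [x]

end SystemNode

/-- The condition x(0) = 0 removes the initial state, and injectivity of X → X₋₁ determines K. Hence
the output is fixed by the input through the ramp response, which may be formed at any α in the
half-plane. -/
theorem IsGeneralisedSolution.output_eq {U X Y : Type*}
    [NormedAddCommGroup U] [NormedSpace ℂ U] [CompleteSpace U]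
    [NormedAddCommGroup X] [NormedSpace ℂ X] [CompleteSpace X]
    [NormedAddCommGroup Y] [NormedSpace ℂ Y] [CompleteSpace Y] {S : SystemNode U X Y} {α : ℂ}
    (hα : α ∈ S.T.halfPlane) {u : ℝ → U} {x : ℝ → S.XExt} {y : Distr Y}
    (h : IsGeneralisedSolution S u x y) (hx0 : x 0 = 0) :
    y = LineDeriv.lineDerivOp (1 : ℝ) (LineDeriv.lineDerivOp (1 : ℝ)
      (distrOf fun t => ∫ r in (0 : ℝ)..t, S.rampResponse hα (t - r) (u r))) := by
  obtain ⟨K, hK, -, rfl⟩ := h.output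
  obtain ⟨x₀, hx⟩ := h.state
  have h0 : incl S.A S.β x₀ = 0 := by
    have := hx 0 le_rfl
    rw [hx0, intervalIntegral.integral_same, add_zero, ext_incl S.β_mem le_rfl, S.T.T_zero] at this
    exact this.symm
  simp only [h0, map_zero, zero_add] at hx
  congr 2
  refine distrOf_congr fun t ht => ?_
  have h1 := S.incl_rampState_eq h.input hx hα ht
  rw [← hK t ht] at h1
  rw [← incl_injective S.β_mem h1, S.cd_integral hα h.input ht]

/-! ### Adjoints of bounded operators -/

section AdjointOperator

variable {U Y : Type*} [NormedAddCommGroup U] [NormedSpace ℂ U]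
  [NormedAddCommGroup Y] [NormedSpace ℂ Y]

/-- The adjoint `v ↦ v ∘ L`, depending conjugate-linearly on `L`. -/
def adj : (U →L[ℂ] Y) →L⋆[ℂ] AntiDual Y →L[ℂ] AntiDual U :=
  LinearMap.mkContinuous₂ (LinearMap.mk₂'ₛₗ (starRingEnd ℂ) (RingHom.id ℂ)
    (fun (L : U →L[ℂ] Y) (v : AntiDual Y) => v.comp L)
    (fun _ _ _ => by ext; simp) (fun _ _ _ => by ext; simp) (fun _ _ _ => by ext; simp)
    (fun _ _ _ => by ext; simp)) 1
    (fun L v => by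
      rw [one_mul, mul_comm]
      exact ContinuousLinearMap.opNorm_comp_le _ _)

theorem adj_apply (L : U →L[ℂ] Y) (v : AntiDual Y) (u : U) : adj L v u = v (L u) := rfl

/-- Taking adjoints is conjugate-linear, and the conjugation of the variable undoes this on
difference quotients, so the result is again complex differentiable. -/
theorem hasDerivAt_adj_conj {G : ℂ → U →L[ℂ] Y} {D : U →L[ℂ] Y} {z : ℂ}
    (h : HasDerivAt G D (starRingEnd ℂ z)) :
    HasDerivAt (fun w => adj (G (starRingEnd ℂ w))) (adj D) z := by
  rw [hasDerivAt_iff_tendsto_slope] at h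
  refine (hasDerivAt_iff_tendsto_slope (𝕜 := ℂ) (F := AntiDual Y →L[ℂ] AntiDual U)).2 ?_
  have h1 : Tendsto (starRingEnd ℂ) (𝓝[≠] z) (𝓝[≠] (starRingEnd ℂ z)) := by
    refine tendsto_nhdsWithin_iff.2 ⟨(Complex.continuous_conj.tendsto z).mono_left
      nhdsWithin_le_nhds, ?_⟩
    filter_upwards [self_mem_nhdsWithin] with w hw
    exact fun h => hw ((starRingEnd ℂ).injective h)
  refine (((adj (U := U) (Y := Y)).continuous.tendsto D).comp (h.comp h1)).congr fun w => ?_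
  simp [slope_def_module]

end AdjointOperator

theorem isOpen_halfPlane {X : Type*} [NormedAddCommGroup X] [NormedSpace ℂ X]
    (T : C0Semigroup X) : IsOpen T.halfPlane :=
  isOpen_lt continuous_const (continuous_coe_real_ereal.comp Complex.continuous_re)

/-! ### The dual system node -/

section DualNode

variable {U X Y : Type*}
  [NormedAddCommGroup U] [NormedSpace ℂ U]
  [NormedAddCommGroup X] [NormedSpace ℂ X] [CompleteSpace X]
  [NormedAddCommGroup Y] [NormedSpace ℂ Y]

/-- The range of an isometry on a complete space is closed, and this one contains the dense subspace
D(A). The inverse is needed to define C* with values in (X*)₋₁. -/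
theorem resIso_surjective {T : C0Semigroup X} {β : ℂ} (hβ : β ∈ T.halfPlane) :
    Function.Surjective (resIso hβ) := by
  have h1 : IsClosed (range (resIso hβ)) := (resIso hβ).isometry.isClosedEmbedding.isClosed_range
  have h2 : (T.generator.domain : Set X) ⊆ range (resIso hβ) := fun x hx =>
    ⟨incl _ _ (β • x - T.generator ⟨x, hx⟩), by
      rw [resIso_apply, resExt_incl hβ hβ, (T.isResolvent hβ).left_inv ⟨x, hx⟩]⟩
  rw [← range_eq_univ, ← h1.closure_eq]
  exact (T.dense_domain.mono h2).closure_eq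

/-- The operator `β - A : X₁ → X`, which is isometric. -/
def shiftCLM (A : X →ₗ.[ℂ] X) (β : ℂ) : DomSpace A β →L[ℂ] X :=
  (DomSpace.shift A β).mkContinuous 1 fun x => by rw [one_mul]; exact le_rfl

theorem shiftCLM_eq {T : C0Semigroup X} {β : ℂ} (hβ : β ∈ T.halfPlane) {x q : X}
    (hx : x ∈ T.generator.domain) (h : resolvent T.generator β q = x) :
    shiftCLM T.generator β (DomSpace.mk β x hx) = q := by
  subst h
  exact (T.isResolvent hβ).right_inv q

theorem resolvent_resExt_sub {T : C0Semigroup X} {β z w : ℂ} (hβ : β ∈ T.halfPlane)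
    (hz : z ∈ T.halfPlane) (hw : w ∈ T.halfPlane) (ξ : Extrap T.generator β) :
    resolvent T.generator β ((β - z) • resExt T.generator β z ξ -
      (β - w) • resExt T.generator β w ξ) =
      resExt T.generator β z ξ - resExt T.generator β w ξ := by
  have h1 := resExt_sub hβ hβ hz ξ
  have h2 := resExt_sub hβ hβ hw ξ
  simp only [map_sub, map_smul]
  linear_combination (norm := module) h1 - h2

variable {T' : C0Semigroup (AntiDual X)}

/-- By the resolvent identity, both sides are the same expression in R(conj β, A*₋₁) ζ and R(β, A₋₁)
ξ once the remaining bounded resolvent is moved across the pairing. -/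
theorem resExt_dual_apply {T : C0Semigroup X} (h : T'.generator = adjoint T.generator) {β z : ℂ}
    (hβ : β ∈ T.halfPlane) (hz : z ∈ T'.halfPlane)
    (ζ : Extrap T'.generator (starRingEnd ℂ β)) (ξ : Extrap T.generator β) :
    resExt T'.generator (starRingEnd ℂ β) z ζ (resExt T.generator β β ξ) =
      resExt T'.generator (starRingEnd ℂ β) (starRingEnd ℂ β) ζ
        (resExt T.generator β (starRingEnd ℂ z) ξ) := by
  have hβ' : starRingEnd ℂ β ∈ T'.halfPlane := dual_halfPlane h ▸ conj_mem_halfPlane hβ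
  have hz' : starRingEnd ℂ z ∈ T.halfPlane := conj_mem_halfPlane (dual_halfPlane h ▸ hz)
  rw [resExt_sub hβ' hz hβ', resExt_sub hβ hz' hβ]
  simp only [add_apply, smul_apply, map_add, map_smulₛₗ, dual_resolvent_apply h hz]
  simp

variable (S : SystemNode U X Y)

/-- The inverse of the extended resolvent. -/
def resInv {T : C0Semigroup X} {β : ℂ} (hβ : β ∈ T.halfPlane) : X →L[ℂ] Extrap T.generator β :=
  (LinearIsometryEquiv.ofSurjective (resIso hβ)
    (resIso_surjective hβ)).symm.toContinuousLinearEquiv.toContinuousLinearMap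

theorem resExt_resInv {T : C0Semigroup X} {β : ℂ} (hβ : β ∈ T.halfPlane) (x : X) :
    resExt T.generator β β (resInv hβ x) = x :=
  (LinearIsometryEquiv.ofSurjective (resIso hβ) (resIso_surjective hβ)).apply_symm_apply x

/-- The hypothesis on ζ says that it represents C* v. The functional equation of the dual transfer
function is then that of G at the conjugate points, tested on each u. -/
theorem dual_transfer_sub (h : T'.generator = adjoint S.T.generator) {z w : ℂ}
    (hz : z ∈ T'.halfPlane) (hw : w ∈ T'.halfPlane) (v : AntiDual Y)
    (ζ : Extrap T'.generator (starRingEnd ℂ S.β))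
    (hζ : resExt T'.generator (starRingEnd ℂ S.β) (starRingEnd ℂ S.β) ζ = adj (S.CR S.β_mem) v) :
    ∃ hm : resExt T'.generator (starRingEnd ℂ S.β) z ζ -
        resExt T'.generator (starRingEnd ℂ S.β) w ζ ∈ T'.generator.domain,
      adj (S.G (starRingEnd ℂ z)) v - adj (S.G (starRingEnd ℂ w)) v =
        adj (S.RB S.β) (shiftCLM T'.generator (starRingEnd ℂ S.β) (DomSpace.mk _ _ hm)) := by
  have hβ' : starRingEnd ℂ S.β ∈ T'.halfPlane := dual_halfPlane h ▸ conj_mem_halfPlane S.β_mem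
  have hz' : starRingEnd ℂ z ∈ S.T.halfPlane := conj_mem_halfPlane (dual_halfPlane h ▸ hz)
  have hw' : starRingEnd ℂ w ∈ S.T.halfPlane := conj_mem_halfPlane (dual_halfPlane h ▸ hw)
  refine ⟨resExt_sub_mem hβ' hz hw _, ?_⟩
  rw [shiftCLM_eq hβ' _ (resolvent_resExt_sub hβ' hz hw _)]
  ext u
  obtain ⟨h1, h2⟩ := S.G_sub _ hz' _ hw' u
  have h3 := resolvent_resExt_sub S.β_mem hz' hw' (S.B u)
  have h5 : DomSpace.mk S.β _ h1 = DomSpace.mk S.β _ ((S.T.isResolvent S.β_mem).mem_domain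
      ((S.β - starRingEnd ℂ z) • resExt S.A S.β (starRingEnd ℂ z) (S.B u) -
        (S.β - starRingEnd ℂ w) • resExt S.A S.β (starRingEnd ℂ w) (S.B u))) :=
    Subtype.ext h3.symm
  have h6 : ∀ q, resExt T'.generator (starRingEnd ℂ S.β) (starRingEnd ℂ S.β) ζ q =
      v (S.CR S.β_mem q) := fun q => by rw [hζ, adj_apply]
  rw [sub_apply, adj_apply, adj_apply, ← map_sub, h2, h5, ← S.CR_apply S.β_mem, ← h6, adj_apply,
    sub_apply, smul_apply, smul_apply, SystemNode.RB, ContinuousLinearMap.comp_apply,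
    resExt_dual_apply h S.β_mem hz, resExt_dual_apply h S.β_mem hw, map_sub, map_smulₛₗ,
    map_smulₛₗ]
  simp

/-- The dual system node, for a semigroup generated by `A*`. -/
def dualNode (h : T'.generator = adjoint S.T.generator) :
    SystemNode (AntiDual Y) (AntiDual X) (AntiDual U) where
  T := T'
  β := starRingEnd ℂ S.β
  β_mem := dual_halfPlane h ▸ conj_mem_halfPlane S.β_mem
  -- Forced by R(conj β, A*₋₁) C* = (C R(β, A))*.
  B := (resInv (T := T') (dual_halfPlane h ▸ conj_mem_halfPlane S.β_mem)).comp
    (adj (S.CR S.β_mem))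
  -- On D(A*) one has B* f = (R(β, A₋₁) B)* (conj β - A*) f.
  C := (adj (S.RB S.β)).comp (shiftCLM _ _)
  G z := adj (S.G (starRingEnd ℂ z))
  analytic := by
    refine DifferentiableOn.analyticOnNhd (fun z hz => ?_) (isOpen_halfPlane T')
    have hz' : starRingEnd ℂ z ∈ S.T.halfPlane := conj_mem_halfPlane (dual_halfPlane h ▸ hz)
    exact (hasDerivAt_adj_conj (S.analytic _ hz').differentiableAt.hasDerivAt
      ).differentiableAt.differentiableWithinAt
  G_sub z hz w hw v := dual_transfer_sub S h hz hw v _ (resExt_resInv _ _)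

theorem isDualNode_dualNode (h : T'.generator = adjoint S.T.generator) :
    IsDualNode S (dualNode S h) where
  generator_eq := h
  input_eq v x := by
    have hβ' : starRingEnd ℂ S.β ∈ T'.halfPlane := dual_halfPlane h ▸ conj_mem_halfPlane S.β_mem
    have key : ∀ x : S.T.generator.domain, extrapEval T'.generator (starRingEnd ℂ S.β) (x : X)
        (resInv hβ' (adj (S.CR S.β_mem) v)) = v (S.C (DomSpace.mk S.β (x : X) x.2)) := by
      intro x
      rw [extrapEval_apply h hβ' x, resExt_resInv, adj_apply, S.CR_apply, Complex.conj_conj]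
      congr 2
      exact Subtype.ext ((S.T.isResolvent S.β_mem).left_inv x)
    exact key x
  output_eq f u := by
    have hβ' : starRingEnd ℂ S.β ∈ T'.halfPlane := dual_halfPlane h ▸ conj_mem_halfPlane S.β_mem
    have h1 : (DomSpace.val f : AntiDual X) =
        (shiftCLM _ _ f : AntiDual X).comp (resolvent S.A S.β) := by
      ext x
      have h2 := (T'.isResolvent hβ').left_inv f
      have h3 := dual_resolvent_apply h hβ' (shiftCLM _ _ f) x
      rw [Complex.conj_conj] at h3
      exact (congrArg (fun f : AntiDual X => f x) h2.symm).trans h3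
    rw [h1, functionalExt_apply S.β_mem S.β_mem]
    rfl
  transfer_eq z hz v u := rfl

end DualNode

/-! ### The ramp response of the dual node -/

section DualRamp

variable {U X Y : Type*}
  [NormedAddCommGroup U] [NormedSpace ℂ U]
  [NormedAddCommGroup X] [NormedSpace ℂ X] [CompleteSpace X]
  [NormedAddCommGroup Y] [NormedSpace ℂ Y]
  {T : C0Semigroup X} {T' : C0Semigroup (AntiDual X)}

theorem dual_Tm_apply (h : T'.generator = adjoint T.generator) (t : ℝ) (f : AntiDual X) (x : X) :
    T'.Tm t f x = f (T.Tm t x) :=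
  dual_T_apply h (le_max_right _ _) f x

theorem intervalIntegral_antiDual_apply {W : Type*} [NormedAddCommGroup W] [NormedSpace ℂ W]
    {g : ℝ → AntiDual W} {t : ℝ} (hg : IntervalIntegrable g volume 0 t) (x : W) :
    (∫ s in (0 : ℝ)..t, g s) x = ∫ s in (0 : ℝ)..t, g s x :=
  (((pairing W).flip x).intervalIntegral_comp_comm hg).symm

theorem antiDual_apply_intervalIntegral (f : AntiDual X) {g : ℝ → X} {t : ℝ}
    (hg : IntervalIntegrable g volume 0 t) :
    f (∫ s in (0 : ℝ)..t, g s) = ∫ s in (0 : ℝ)..t, f (g s) :=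
  ((pairing X f).intervalIntegral_comp_comm hg).symm

theorem dual_J1_apply (h : T'.generator = adjoint T.generator) (t : ℝ) (f : AntiDual X) (x : X) :
    T'.J1 t f x = f (T.J1 t x) := by
  rw [C0Semigroup.J1_apply, C0Semigroup.J1_apply,
    intervalIntegral_antiDual_apply ((T'.continuous_Tm f).intervalIntegrable _ _),
    antiDual_apply_intervalIntegral f ((T.continuous_Tm x).intervalIntegrable _ _)]
  simp only [dual_Tm_apply h]

theorem dual_J2_apply (h : T'.generator = adjoint T.generator) (t : ℝ) (f : AntiDual X) (x : X) :
    T'.J2 t f x = f (T.J2 t x) := by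
  rw [C0Semigroup.J2_apply, C0Semigroup.J2_apply,
    intervalIntegral_antiDual_apply ((T'.continuous_weighted t f).intervalIntegrable _ _),
    antiDual_apply_intervalIntegral f ((T.continuous_weighted t x).intervalIntegrable _ _)]
  simp only [smul_apply, dual_Tm_apply h, map_smulₛₗ, Complex.conj_ofReal]

theorem dual_P_apply (h : T'.generator = adjoint T.generator) (α : ℂ) (t : ℝ) (f : AntiDual X)
    (x : X) : T'.P α t f x = f (T.P (starRingEnd ℂ α) t x) := by
  simp only [C0Semigroup.P, add_apply, sub_apply, smul_apply, ContinuousLinearMap.id_apply,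
    dual_J1_apply h, dual_J2_apply h, dual_Tm_apply h, map_add, map_sub, map_smulₛₗ]
  simp [show (starRingEnd ℂ) 2 = 2 from map_ofNat _ 2]

variable {S : SystemNode U X Y} {Sd : SystemNode (AntiDual Y) (AntiDual X) (AntiDual U)}

theorem IsDualNode.halfPlane_eq (hD : IsDualNode S Sd) : Sd.T.halfPlane = S.T.halfPlane :=
  dual_halfPlane hD.generator_eq

theorem IsDualNode.conj_mem (hD : IsDualNode S Sd) : starRingEnd ℂ Sd.β ∈ S.T.halfPlane :=
  conj_mem_halfPlane (hD.halfPlane_eq ▸ Sd.β_mem)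

/-- Together with `IsDualNode.CR_apply` this extracts from the abstract pairings the only facts used
about an arbitrary dual node: its R B and C R are the adjoints of C R and R B of S at the conjugate
point. -/
theorem IsDualNode.RB_apply (hD : IsDualNode S Sd) (v : AntiDual Y) (q : X) :
    Sd.RB Sd.β v q = v (S.CR hD.conj_mem q) := by
  have h1 := hD.input_eq v (DomSpace.mk S.β _ ((S.T.isResolvent hD.conj_mem).mem_domain q))
  have h2 := extrapEval_apply hD.generator_eq Sd.β_mem
    ⟨_, (S.T.isResolvent hD.conj_mem).mem_domain q⟩ (Sd.B v)
  rw [(S.T.isResolvent hD.conj_mem).right_inv] at h2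
  exact h2.symm.trans h1

theorem IsDualNode.CR_apply (hD : IsDualNode S Sd) (g : AntiDual X) (u : U) :
    Sd.CR Sd.β_mem g u = g (S.RB (starRingEnd ℂ Sd.β) u) := by
  have h1 := hD.output_eq (DomSpace.mk Sd.β _ ((Sd.T.isResolvent Sd.β_mem).mem_domain g)) u
  have h2 : resolvent Sd.A Sd.β g = g.comp (resolvent S.A (starRingEnd ℂ Sd.β)) := by
    ext x
    exact dual_resolvent_apply hD.generator_eq Sd.β_mem g x
  have h3 := functionalExt_apply S.β_mem hD.conj_mem g (S.B u)
  rw [← h2] at h3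
  exact h1.trans h3

/-- Taking adjoints reverses C R · P · R B, exchanges its outer factors, and sends P at a point to P
at the conjugate point. The real factor t in front of G is unaffected. -/
theorem IsDualNode.rampResponse_apply (hD : IsDualNode S Sd) (t : ℝ) (v : AntiDual Y) (u : U) :
    Sd.rampResponse Sd.β_mem t v u = v (S.rampResponse hD.conj_mem t u) := by
  simp only [SystemNode.rampResponse, add_apply, smul_apply, ContinuousLinearMap.comp_apply,
    hD.CR_apply, dual_P_apply hD.generator_eq, hD.RB_apply, hD.transfer_eq _ Sd.β_mem, map_add,
    map_smulₛₗ, Complex.conj_ofReal]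

end DualRamp

/-! ### Second differences -/

section SecondDiff

variable {E : Type*} [AddCommGroup E]

theorem sum_backward_diff (g : ℝ → E) (ε t : ℝ) (n : ℕ) :
    ∑ j ∈ Finset.range n, (g (t - j * ε) - g (t - j * ε - ε)) = g t - g (t - n * ε) := by
  induction n with
  | zero => simp
  | succ n ih =>
    rw [Finset.sum_range_succ, ih]
    push_cast
    rw [show t - (n + 1) * ε = t - n * ε - ε by ring]
    abel

variable [Module ℝ E]

/-- The second backward difference quotient. -/
def secondDiff (ε : ℝ) (h : ℝ → E) (t : ℝ) : E :=
  (ε ^ 2)⁻¹ • (h t - (2 : ℝ) • h (t - ε) + h (t - 2 * ε))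

/-- With τ the translation by ε, 1 - τⁿ = (1 + τ + ⋯ + τⁿ⁻¹)(1 - τ); squaring shows that the
quotient at the coarse scale is the mean of n² translates of the one at the fine scale. -/
theorem secondDiff_nsmul (h : ℝ → E) (ε t : ℝ) {n : ℕ} (hn : n ≠ 0) :
    secondDiff (n * ε) h t = ((n : ℝ) ^ 2)⁻¹ • ∑ i ∈ Finset.range n, ∑ j ∈ Finset.range n,
      secondDiff ε h (t - (i + j) * ε) := by
  have hn' : (n : ℝ) ≠ 0 := Nat.cast_ne_zero.2 hn
  let g : ℝ → E := fun s => h s - h (s - ε)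
  have h1 : ∀ s, secondDiff ε h s = (ε ^ 2)⁻¹ • (g s - g (s - ε)) := by
    intro s
    simp only [secondDiff, g]
    rw [show s - ε - ε = s - 2 * ε by ring]
    module
  have h2 : ∀ i : ℕ, ∑ j ∈ Finset.range n, secondDiff ε h (t - (i + j) * ε) =
      (ε ^ 2)⁻¹ • (g (t - i * ε) - g (t - n * ε - i * ε)) := by
    intro i
    simp only [h1]
    rw [← Finset.smul_sum, show t - n * ε - i * ε = t - i * ε - n * ε by ring,
      ← sum_backward_diff]
    congr 1
    refine Finset.sum_congr rfl fun j _ => ?_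
    rw [show t - (i + j) * ε = t - i * ε - j * ε by ring]
  simp only [h2]
  rw [← Finset.smul_sum, Finset.sum_sub_distrib]
  simp only [g]
  rw [sum_backward_diff, sum_backward_diff, smul_smul, secondDiff,
    show t - n * ε - n * ε = t - 2 * (n * ε) by ring, mul_pow, mul_inv]
  module

end SecondDiff

theorem secondDiff_apply {U Y : Type*} [NormedAddCommGroup U] [NormedSpace ℂ U]
    [NormedAddCommGroup Y] [NormedSpace ℂ Y] (Φ : ℝ → U →L[ℂ] Y) (ε t : ℝ) (u : U) :
    secondDiff ε Φ t u = secondDiff ε (fun s => Φ s u) t := by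
  simp [secondDiff]

theorem StrongCont.secondDiff {U Y : Type*} [NormedAddCommGroup U] [NormedSpace ℂ U]
    [NormedAddCommGroup Y] [NormedSpace ℂ Y] {Φ : ℝ → U →L[ℂ] Y} (hΦ : StrongCont Φ) (ε : ℝ) :
    StrongCont (secondDiff ε Φ) := by
  have h1 : StrongCont fun t => Φ (t - ε) := hΦ.comp_real (by fun_prop)
  have h2 : StrongCont fun t => Φ (t - 2 * ε) := hΦ.comp_real (by fun_prop)
  have h3 : StrongCont fun t => (2 : ℝ) • Φ (t - ε) := Continuous.const_smul h1 (2 : ℝ)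
  exact Continuous.const_smul ((hΦ.sub h3).add h2) (ε ^ 2)⁻¹

theorem continuous_secondDiff {E : Type*} [NormedAddCommGroup E] [NormedSpace ℝ E] {h : ℝ → E}
    (hh : Continuous h) (ε : ℝ) : Continuous (secondDiff ε h) := by
  unfold secondDiff
  fun_prop

/-! ### Test functions -/

section Test

/-- `φ''` has Lipschitz constant `M`, for a smooth compactly supported `φ`. -/
theorem exists_lipschitz_deriv2 {φ : ℝ → ℝ} (hφ : ContDiff ℝ ∞ φ) (hc : HasCompactSupport φ) :
    ∃ M, 0 ≤ M ∧ ∀ x y, |deriv (deriv φ) x - deriv (deriv φ) y| ≤ M * |x - y| := by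
  have h1 : ContDiff ℝ ∞ (deriv φ) := (contDiff_infty_iff_deriv.1 hφ).2
  have h2 : ContDiff ℝ ∞ (deriv (deriv φ)) := (contDiff_infty_iff_deriv.1 h1).2
  have h3 : ContDiff ℝ ∞ (deriv (deriv (deriv φ))) := (contDiff_infty_iff_deriv.1 h2).2
  obtain ⟨M, hM⟩ := h3.continuous.bounded_above_of_compact_support hc.deriv.deriv.deriv
  refine ⟨M, (norm_nonneg _).trans (hM 0), fun x y => ?_⟩
  exact Convex.norm_image_sub_le_of_norm_deriv_le (s := univ)
    (fun z _ => (h2.differentiable (by simp)).differentiableAt) (fun z _ => hM z) convex_univ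
    (mem_univ y) (mem_univ x)

/-- The mean value inequality is used twice. The constant comes from φ'' varying by at most M · 2ε
on [t, t + 2ε]. -/
theorem abs_forward_second_diff_le {φ : ℝ → ℝ} (hφ : ContDiff ℝ ∞ φ) {M : ℝ} (hM0 : 0 ≤ M)
    (hM : ∀ x y, |deriv (deriv φ) x - deriv (deriv φ) y| ≤ M * |x - y|) {ε : ℝ} (hε : 0 < ε)
    (t : ℝ) : |(ε ^ 2)⁻¹ * (φ t - 2 * φ (t + ε) + φ (t + 2 * ε)) - deriv (deriv φ) t| ≤
      2 * M * ε := by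
  have h1 : ContDiff ℝ ∞ (deriv φ) := (contDiff_infty_iff_deriv.1 hφ).2
  have d0 : ∀ x, HasDerivAt φ (deriv φ x) x :=
    fun x => (hφ.differentiable (by simp)).differentiableAt.hasDerivAt
  have d1 : ∀ x, HasDerivAt (deriv φ) (deriv (deriv φ) x) x :=
    fun x => (h1.differentiable (by simp)).differentiableAt.hasDerivAt
  have e1 : ∀ x ∈ Icc t (t + ε), ‖deriv φ (x + ε) - deriv φ x - ε * deriv (deriv φ) t‖ ≤
      2 * M * ε * ε := by
    intro x hx
    have := Convex.norm_image_sub_le_of_norm_hasDerivWithin_le (s := Icc x (x + ε))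
      (f := fun y => deriv φ y - y * deriv (deriv φ) t)
      (f' := fun y => deriv (deriv φ) y - 1 * deriv (deriv φ) t) (C := 2 * M * ε)
      (fun y _ => ((d1 y).sub ((hasDerivAt_id y).mul_const _)).hasDerivWithinAt)
      (fun y hy => ?_) (convex_Icc _ _) (left_mem_Icc.2 (by linarith))
      (right_mem_Icc.2 (by linarith))
    · rw [add_sub_cancel_left, Real.norm_of_nonneg hε.le] at this
      refine le_trans (le_of_eq ?_) this
      congr 1
      ring
    · rw [one_mul]
      refine (hM y t).trans ?_
      rw [abs_of_nonneg (by linarith [hx.1, hy.1])]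
      have : y - t ≤ 2 * ε := by linarith [hx.2, hy.2]
      nlinarith
  have := Convex.norm_image_sub_le_of_norm_hasDerivWithin_le (s := Icc t (t + ε))
      (f := fun x => φ (x + ε) - φ x - x * (ε * deriv (deriv φ) t))
      (f' := fun x => deriv φ (x + ε) - deriv φ x - 1 * (ε * deriv (deriv φ) t))
      (C := 2 * M * ε * ε)
      (fun x _ => ((((d0 (x + ε)).comp_add_const x ε).sub (d0 x)).sub
        ((hasDerivAt_id x).mul_const _)).hasDerivWithinAt)
      (fun x hx => by rw [one_mul]; exact e1 x hx) (convex_Icc _ _)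
      (left_mem_Icc.2 (by linarith)) (right_mem_Icc.2 (by linarith))
  rw [add_sub_cancel_left, Real.norm_of_nonneg hε.le] at this
  have h3 : (ε ^ 2)⁻¹ * (φ t - 2 * φ (t + ε) + φ (t + 2 * ε)) - deriv (deriv φ) t =
      (ε ^ 2)⁻¹ * (φ (t + ε + ε) - φ (t + ε) - (t + ε) * (ε * deriv (deriv φ) t) -
        (φ (t + ε) - φ t - t * (ε * deriv (deriv φ) t))) := by
    rw [show t + ε + ε = t + 2 * ε by ring]
    field_simp
    ring
  rw [h3, abs_mul, abs_of_nonneg (by positivity)]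
  calc _ ≤ (ε ^ 2)⁻¹ * (2 * M * ε * ε * ε) := by gcongr; exact this
    _ = _ := by field_simp

variable {E : Type*} [NormedAddCommGroup E] [NormedSpace ℝ E]

theorem integral_second_difference {μ : Measure ℝ} {a b c : ℝ → E} (ha : Integrable a μ)
    (hb : Integrable b μ) (hc : Integrable c μ) :
    ∫ t, (a t - (2 : ℝ) • b t + c t) ∂μ = ∫ t, a t ∂μ - (2 : ℝ) • ∫ t, b t ∂μ + ∫ t, c t ∂μ := by
  have hb2 : Integrable (fun t => (2 : ℝ) • b t) μ := hb.smul (2 : ℝ)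
  have hab : Integrable (fun t => a t - (2 : ℝ) • b t) μ := ha.sub hb2
  rw [integral_add hab hc, integral_sub ha hb2, integral_smul]

theorem integral_smul_secondDiff {φ : ℝ → ℝ} (hφ : Continuous φ) (hc : HasCompactSupport φ)
    {H : ℝ → E} (hH : Continuous H) (ε : ℝ) :
    ∫ t, φ t • secondDiff ε H t =
      ∫ t, ((ε ^ 2)⁻¹ * (φ t - 2 * φ (t + ε) + φ (t + 2 * ε))) • H t := by
  have hi : ∀ a : ℝ, Integrable fun t => φ t • H (t - a) := fun a =>
    (hφ.smul (hH.comp (by fun_prop))).integrable_of_hasCompactSupport hc.smul_right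
  have hi' : ∀ a : ℝ, Integrable fun t => φ (t + a) • H t := fun a => by
    have := (hi a).comp_add_right a
    simpa using this
  have he : ∀ a : ℝ, ∫ t, φ t • H (t - a) = ∫ t, φ (t + a) • H t := fun a => by
    rw [← integral_add_right_eq_self _ a]
    simp
  have h0 := hi 0
  have h0' := hi' 0
  simp only [sub_zero, add_zero] at h0 h0'
  calc ∫ t, φ t • secondDiff ε H t
      = ∫ t, (ε ^ 2)⁻¹ • (φ t • H t - (2 : ℝ) • (φ t • H (t - ε)) + φ t • H (t - 2 * ε)) := by
        refine integral_congr_ae (.of_forall fun t => ?_)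
        simp only [secondDiff]
        module
    _ = (ε ^ 2)⁻¹ • ((∫ t, φ t • H t) - (2 : ℝ) • (∫ t, φ t • H (t - ε)) +
        (∫ t, φ t • H (t - 2 * ε))) := by
        rw [integral_smul, integral_second_difference h0 (hi ε) (hi (2 * ε))]
    _ = (ε ^ 2)⁻¹ • ∫ t, (φ t • H t - (2 : ℝ) • (φ (t + ε) • H t) + φ (t + 2 * ε) • H t) := by
        rw [integral_second_difference h0' (hi' ε) (hi' (2 * ε)), he, he]
    _ = _ := by
        rw [← integral_smul]
        refine integral_congr_ae (.of_forall fun t => ?_)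
        simp only
        module

/-- Second difference quotients approximate the second distributional derivative. -/
theorem norm_integral_secondDiff_sub_le {φ : ℝ → ℝ} (hφ : ContDiff ℝ ∞ φ) {M R : ℝ} (hM0 : 0 ≤ M)
    (hM : ∀ x y, |deriv (deriv φ) x - deriv (deriv φ) y| ≤ M * |x - y|)
    (hR : ∀ x, R < |x| → φ x = 0) {H : ℝ → E} (hH : Continuous H) {ε : ℝ} (hε : 0 < ε)
    (hε1 : ε ≤ 1) :
    ‖(∫ t, φ t • secondDiff ε H t) - ∫ t, deriv (deriv φ) t • H t‖ ≤
      2 * M * ε * ∫ t in Icc (-(R + 2)) (R + 2), ‖H t‖ := by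
  have hsupp : tsupport φ ⊆ Icc (-R) R := closure_minimal (fun x hx => by
      rw [mem_Icc, ← abs_le]
      by_contra h
      exact hx (hR x (not_le.1 h))) isClosed_Icc
  have hc : HasCompactSupport φ := isCompact_Icc.of_isClosed_subset (isClosed_tsupport φ) hsupp
  have h1 : ContDiff ℝ ∞ (deriv φ) := (contDiff_infty_iff_deriv.1 hφ).2
  have h2 : ContDiff ℝ ∞ (deriv (deriv φ)) := (contDiff_infty_iff_deriv.1 h1).2
  have hd : ∀ x, R < |x| → deriv (deriv φ) x = 0 := fun x hx => by
    by_contra h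
    have := hsupp (closure_minimal support_deriv_subset (isClosed_tsupport φ)
      (support_deriv_subset h))
    rw [mem_Icc, ← abs_le] at this
    exact absurd this (not_le.2 hx)
  rw [integral_smul_secondDiff hφ.continuous hc hH, ← integral_sub]
  -- The forward shifts of the test function reach at most 2ε ≤ 2 beyond its support, whence the
  -- margin 2.
  · have h3 : ∀ t ∉ Icc (-(R + 2)) (R + 2),
        ((ε ^ 2)⁻¹ * (φ t - 2 * φ (t + ε) + φ (t + 2 * ε))) • H t - deriv (deriv φ) t • H t = 0 := by
      intro t ht
      have ht : R + 2 < |t| := by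
        rw [mem_Icc, ← abs_le] at ht
        exact not_le.1 ht
      have e1 : |t| - ε ≤ |t + ε| := by
        have := abs_sub_abs_le_abs_sub t (-ε)
        rw [abs_neg, abs_of_pos hε, sub_neg_eq_add] at this
        exact this
      have e2 : |t| - 2 * ε ≤ |t + 2 * ε| := by
        have := abs_sub_abs_le_abs_sub t (-(2 * ε))
        rw [abs_neg, abs_of_pos (by linarith : 0 < 2 * ε), sub_neg_eq_add] at this
        exact this
      rw [hR t (by linarith), hR (t + ε) (by linarith), hR (t + 2 * ε) (by linarith),
        hd t (by linarith)]
      simp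
    rw [← setIntegral_eq_integral_of_forall_compl_eq_zero h3, ← integral_const_mul]
    refine norm_integral_le_of_norm_le
      (hH.norm.integrableOn_Icc.const_mul (2 * M * ε)) (.of_forall fun t => ?_)
    rw [← sub_smul, norm_smul]
    gcongr
    exact abs_forward_second_diff_le hφ hM0 hM hε t
  · refine Continuous.integrable_of_hasCompactSupport ?_ ?_
    · have := hφ.continuous
      fun_prop
    · have hs : ∀ a : ℝ, HasCompactSupport fun t => φ (t + a) := fun a =>
        hc.comp_homeomorph (Homeomorph.addRight a)
      refine HasCompactSupport.smul_right ?_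
      exact ((hc.sub ((hs ε).mul_left (f := fun _ => (2 : ℝ)))).add (hs (2 * ε))).mul_left
        (f := fun _ => (ε ^ 2)⁻¹)
  · exact (h2.continuous.smul hH).integrable_of_hasCompactSupport hc.deriv.deriv.smul_right

end Test

/-! ### Distributions given by functions -/

section Distr

variable {E : Type*} [NormedAddCommGroup E]

theorem MemLpLoc.mono_exponent {p : ℝ≥0∞} (hp : 1 ≤ p) {f : ℝ → E} (hf : MemLpLoc p f) :
    MemLpLoc 1 f := fun t ht => (hf t ht).mono_exponent hp

theorem MemLpLoc.locallyIntegrable {f : ℝ → E} (hf : MemLpLoc 1 f) :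
    LocallyIntegrable ((Ici (0 : ℝ)).indicator f) := by
  rw [locallyIntegrable_iff]
  intro K hK
  obtain ⟨R, hR⟩ := hK.isBounded.subset_closedBall 0
  rw [integrableOn_indicator_iff measurableSet_Ici]
  have hint : IntegrableOn f (Icc 0 (|R| + 1)) := memLp_one_iff_integrable.1 (hf _ (by positivity))
  refine hint.mono_set ?_
  rintro x ⟨h1, h2⟩
  have := hR h2
  rw [mem_closedBall_zero_iff, Real.norm_eq_abs] at this
  exact ⟨h1, (le_abs_self x).trans (this.trans ((le_abs_self R).trans (by linarith)))⟩

theorem continuousOn_memLpLoc {h : ℝ → E} (hh : ContinuousOn h (Ici 0)) : MemLpLoc 1 h :=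
  fun _ _ => memLp_one_iff_integrable.2
    ((hh.mono fun _ hx => hx.1).integrableOn_compact isCompact_Icc)

variable [NormedSpace ℂ E]

theorem distrOf_apply {f : ℝ → E} (hf : MemLpLoc 1 f)
    (φ : TestFunction (⊤ : TopologicalSpace.Opens ℝ) ℝ ⊤) :
    distrOf f φ = ∫ t, φ t • (Ici (0 : ℝ)).indicator f t :=
  TestFunction.integralAgainstBilinCLM_eq_integral (hf.locallyIntegrable.locallyIntegrableOn _)

theorem lineDeriv_distrOf_apply (T : Distr E)
    (φ : TestFunction (⊤ : TopologicalSpace.Opens ℝ) ℝ ⊤) :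
    LineDeriv.lineDerivOp (1 : ℝ) (LineDeriv.lineDerivOp (1 : ℝ) T) φ =
      T (LineDeriv.lineDerivOp (1 : ℝ) (LineDeriv.lineDerivOp (1 : ℝ) φ)) := by
  rw [Distribution.lineDerivOp_apply_apply, map_neg, Distribution.lineDerivOp_apply_apply, map_neg,
    neg_neg]

theorem coe_lineDeriv (φ : TestFunction (⊤ : TopologicalSpace.Opens ℝ) ℝ ⊤) :
    ⇑(LineDeriv.lineDerivOp (1 : ℝ) φ) = deriv φ := by
  ext x
  rw [TestFunction.lineDerivOp_eq_lineDerivCLM ℝ, TestFunction.lineDerivCLM_apply_of_le (by simp),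
    lineDeriv]
  simpa using deriv_comp_const_add (f := φ) x 0

/-- `h'' = f` in the sense of distributions. -/
theorem lineDeriv_distrOf_eq_iff {h f : ℝ → E} (hh : MemLpLoc 1 h) (hf : MemLpLoc 1 f) :
    LineDeriv.lineDerivOp (1 : ℝ) (LineDeriv.lineDerivOp (1 : ℝ) (distrOf h)) = distrOf f ↔
      ∀ φ : ℝ → ℝ, ContDiff ℝ ∞ φ → HasCompactSupport φ →
        ∫ t, deriv (deriv φ) t • (Ici (0 : ℝ)).indicator h t =
          ∫ t, φ t • (Ici (0 : ℝ)).indicator f t := by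
  constructor
  · intro he φ hφ hc
    let φ' : TestFunction (⊤ : TopologicalSpace.Opens ℝ) ℝ ⊤ := ⟨φ, hφ, hc, subset_univ _⟩
    have h1 := congrArg (fun T : Distr E => T φ') he
    simp only [lineDeriv_distrOf_apply, distrOf_apply hh, distrOf_apply hf, coe_lineDeriv] at h1
    exact h1
  · intro he
    ext φ
    rw [lineDeriv_distrOf_apply, distrOf_apply hh, distrOf_apply hf, coe_lineDeriv, coe_lineDeriv]
    exact he φ φ.contDiff φ.hasCompactSupport

end Distr

/-! ### Bounded distributional derivatives have bounded second differences -/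

section Bound

variable {E : Type*} [NormedAddCommGroup E] [NormedSpace ℝ E]

theorem norm_integral_smul_le_of_nonneg {ρ : ℝ → ℝ} (h0 : ∀ x, 0 ≤ ρ x) (hi : Integrable ρ)
    (h1 : ∫ x, ρ x = 1) {f : ℝ → E} {c : ℝ} (hf : ∀ᵐ t, ‖f t‖ ≤ c) : ‖∫ x, ρ x • f x‖ ≤ c := by
  refine (norm_integral_le_of_norm_le (hi.mul_const c) ?_).trans_eq ?_
  · filter_upwards [hf] with t ht
    rw [norm_smul, Real.norm_of_nonneg (h0 t)]
    exact mul_le_mul_of_nonneg_left ht (h0 t)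
  · rw [integral_mul_const, h1, one_mul]

/-- At a small scale ε, pairing ΔH with a translate of ρ differs from ∫ ρ f by O(ε), and ρ has
integral 1, so the pairing is at most c + O(ε). The quotient at the fixed scale a is a mean of such
terms at the scale a / n; letting n → ∞ removes the error. -/
theorem norm_integral_smul_secondDiff_le {H f : ℝ → E} (hH : Continuous H) {c : ℝ}
    (hf : ∀ᵐ t, ‖f t‖ ≤ c)
    (hw : ∀ φ : ℝ → ℝ, ContDiff ℝ ∞ φ → HasCompactSupport φ →
      ∫ t, deriv (deriv φ) t • H t = ∫ t, φ t • f t) {a : ℝ} (ha : 0 < a) {ρ : ℝ → ℝ}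
    (hρ : ContDiff ℝ ∞ ρ) (hc : HasCompactSupport ρ) (h0 : ∀ x, 0 ≤ ρ x)
    (h1 : ∫ x, ρ x = 1) : ‖∫ t, ρ t • secondDiff a H t‖ ≤ c := by
  obtain ⟨M, hM0, hM⟩ := exists_lipschitz_deriv2 hρ hc
  obtain ⟨R, hR⟩ : ∃ R, ∀ x, R < |x| → ρ x = 0 := by
    obtain ⟨R, hR⟩ := hc.isBounded.subset_closedBall 0
    refine ⟨R, fun x hx => ?_⟩
    by_contra h
    have := hR (subset_tsupport ρ h)
    rw [mem_closedBall_zero_iff, Real.norm_eq_abs] at this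
    linarith
  -- One constant serves all translates by s ≤ 2a, since the interval is enlarged by 2a.
  set K := ∫ t in Icc (-(R + 2 * a + 2)) (R + 2 * a + 2), ‖H t‖
  have hi : Integrable ρ := hρ.continuous.integrable_of_hasCompactSupport hc
  have key : ∀ ε : ℝ, 0 < ε → ε ≤ 1 → ∀ s, 0 ≤ s → s ≤ 2 * a →
      ‖∫ t, ρ t • secondDiff ε H (t - s)‖ ≤ c + 2 * M * ε * K := by
    intro ε hε hε1 s hs hs2
    have hρs : ContDiff ℝ ∞ fun t => ρ (t + s) := hρ.comp (by fun_prop)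
    have hcs : HasCompactSupport fun t => ρ (t + s) := hc.comp_homeomorph (Homeomorph.addRight s)
    have hd : deriv (deriv fun t => ρ (t + s)) = fun t => deriv (deriv ρ) (t + s) := by
      have e1 : (deriv fun t => ρ (t + s)) = fun t => deriv ρ (t + s) := by
        ext t; rw [deriv_comp_add_const]
      rw [e1]
      ext t; rw [deriv_comp_add_const]
    have e2 : ∫ t, ρ t • secondDiff ε H (t - s) = ∫ t, ρ (t + s) • secondDiff ε H t := by
      rw [← integral_add_right_eq_self _ s]
      simp
    have e3 := norm_integral_secondDiff_sub_le hρs hM0 (R := R + 2 * a) (fun x y => by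
      rw [hd]
      simpa using hM (x + s) (y + s)) (fun x hx => hR _ (by
        have := abs_sub_abs_le_abs_sub x (-s)
        rw [abs_neg, abs_of_nonneg hs, sub_neg_eq_add] at this
        linarith)) hH hε hε1
    rw [hw _ hρs hcs] at e3
    have e4 : ‖∫ t, ρ (t + s) • f t‖ ≤ c :=
      norm_integral_smul_le_of_nonneg (fun x => h0 _) (hi.comp_add_right s)
        (by rw [integral_add_right_eq_self ρ s, h1]) hf
    rw [e2]
    calc _ = ‖(∫ t, ρ (t + s) • f t) + ((∫ t, ρ (t + s) • secondDiff ε H t) -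
          ∫ t, ρ (t + s) • f t)‖ := by rw [add_sub_cancel]
      _ ≤ _ := (norm_add_le _ _).trans (add_le_add e4 e3)
  have key2 : ∀ n : ℕ, a ≤ n → 0 < n → ‖∫ t, ρ t • secondDiff a H t‖ ≤
      c + 2 * M * (a / n) * K := by
    intro n hn hn0
    have hn' : (0 : ℝ) < n := Nat.cast_pos.2 hn0
    set ε := a / n
    have hε : 0 < ε := by positivity
    have hε1 : ε ≤ 1 := (div_le_one hn').2 hn
    have hna : (n : ℝ) * ε = a := by simp only [ε]; field_simp
    have hint : ∀ s, Integrable fun t => ρ t • secondDiff ε H (t - s) := fun s =>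
      (hρ.continuous.smul ((continuous_secondDiff hH ε).comp
        (by fun_prop))).integrable_of_hasCompactSupport hc.smul_right
    have e1 : ∫ t, ρ t • secondDiff a H t = ((n : ℝ) ^ 2)⁻¹ • ∑ i ∈ Finset.range n,
        ∑ j ∈ Finset.range n, ∫ t, ρ t • secondDiff ε H (t - (i + j) * ε) := by
      have : ∀ i : ℕ, ∑ j ∈ Finset.range n, ∫ t, ρ t • secondDiff ε H (t - (i + j) * ε) =
          ∫ t, ∑ j ∈ Finset.range n, ρ t • secondDiff ε H (t - (i + j) * ε) := fun i =>
        (integral_finsetSum _ fun j _ => hint _).symm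
      simp only [this]
      rw [← integral_finsetSum _ fun i _ => integrable_finsetSum _ fun j _ => hint _,
        ← integral_smul]
      refine integral_congr_ae (.of_forall fun t => ?_)
      simp only
      rw [← hna, secondDiff_nsmul _ _ _ hn0.ne', smul_comm]
      congr 1
      rw [Finset.smul_sum]
      exact Finset.sum_congr rfl fun i _ => Finset.smul_sum
    rw [e1, norm_smul, Real.norm_of_nonneg (by positivity)]
    have e2 : ‖∑ i ∈ Finset.range n, ∑ j ∈ Finset.range n,
        ∫ t, ρ t • secondDiff ε H (t - (i + j) * ε)‖ ≤
        ∑ i ∈ Finset.range n, ∑ j ∈ Finset.range n, (c + 2 * M * ε * K) := by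
      refine norm_sum_le_of_le _ fun i hi => norm_sum_le_of_le _ fun j hj =>
        key ε hε hε1 _ (by positivity) ?_
      have h2 : (i : ℝ) ≤ n := Nat.cast_le.2 (Finset.mem_range.1 hi).le
      have h3 : (j : ℝ) ≤ n := Nat.cast_le.2 (Finset.mem_range.1 hj).le
      rw [← hna]
      nlinarith
    rw [Finset.sum_const, Finset.sum_const, Finset.card_range, smul_smul, nsmul_eq_mul] at e2
    calc _ ≤ ((n : ℝ) ^ 2)⁻¹ * (((n * n : ℕ) : ℝ) * (c + 2 * M * ε * K)) := by gcongr
      _ = _ := by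
        push_cast
        field_simp
  have hlim : Tendsto (fun n : ℕ => c + 2 * M * (a / n) * K) atTop (𝓝 (c + 2 * M * 0 * K)) :=
    (((tendsto_const_div_atTop_nhds_zero_nat a).const_mul (2 * M)).mul_const K).const_add c
  rw [mul_zero, zero_mul, add_zero] at hlim
  refine ge_of_tendsto hlim ?_
  obtain ⟨n₀, hn₀⟩ := exists_nat_ge a
  filter_upwards [eventually_ge_atTop (max n₀ 1)] with n hn
  exact key2 n (hn₀.trans (Nat.cast_le.2 ((le_max_left _ _).trans hn)))
    (lt_of_lt_of_le one_pos ((le_max_right _ _).trans hn))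

/-- Mollifying at t₀ turns the averaged bound into a bound at every point, by continuity of the
second difference. An almost everywhere bound would not do, because the duality argument evaluates
at one prescribed time. -/
theorem norm_secondDiff_le [CompleteSpace E] {H f : ℝ → E} (hH : Continuous H) {c : ℝ}
    (hf : ∀ᵐ t, ‖f t‖ ≤ c)
    (hw : ∀ φ : ℝ → ℝ, ContDiff ℝ ∞ φ → HasCompactSupport φ →
      ∫ t, deriv (deriv φ) t • H t = ∫ t, φ t • f t) {a : ℝ} (ha : 0 < a) (t₀ : ℝ) :
    ‖secondDiff a H t₀‖ ≤ c := by
  refine le_of_forall_pos_le_add fun η hη => ?_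
  have hG := continuous_secondDiff hH a
  obtain ⟨δ, hδ, hball⟩ := Metric.continuous_iff.1 hG t₀ η hη
  let b : ContDiffBump t₀ := ⟨δ / 2, δ, by linarith, by linarith⟩
  have hsm : ContDiff ℝ ∞ (b.normed volume) := b.contDiff_normed
  have hcs := b.hasCompactSupport_normed (μ := volume)
  have h1 := norm_integral_smul_secondDiff_le hH hf hw ha hsm hcs (fun x => b.nonneg_normed x)
    b.integral_normed
  have hi : Integrable (b.normed volume) := hsm.continuous.integrable_of_hasCompactSupport hcs
  have h2 : ‖(∫ t, b.normed volume t • secondDiff a H t) - secondDiff a H t₀‖ ≤ η := by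
    have e1 : secondDiff a H t₀ = ∫ t, b.normed volume t • secondDiff a H t₀ := by
      rw [integral_smul_const, b.integral_normed, one_smul]
    conv_lhs => rw [e1]
    have hA : Integrable fun t => b.normed volume t • secondDiff a H t :=
      (hsm.continuous.smul hG).integrable_of_hasCompactSupport hcs.smul_right
    have hB : Integrable fun t => b.normed volume t • secondDiff a H t₀ := hi.smul_const _
    rw [← integral_sub hA hB]
    refine (norm_integral_le_of_norm_le (hi.mul_const η) (.of_forall fun t => ?_)).trans_eq ?_
    · rw [← smul_sub, norm_smul, Real.norm_of_nonneg (b.nonneg_normed t)]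
      by_cases ht : dist t t₀ < δ
      · exact mul_le_mul_of_nonneg_left (by rw [← dist_eq_norm]; exact (hball t ht).le)
          (b.nonneg_normed t)
      · have : b.normed volume t = 0 := by
          by_contra h
          have h3 : t ∈ Function.support (b.normed volume) := h
          rw [b.support_normed_eq] at h3
          exact ht h3
        rw [this]
        simp
    · rw [integral_mul_const, b.integral_normed, one_mul]
  calc ‖secondDiff a H t₀‖ = ‖(∫ t, b.normed volume t • secondDiff a H t) -
        ((∫ t, b.normed volume t • secondDiff a H t) - secondDiff a H t₀)‖ := by
        rw [sub_sub_cancel]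
    _ ≤ _ := (norm_sub_le _ _).trans (add_le_add h1 h2)

end Bound

/-! ### Translations in `L¹` -/

theorem exists_eLpNorm_translate_sub_le {E : Type*} [NormedAddCommGroup E] {v : ℝ → E}
    (hv : MemLp v 1) {η : ℝ≥0∞} (hη : 0 < η) :
    ∃ δ > 0, ∀ a : ℝ, |a| < δ → eLpNorm (fun t => v (t - a) - v t) 1 volume ≤ η := by
  let g : ℝ → C(ℝ, ℝ) := fun a => ⟨fun t => t - a, by fun_prop⟩
  have hg : Continuous g := ContinuousMap.continuous_of_continuous_uncurry _ (by
    change Continuous fun p : ℝ × ℝ => p.2 - p.1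
    fun_prop)
  have hm : ∀ a, MeasurePreserving (g a) volume volume := fun a =>
    measurePreserving_sub_right volume a
  have hc : Continuous fun a => Lp.compMeasurePreserving (g a) (hm a) (hv.toLp v) :=
    continuous_const.compMeasurePreservingLp hg hm ENNReal.one_ne_top
  have h0 := (hc.tendsto 0)
  simp only [Lp.toLp_compMeasurePreserving hv] at h0
  have h1 := (Lp.tendsto_Lp_iff_tendsto_eLpNorm'' _ _ _ _).1 h0
  have h2 := (ENNReal.tendsto_nhds_zero.1 h1) η hη
  obtain ⟨δ, hδ, h3⟩ := Metric.eventually_nhds_iff.1 h2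
  refine ⟨δ, hδ, fun a ha => ?_⟩
  have h4 := h3 (y := a) (by simpa using ha)
  refine le_trans (le_of_eq ?_) h4
  congr 1
  ext t
  simp [g]

/-! ### Convolutions with strongly continuous kernels -/

section Conv

variable {E F : Type*} [NormedAddCommGroup E] [NormedSpace ℂ E]
  [NormedAddCommGroup F] [NormedSpace ℂ F]

/-- The convolution of `v` with the kernel `ψ`. -/
def conv (ψ : ℝ → E →L[ℂ] F) (v : ℝ → E) (t : ℝ) : F := ∫ r, ψ (t - r) (v r)

theorem conv_translate (ψ : ℝ → E →L[ℂ] F) (v : ℝ → E) (a t : ℝ) :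
    conv ψ (fun r => v (r - a)) t = conv ψ v (t - a) := by
  rw [conv, conv, ← integral_sub_right_eq_self (fun r => ψ (t - a - r) (v r)) a]
  simp

/-- After Tonelli the vector v(r) is constant in the inner integral, so an L¹ bound on each orbit
ψ(·) e suffices; integrability of the operator norm is not required. -/
theorem lintegral_enorm_conv_le {ψ : ℝ → E →L[ℂ] F} (hψ : StrongCont ψ) {c : ℝ≥0∞}
    (hc : ∀ e, ∫⁻ s, ‖ψ s e‖ₑ ≤ c * ‖e‖ₑ) {v : ℝ → E} (hv : AEStronglyMeasurable v) :
    ∫⁻ t, ‖conv ψ v t‖ₑ ≤ c * ∫⁻ r, ‖v r‖ₑ := by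
  have hm : AEStronglyMeasurable (fun p : ℝ × ℝ => ψ (p.1 - p.2) (v p.2))
      (volume.prod volume) :=
    Continuous.comp_aestronglyMeasurable (f := fun p : ℝ × ℝ => (p.1 - p.2, v p.2)) hψ
      ((by fun_prop : Continuous fun p : ℝ × ℝ => p.1 - p.2).aestronglyMeasurable.prodMk
        hv.comp_snd)
  calc ∫⁻ t, ‖conv ψ v t‖ₑ ≤ ∫⁻ t, ∫⁻ r, ‖ψ (t - r) (v r)‖ₑ :=
        lintegral_mono fun t => enorm_integral_le_lintegral_enorm _
    _ = ∫⁻ r, ∫⁻ t, ‖ψ (t - r) (v r)‖ₑ := lintegral_lintegral_swap hm.enorm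
    _ ≤ ∫⁻ r, c * ‖v r‖ₑ := lintegral_mono fun r => by
        rw [lintegral_sub_right_eq_self fun t => ‖ψ t (v r)‖ₑ]
        exact hc _
    _ = _ := lintegral_const_mul'' _ hv.enorm

variable {ψ : ℝ → E →L[ℂ] F} {v : ℝ → E}

theorem conv_of_nonpos (h0 : ∀ s ≤ 0, ψ s = 0) (hv0 : ∀ r < 0, v r = 0) {t : ℝ} (ht : t ≤ 0) :
    conv ψ v t = 0 := by
  refine integral_eq_zero_of_ae (.of_forall fun r => ?_)
  rcases lt_or_ge r 0 with hr | hr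
  · simp [hv0 r hr]
  · simp [h0 (t - r) (by linarith)]

theorem conv_eq_intervalIntegral (h0 : ∀ s ≤ 0, ψ s = 0) (hv0 : ∀ r < 0, v r = 0) {t : ℝ}
    (ht : 0 ≤ t) : conv ψ v t = ∫ r in 0..t, ψ (t - r) (v r) := by
  rw [intervalIntegral.integral_of_le ht, ← integral_Icc_eq_integral_Ioc,
    setIntegral_eq_integral_of_forall_compl_eq_zero]
  · rfl
  · intro r hr
    rcases lt_or_ge r 0 with hr0 | hr0
    · simp [hv0 r hr0]
    · have : t < r := by
        by_contra h
        exact hr ⟨hr0, not_lt.1 h⟩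
      simp [h0 (t - r) (by linarith)]

variable [CompleteSpace E]

theorem integrable_conv (hψ : StrongCont ψ) (h0 : ∀ s ≤ 0, ψ s = 0) (hv : Integrable v)
    (hv0 : ∀ r < 0, v r = 0) (t : ℝ) : Integrable fun r => ψ (t - r) (v r) := by
  rcases le_or_gt t 0 with ht | ht
  · refine (integrable_zero ℝ F volume).congr (.of_forall fun r => ?_)
    rcases lt_or_ge r 0 with hr | hr
    · simp [hv0 r hr]
    · simp [h0 (t - r) (by linarith)]
  · have h2 : IntegrableOn (fun r => ψ (t - r) (v r)) (Icc 0 t) := by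
      rw [integrableOn_Icc_iff_integrableOn_Ioc]
      exact (hψ.intervalIntegrable hv.intervalIntegrable t).1
    refine h2.integrable_of_forall_notMem_eq_zero fun r hr => ?_
    rcases lt_or_ge r 0 with hr0 | hr0
    · simp [hv0 r hr0]
    · have : t < r := by
        by_contra h
        exact hr ⟨hr0, not_lt.1 h⟩
      simp [h0 (t - r) (by linarith)]

theorem continuous_conv (hψ : StrongCont ψ) (h0 : ∀ s ≤ 0, ψ s = 0) (hv : MemLpLoc 1 v)
    (hv0 : ∀ r < 0, v r = 0) : Continuous (conv ψ v) := by
  have h1 : ContinuousOn (conv ψ v) (Ici 0) :=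
    (hψ.continuousOn_convolution hv).congr fun t ht => conv_eq_intervalIntegral h0 hv0 ht
  have h2 : ContinuousOn (conv ψ v) (Iic 0) :=
    continuousOn_const.congr fun t ht => conv_of_nonpos h0 hv0 ht
  rw [← continuousOn_univ, ← Iic_union_Ici (a := (0 : ℝ))]
  exact h2.union_of_isClosed h1 isClosed_Iic isClosed_Ici

theorem conv_sub (hψ : StrongCont ψ) (h0 : ∀ s ≤ 0, ψ s = 0) {w : ℝ → E} (hv : Integrable v)
    (hv0 : ∀ r < 0, v r = 0) (hw : Integrable w) (hw0 : ∀ r < 0, w r = 0) (t : ℝ) :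
    conv ψ (fun r => v r - w r) t = conv ψ v t - conv ψ w t := by
  simp only [conv, map_sub]
  exact integral_sub (integrable_conv hψ h0 hv hv0 t) (integrable_conv hψ h0 hw hw0 t)

theorem secondDiff_of_nonpos {V : Type*} [AddCommGroup V] [Module ℝ V] {h : ℝ → V}
    (h0 : ∀ s ≤ 0, h s = 0) {ε : ℝ} (hε : 0 ≤ ε) {s : ℝ} (hs : s ≤ 0) : secondDiff ε h s = 0 := by
  simp [secondDiff, h0 s hs, h0 (s - ε) (by linarith), h0 (s - 2 * ε) (by linarith)]

theorem conv_secondDiff (hψ : StrongCont ψ) (h0 : ∀ s ≤ 0, ψ s = 0) (hv : Integrable v)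
    (hv0 : ∀ r < 0, v r = 0) (ε t : ℝ) :
    conv (secondDiff ε ψ) v t = secondDiff ε (conv ψ v) t := by
  have h1 : ∀ r, secondDiff ε ψ (t - r) (v r) = (ε ^ 2)⁻¹ • (ψ (t - r) (v r) -
      (2 : ℝ) • ψ (t - ε - r) (v r) + ψ (t - 2 * ε - r) (v r)) := fun r => by
    rw [secondDiff_apply, secondDiff, sub_right_comm t r ε, sub_right_comm t r (2 * ε)]
  simp only [conv, h1]
  rw [integral_smul, integral_second_difference (integrable_conv hψ h0 hv hv0 t)
    (integrable_conv hψ h0 hv hv0 (t - ε)) (integrable_conv hψ h0 hv hv0 (t - 2 * ε))]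
  rfl

variable {c : ℝ≥0}

theorem memLp_conv (hψ : StrongCont ψ) (h0 : ∀ s ≤ 0, ψ s = 0)
    (hc : ∀ e, ∫⁻ s, ‖ψ s e‖ₑ ≤ c * ‖e‖ₑ) (hv : Integrable v) (hv0 : ∀ r < 0, v r = 0) :
    MemLp (conv ψ v) 1 := by
  refine ⟨(continuous_conv hψ h0 (fun t _ => (memLp_one_iff_integrable.2 hv).restrict _)
    hv0).aestronglyMeasurable, ?_⟩
  rw [eLpNorm_one_eq_lintegral_enorm]
  exact (lintegral_enorm_conv_le hψ hc hv.1).trans_lt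
    (ENNReal.mul_lt_top ENNReal.coe_lt_top hv.2)

theorem memLp_secondDiff_conv (hψ : StrongCont ψ) (h0 : ∀ s ≤ 0, ψ s = 0)
    (hc : ∀ ε > 0, ∀ e, ∫⁻ s, ‖secondDiff ε ψ s e‖ₑ ≤ c * ‖e‖ₑ) (hv : Integrable v)
    (hv0 : ∀ r < 0, v r = 0) {ε : ℝ} (hε : 0 < ε) : MemLp (secondDiff ε (conv ψ v)) 1 := by
  have := memLp_conv (hψ.secondDiff ε) (fun s hs => secondDiff_of_nonpos h0 hε.le hs) (hc ε hε)
    hv hv0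
  rwa [show conv (secondDiff ε ψ) v = secondDiff ε (conv ψ v) from
    funext (conv_secondDiff hψ h0 hv hv0 ε)] at this

theorem eLpNorm_secondDiff_conv_le (hψ : StrongCont ψ) (h0 : ∀ s ≤ 0, ψ s = 0)
    (hc : ∀ ε > 0, ∀ e, ∫⁻ s, ‖secondDiff ε ψ s e‖ₑ ≤ c * ‖e‖ₑ) (hv : Integrable v)
    (hv0 : ∀ r < 0, v r = 0) {ε : ℝ} (hε : 0 < ε) :
    eLpNorm (secondDiff ε (conv ψ v)) 1 volume ≤ c * eLpNorm v 1 volume := by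
  rw [eLpNorm_one_eq_lintegral_enorm, eLpNorm_one_eq_lintegral_enorm,
    ← show conv (secondDiff ε ψ) v = secondDiff ε (conv ψ v) from
      funext (conv_secondDiff hψ h0 hv hv0 ε)]
  exact lintegral_enorm_conv_le (hψ.secondDiff ε) (hc ε hε) hv.1

/-- The difference is a mean of n² terms D(· - a) - D with a = (i + j)ε ≤ 2nε, and each is the
second difference of the convolution with v(· - a) - v, hence has norm at most cη. -/
theorem eLpNorm_secondDiff_nsmul_sub_le (hψ : StrongCont ψ) (h0 : ∀ s ≤ 0, ψ s = 0)
    (hc : ∀ ε > 0, ∀ e, ∫⁻ s, ‖secondDiff ε ψ s e‖ₑ ≤ c * ‖e‖ₑ) (hv : Integrable v)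
    (hv0 : ∀ r < 0, v r = 0) {ε : ℝ} (hε : 0 < ε) {n : ℕ} (hn : n ≠ 0) {η : ℝ≥0∞}
    (hη : ∀ a, 0 ≤ a → a ≤ 2 * (n * ε) → eLpNorm (fun t => v (t - a) - v t) 1 volume ≤ η) :
    eLpNorm (secondDiff (n * ε) (conv ψ v) - secondDiff ε (conv ψ v)) 1 volume ≤ c * η := by
  have hn' : (n : ℝ) ≠ 0 := Nat.cast_ne_zero.2 hn
  set D := secondDiff ε (conv ψ v)
  let d : ℕ → ℕ → ℝ → F := fun i j t => D (t - (i + j) * ε) - D t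
  have hvt : ∀ a, Integrable fun t => v (t - a) := fun a => hv.comp_sub_right a
  have hvt0 : ∀ a, 0 ≤ a → ∀ r < 0, v (r - a) = 0 := fun a ha r hr => hv0 _ (by linarith)
  have hd : ∀ i j : ℕ, d i j = secondDiff ε (conv ψ fun t => v (t - (i + j) * ε) - v t) := by
    intro i j
    have ha : 0 ≤ ((i : ℝ) + j) * ε := by positivity
    ext t
    simp only [d, D, secondDiff, conv_sub hψ h0 (hvt _) (hvt0 _ ha) hv hv0, conv_translate]
    rw [sub_right_comm t _ ε, sub_right_comm t _ (2 * ε)]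
    module
  have hdint : ∀ i j : ℕ, Integrable fun t => v (t - (i + j) * ε) - v t := fun i j =>
    (hvt _).sub hv
  have hd0 : ∀ i j : ℕ, ∀ r < 0, v (r - (i + j) * ε) - v r = 0 := fun i j r hr => by
    rw [hvt0 _ (by positivity) r hr, hv0 r hr, sub_zero]
  have hle : ∀ i < n, ∀ j < n, eLpNorm (d i j) 1 volume ≤ c * η := by
    intro i hi j hj
    rw [hd]
    refine (eLpNorm_secondDiff_conv_le hψ h0 hc (hdint i j) (hd0 i j) hε).trans ?_
    gcongr
    refine hη _ (by positivity) ?_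
    have h2 : (i : ℝ) ≤ n := Nat.cast_le.2 hi.le
    have h3 : (j : ℝ) ≤ n := Nat.cast_le.2 hj.le
    nlinarith
  have hmeas : ∀ i j, AEStronglyMeasurable (d i j) := fun i j => by
    rw [hd]
    exact (memLp_secondDiff_conv hψ h0 hc (hdint i j) (hd0 i j) hε).1
  have heq : secondDiff (n * ε) (conv ψ v) - D = ((n : ℝ) ^ 2)⁻¹ •
      ∑ i ∈ Finset.range n, ∑ j ∈ Finset.range n, d i j := by
    ext t
    simp only [Pi.sub_apply, Pi.smul_apply, Finset.sum_apply, d, Finset.sum_sub_distrib,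
      Finset.sum_const, Finset.card_range, secondDiff_nsmul _ _ _ hn, smul_sub, D,
      ← Nat.cast_smul_eq_nsmul ℝ, smul_smul]
    congr 1
    rw [show ((n : ℝ) ^ 2)⁻¹ * ((n : ℝ) * n) = 1 by field_simp, one_smul]
  rw [heq, eLpNorm_const_smul]
  have hsum : eLpNorm (∑ i ∈ Finset.range n, ∑ j ∈ Finset.range n, d i j) 1 volume ≤
      ∑ i ∈ Finset.range n, ∑ j ∈ Finset.range n, c * η := by
    refine (eLpNorm_sum_le (fun i _ => Finset.aestronglyMeasurable_sum _ fun j _ => hmeas i j)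
      le_rfl).trans (Finset.sum_le_sum fun i hi => ?_)
    exact (eLpNorm_sum_le (fun j _ => hmeas i j) le_rfl).trans (Finset.sum_le_sum fun j hj =>
      hle i (Finset.mem_range.1 hi) j (Finset.mem_range.1 hj))
  rw [Finset.sum_const, Finset.sum_const, Finset.card_range, smul_smul, nsmul_eq_mul] at hsum
  refine (mul_le_mul_right hsum _).trans_eq ?_
  rw [← mul_assoc]
  convert one_mul (c * η : ℝ≥0∞)
  rw [Real.enorm_eq_ofReal (by positivity), ← ENNReal.ofReal_natCast, ← ENNReal.ofReal_mul (by positivity),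
    ← ENNReal.ofReal_one]
  congr 1
  push_cast
  field_simp

variable [CompleteSpace F]

/-- The second difference quotients converge in `L¹`. -/
theorem exists_tendsto_secondDiff_conv (hψ : StrongCont ψ) (h0 : ∀ s ≤ 0, ψ s = 0)
    (hc : ∀ ε > 0, ∀ e, ∫⁻ s, ‖secondDiff ε ψ s e‖ₑ ≤ c * ‖e‖ₑ) (hv : Integrable v)
    (hv0 : ∀ r < 0, v r = 0) :
    ∃ f : ℝ → F, MemLp f 1 ∧ Tendsto (fun k : ℕ =>
      eLpNorm (secondDiff ((2⁻¹ : ℝ) ^ k) (conv ψ v) - f) 1 volume) atTop (𝓝 0) := by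
  set D : ℕ → ℝ → F := fun k => secondDiff ((2⁻¹ : ℝ) ^ k) (conv ψ v)
  have hD : ∀ k, MemLp (D k) 1 := fun k => memLp_secondDiff_conv hψ h0 hc hv hv0 (by positivity)
  have hcau : CauchySeq fun k => (hD k).toLp (D k) := by
    rw [EMetric.cauchySeq_iff]
    intro η hη
    obtain ⟨η', hη', hlt⟩ : ∃ η' : ℝ≥0∞, 0 < η' ∧ c * η' < η := by
      have h1 : Tendsto (fun z : ℝ≥0∞ => c * z) (𝓝[>] 0) (𝓝 0) := by
        have := (ENNReal.continuous_const_mul (a := c) ENNReal.coe_ne_top).tendsto 0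
        rw [mul_zero] at this
        exact this.mono_left nhdsWithin_le_nhds
      obtain ⟨z, h2, h3⟩ := ((h1.eventually_lt_const hη).and self_mem_nhdsWithin).exists
      exact ⟨z, h3, h2⟩
    obtain ⟨δ, hδ, htr⟩ := exists_eLpNorm_translate_sub_le (memLp_one_iff_integrable.2 hv) hη'
    -- The translations in play go up to 2 · 2⁻ᵏ, hence δ / 2.
    obtain ⟨K, hK⟩ := exists_pow_lt_of_lt_one (half_pos hδ) (by norm_num : (2⁻¹ : ℝ) < 1)
    have key : ∀ k, K ≤ k → ∀ l, k ≤ l → eLpNorm (D k - D l) 1 volume < η := by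
      intro k hk l hl
      refine lt_of_le_of_lt ?_ hlt
      -- At dyadic scales the coarser one is an integer multiple of the finer one, as the averaging
      -- identity requires.
      have e1 : (2⁻¹ : ℝ) ^ k = ((2 ^ (l - k) : ℕ) : ℝ) * (2⁻¹ : ℝ) ^ l := by
        obtain ⟨m, rfl⟩ := Nat.exists_eq_add_of_le hl
        rw [Nat.add_sub_cancel_left, pow_add]
        push_cast
        rw [mul_left_comm, ← mul_pow]
        norm_num
      simp only [D]
      rw [e1]
      refine eLpNorm_secondDiff_nsmul_sub_le hψ h0 hc hv hv0 (by positivity) (by positivity)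
        fun a ha ha' => htr a ?_
      rw [← e1] at ha'
      rw [abs_of_nonneg ha]
      have : (2⁻¹ : ℝ) ^ k ≤ (2⁻¹ : ℝ) ^ K := pow_le_pow_of_le_one (by norm_num) (by norm_num) hk
      linarith
    refine ⟨K, fun k hk l hl => ?_⟩
    rw [Lp.edist_toLp_toLp]
    rcases le_total k l with h | h
    · exact key k hk l h
    · rw [eLpNorm_sub_comm]
      exact key l hl k h
  obtain ⟨f, hf⟩ := cauchySeq_tendsto_of_complete hcau
  refine ⟨f, Lp.memLp f, ?_⟩
  have := (Lp.tendsto_Lp_iff_tendsto_eLpNorm' _ _).1 hf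
  refine this.congr fun k => eLpNorm_congr_ae ?_
  filter_upwards [(hD k).coeFn_toLp] with t ht
  simp only [Pi.sub_apply, ht, D]

end Conv

/-! ### Limits in `L¹` -/

section Limits

variable {α F : Type*} [MeasurableSpace α] {μ : Measure α} [NormedAddCommGroup F]

/-- Limits in L¹ are limits in measure, hence unique almost everywhere on s. This carries causality
over from second differences to their limits. -/
theorem ae_eq_of_tendsto_eLpNorm {f g : α → F} {a b : ℕ → α → F} {s : Set α}
    (hs : MeasurableSet s) (hf : AEStronglyMeasurable f μ) (hg : AEStronglyMeasurable g μ)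
    (ha : ∀ k, AEStronglyMeasurable (a k) μ)
    (hfa : Tendsto (fun k => eLpNorm (a k - f) 1 μ) atTop (𝓝 0))
    (hgb : Tendsto (fun k => eLpNorm (b k - g) 1 μ) atTop (𝓝 0))
    (hab : ∀ k, ∀ x ∈ s, a k x = b k x) : ∀ᵐ x ∂μ, x ∈ s → f x = g x := by
  rw [← ae_restrict_iff' hs]
  have h1 : Tendsto (fun k => eLpNorm (a k - f) 1 (μ.restrict s)) atTop (𝓝 0) :=
    tendsto_of_tendsto_of_tendsto_of_le_of_le tendsto_const_nhds hfa (fun _ => zero_le)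
      fun k => eLpNorm_mono_measure _ Measure.restrict_le_self
  have h2 : Tendsto (fun k => eLpNorm (a k - g) 1 (μ.restrict s)) atTop (𝓝 0) := by
    refine tendsto_of_tendsto_of_tendsto_of_le_of_le tendsto_const_nhds hgb (fun _ => zero_le)
      fun k => (le_of_eq (eLpNorm_congr_ae ?_)).trans
        (eLpNorm_mono_measure _ Measure.restrict_le_self)
    filter_upwards [ae_restrict_mem hs] with x hx
    simp only [Pi.sub_apply, hab k x hx]
  exact tendstoInMeasure_ae_unique
    (tendstoInMeasure_of_tendsto_eLpNorm one_ne_zero (fun k => (ha k).restrict) hf.restrict h1)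
    (tendstoInMeasure_of_tendsto_eLpNorm one_ne_zero (fun k => (ha k).restrict) hg.restrict h2)

theorem eLpNorm_le_of_tendsto {f : α → F} {a : ℕ → α → F} {C : ℝ≥0∞}
    (hf : AEStronglyMeasurable f μ) (ha : ∀ k, AEStronglyMeasurable (a k) μ)
    (hfa : Tendsto (fun k => eLpNorm (a k - f) 1 μ) atTop (𝓝 0))
    (hC : ∀ k, eLpNorm (a k) 1 μ ≤ C) : eLpNorm f 1 μ ≤ C := by
  have h1 : Tendsto (fun k => C + eLpNorm (a k - f) 1 μ) atTop (𝓝 (C + 0)) := hfa.const_add C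
  rw [add_zero] at h1
  refine ge_of_tendsto' h1 fun k => ?_
  calc eLpNorm f 1 μ = eLpNorm (a k - (a k - f)) 1 μ := by rw [sub_sub_cancel]
    _ ≤ eLpNorm (a k) 1 μ + eLpNorm (a k - f) 1 μ :=
        eLpNorm_sub_le (ha k) ((ha k).sub hf) le_rfl
    _ ≤ _ := by gcongr; exact hC k

theorem tendsto_integral_smul_of_tendsto_eLpNorm [NormedSpace ℝ F] {f : α → F} {a : ℕ → α → F}
    {φ : α → ℝ} (hφ : AEStronglyMeasurable φ μ) {M : ℝ} (hM : ∀ x, ‖φ x‖ ≤ M)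
    (hf : MemLp f 1 μ) (ha : ∀ k, MemLp (a k) 1 μ)
    (hfa : Tendsto (fun k => eLpNorm (a k - f) 1 μ) atTop (𝓝 0)) :
    Tendsto (fun k => ∫ x, φ x • a k x ∂μ) atTop (𝓝 (∫ x, φ x • f x ∂μ)) := by
  have hi : ∀ {g : α → F}, MemLp g 1 μ → Integrable (fun x => φ x • g x) μ := fun hg =>
    (memLp_one_iff_integrable.1 hg).bdd_smul M hφ (.of_forall hM)
  refine tendsto_integral_of_L1' _ (hi hf).1 (.of_forall fun k => hi (ha k)) ?_
  have h1 : Tendsto (fun k => ENNReal.ofReal M * eLpNorm (a k - f) 1 μ) atTop (𝓝 0) := by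
    have := ENNReal.Tendsto.const_mul (a := ENNReal.ofReal M) hfa (.inr ENNReal.ofReal_ne_top)
    rwa [mul_zero] at this
  refine tendsto_of_tendsto_of_tendsto_of_le_of_le tendsto_const_nhds h1 (fun _ => zero_le)
    fun k => eLpNorm_le_mul_eLpNorm_of_ae_le_mul (.of_forall fun x => ?_) 1
  simp only [Pi.sub_apply]
  rw [← smul_sub, norm_smul]
  exact mul_le_mul_of_nonneg_right (hM x) (norm_nonneg _)

end Limits

section Indicator

variable {E : Type*} [NormedAddCommGroup E] {v : ℝ → E}

theorem integrable_indicator_Icc (hv : MemLpLoc 1 v) {T : ℝ} (hT : 0 < T) :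
    Integrable ((Icc 0 T).indicator v) :=
  (integrable_indicator_iff measurableSet_Icc).2 (memLp_one_iff_integrable.1 (hv T hT))

theorem indicator_Icc_of_neg (v : ℝ → E) (T : ℝ) : ∀ r < 0, (Icc 0 T).indicator v r = 0 :=
  fun _ hr => indicator_of_notMem (fun h => absurd h.1 (not_le.2 hr)) _

end Indicator

/-! ### Second derivatives of convolutions with locally integrable inputs, glued from truncations -/

section Glue

variable {E F : Type*} [NormedAddCommGroup E] [NormedSpace ℂ E]
  [NormedAddCommGroup F] [NormedSpace ℂ F] {ψ : ℝ → E →L[ℂ] F} {v : ℝ → E}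

theorem conv_indicator_Icc (h0 : ∀ s ≤ 0, ψ s = 0) {t T : ℝ} (ht : t ≤ T) :
    conv ψ ((Icc 0 T).indicator v) t =
      (Ici (0 : ℝ)).indicator (fun t => ∫ r in 0..t, ψ (t - r) (v r)) t := by
  rcases lt_or_ge t 0 with h | h
  · rw [conv_of_nonpos h0 (indicator_Icc_of_neg v T) h.le,
      indicator_of_notMem (by simpa using h)]
  · rw [conv_eq_intervalIntegral h0 (indicator_Icc_of_neg v T) h, indicator_of_mem (mem_Ici.2 h)]
    refine intervalIntegral.integral_congr fun r hr => ?_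
    rw [uIcc_of_le h] at hr
    simp only [indicator_of_mem (show r ∈ Icc 0 T from ⟨hr.1, hr.2.trans ht⟩)]

/-- If the second difference quotients of a continuous function converge in `L¹`, then the limit
is the second distributional derivative. -/
theorem integral_deriv2_smul_eq_of_tendsto {H f : ℝ → F} (hH : Continuous H) (hf : MemLp f 1)
    (hD : ∀ k : ℕ, MemLp (secondDiff ((2⁻¹ : ℝ) ^ k) H) 1)
    (hlim : Tendsto (fun k : ℕ => eLpNorm (secondDiff ((2⁻¹ : ℝ) ^ k) H - f) 1 volume)
      atTop (𝓝 0)) {φ : ℝ → ℝ} (hφ : ContDiff ℝ ∞ φ) (hc : HasCompactSupport φ) :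
    ∫ t, deriv (deriv φ) t • H t = ∫ t, φ t • f t := by
  obtain ⟨M, hM⟩ := hφ.continuous.bounded_above_of_compact_support hc
  obtain ⟨M', hM0', hM'⟩ := exists_lipschitz_deriv2 hφ hc
  obtain ⟨R, hR⟩ : ∃ R, ∀ x, R < |x| → φ x = 0 := by
    obtain ⟨R, hR⟩ := hc.isBounded.subset_closedBall 0
    refine ⟨R, fun x hx => ?_⟩
    by_contra h
    have := hR (subset_tsupport φ h)
    rw [mem_closedBall_zero_iff, Real.norm_eq_abs] at this
    linarith
  have h1 := tendsto_integral_smul_of_tendsto_eLpNorm hφ.continuous.aestronglyMeasurable hM hf hD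
    hlim
  refine tendsto_nhds_unique ?_ h1
  rw [tendsto_iff_norm_sub_tendsto_zero]
  have hp : Tendsto (fun k : ℕ => (2⁻¹ : ℝ) ^ k) atTop (𝓝 0) :=
    tendsto_pow_atTop_nhds_zero_of_lt_one (by norm_num) (by norm_num)
  have h2 : Tendsto (fun k : ℕ => 2 * M' * (2⁻¹ : ℝ) ^ k *
      ∫ t in Icc (-(R + 2)) (R + 2), ‖H t‖) atTop (𝓝 0) := by
    have := (hp.const_mul (2 * M')).mul_const (∫ t in Icc (-(R + 2)) (R + 2), ‖H t‖)
    simpa using this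
  exact squeeze_zero (fun _ => norm_nonneg _) (fun k => norm_integral_secondDiff_sub_le hφ hM0' hM'
    hR hH (by positivity) (pow_le_one₀ (by norm_num) (by norm_num))) h2

variable [CompleteSpace E] [CompleteSpace F] {c : ℝ≥0}

/-- A convolution kernel whose second difference quotients are bounded in the strong `L¹` sense
maps `L¹_loc` to functions with a second distributional derivative in `L¹_loc`. -/
theorem exists_deriv2_conv (hψ : StrongCont ψ) (h0 : ∀ s ≤ 0, ψ s = 0)
    (hc : ∀ ε > 0, ∀ e, ∫⁻ s, ‖secondDiff ε ψ s e‖ₑ ≤ c * ‖e‖ₑ) (hv : MemLpLoc 1 v) :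
    ∃ f : ℝ → F, MemLpLoc 1 f ∧
      LineDeriv.lineDerivOp (1 : ℝ) (LineDeriv.lineDerivOp (1 : ℝ)
        (distrOf fun t => ∫ r in 0..t, ψ (t - r) (v r))) = distrOf f ∧
      ∀ t : ℝ, 0 < t → lpNormOn 1 f t ≤ c * lpNormOn 1 v t := by
  set h : ℝ → F := fun t => ∫ r in 0..t, ψ (t - r) (v r)
  let w : ℝ → ℝ → E := fun T => (Icc 0 T).indicator v
  have hwi : ∀ T, 0 < T → Integrable (w T) := fun T hT => integrable_indicator_Icc hv hT
  have hw0 : ∀ T, ∀ r < 0, w T r = 0 := indicator_Icc_of_neg v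
  have hex : ∀ T : ℝ, ∃ f : ℝ → F, 0 < T → MemLp f 1 ∧ Tendsto (fun k : ℕ =>
      eLpNorm (secondDiff ((2⁻¹ : ℝ) ^ k) (conv ψ (w T)) - f) 1 volume) atTop (𝓝 0) := by
    intro T
    by_cases hT : 0 < T
    · obtain ⟨f, hf⟩ := exists_tendsto_secondDiff_conv hψ h0 hc (hwi T hT) (hw0 T)
      exact ⟨f, fun _ => hf⟩
    · exact ⟨0, fun h => absurd h hT⟩
  choose G hG using hex
  have hDm : ∀ T, 0 < T → ∀ k : ℕ, MemLp (secondDiff ((2⁻¹ : ℝ) ^ k) (conv ψ (w T))) 1 :=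
    fun T hT k => memLp_secondDiff_conv hψ h0 hc (hwi T hT) (hw0 T) (by positivity)
  -- Vanishing on the left half-line means that no mass is lost when the limit is cut off by the
  -- indicator of [0, ∞).
  have hneg : ∀ T, 0 < T → ∀ᵐ t, t ∈ Iic (0 : ℝ) → G T t = 0 := fun T hT =>
    ae_eq_of_tendsto_eLpNorm (b := fun _ => 0) measurableSet_Iic (hG T hT).1.1
      aestronglyMeasurable_zero (fun k => (hDm T hT k).1)
      (hG T hT).2 (by simp) fun k t ht => secondDiff_of_nonpos
        (fun s hs => conv_of_nonpos h0 (hw0 T) hs) (by positivity) ht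
  have hcoh : ∀ T T', 0 < T → 0 < T' → ∀ᵐ t, t ∈ Iic (min T T') → G T t = G T' t := by
    intro T T' hT hT'
    refine ae_eq_of_tendsto_eLpNorm measurableSet_Iic (hG T hT).1.1 (hG T' hT').1.1
      (fun k => (hDm T hT k).1) (hG T hT).2 (hG T' hT').2 ?_
    intro k t ht
    have h1 : ∀ s ≤ t, conv ψ (w T) s = conv ψ (w T') s := fun s hs => by
      rw [conv_indicator_Icc h0 (hs.trans (ht.trans (min_le_left _ _))),
        conv_indicator_Icc h0 (hs.trans (ht.trans (min_le_right _ _)))]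
    have hk : (0 : ℝ) < (2⁻¹ : ℝ) ^ k := by positivity
    simp only [secondDiff]
    rw [h1 t le_rfl, h1 _ (by linarith), h1 _ (by linarith)]
  -- At time t the truncation at ⌊t⌋ + 1 > t is used; by causality any later truncation gives the
  -- same value almost everywhere. Countably many truncations keep the null sets under control.
  let f : ℝ → F := fun t => G (⌊t⌋₊ + 1) t
  have hf : ∀ T, 0 < T → ∀ᵐ t, t ∈ Iic T → f t = G T t := by
    intro T hT
    have h1 : ∀ᵐ t, ∀ n : ℕ, t ∈ Iic (min ((n : ℝ) + 1) T) → G (n + 1) t = G T t :=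
      ae_all_iff.2 fun n => hcoh _ _ (by positivity) hT
    filter_upwards [h1] with t ht htT
    exact ht ⌊t⌋₊ (le_min (Nat.lt_floor_add_one t).le htT)
  have hfr : ∀ T, 0 < T → f =ᵐ[volume.restrict (Icc 0 T)] G T := by
    intro T hT
    refine (ae_restrict_iff' measurableSet_Icc).2 ?_
    filter_upwards [hf T hT] with t ht h2
    exact ht h2.2
  have hfloc : MemLpLoc 1 f := fun T hT => ((hG T hT).1.restrict _).ae_eq (hfr T hT).symm
  refine ⟨f, hfloc, ?_, fun T hT => ?_⟩
  · rw [lineDeriv_distrOf_eq_iff (continuousOn_memLpLoc (hψ.continuousOn_convolution hv)) hfloc]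
    intro φ hφ hφc
    obtain ⟨R, hR0, hR⟩ : ∃ R > 0, ∀ x, R < x → φ x = 0 ∧ deriv (deriv φ) x = 0 := by
      obtain ⟨R, hR⟩ := hφc.isBounded.subset_closedBall 0
      refine ⟨|R| + 1, by positivity, fun x hx => ?_⟩
      have hx' : x ∉ tsupport φ := fun h => by
        have := hR h
        rw [mem_closedBall_zero_iff, Real.norm_eq_abs] at this
        linarith [le_abs_self x, le_abs_self R]
      exact ⟨image_eq_zero_of_notMem_tsupport hx', image_eq_zero_of_notMem_tsupport fun h =>
        hx' (tsupport_deriv_subset (tsupport_deriv_subset h))⟩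
    have key := integral_deriv2_smul_eq_of_tendsto
      (continuous_conv hψ h0 (fun t _ => (memLp_one_iff_integrable.2 (hwi R hR0)).restrict _)
        (hw0 R)) (hG R hR0).1 (hDm R hR0) (hG R hR0).2 hφ hφc
    refine Eq.trans (integral_congr_ae (.of_forall fun t => ?_)) (key.trans (integral_congr_ae ?_))
    · simp only
      rcases le_or_gt t R with ht | ht
      · rw [conv_indicator_Icc h0 ht]
      · rw [(hR t ht).2, zero_smul, zero_smul]
    · filter_upwards [hf R hR0, hneg R hR0] with t h1 h2
      rcases le_or_gt t R with ht | ht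
      · rcases lt_or_ge t 0 with h3 | h3
        · rw [indicator_of_notMem (by simpa using h3), h2 h3.le]
        · rw [indicator_of_mem (mem_Ici.2 h3), h1 ht]
      · rw [(hR t ht).1, zero_smul, zero_smul]
  · have h1 : eLpNorm (w T) 1 volume = lpNormOn 1 v T :=
      eLpNorm_indicator_eq_eLpNorm_restrict measurableSet_Icc
    rw [lpNormOn, eLpNorm_congr_ae (hfr T hT), ← h1]
    have h2 : eLpNorm (G T) 1 volume ≤ c * eLpNorm (w T) 1 volume :=
      eLpNorm_le_of_tendsto (hG T hT).1.1 (fun k => (hDm T hT k).1) (hG T hT).2 fun k =>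
        eLpNorm_secondDiff_conv_le hψ h0 hc (hwi T hT) (hw0 T) (by positivity)
    exact (eLpNorm_restrict_le _ _ _ _).trans h2

end Glue

/-! ### The `L¹` norm of functionals by duality -/

section Duality

variable {U : Type*} [NormedAddCommGroup U] [NormedSpace ℂ U]

theorem exists_re_apply_ge (f : AntiDual U) {η : ℝ} (hη : 0 < η) :
    ∃ u : U, ‖u‖ ≤ 1 ∧ ‖f‖ - η ≤ (f u).re := by
  obtain ⟨x, hx, hfx⟩ := f.exists_lt_apply_of_lt_opNorm (sub_lt_self ‖f‖ hη)
  rcases eq_or_ne (f x) 0 with h0 | h0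
  · refine ⟨x, hx.le, ?_⟩
    rw [h0, norm_zero] at hfx
    rw [h0, Complex.zero_re]
    exact hfx.le
  · have hn : (‖f x‖ : ℂ) ≠ 0 := by exact_mod_cast norm_ne_zero_iff.2 h0
    -- Conjugate-linearity turns the phase of f x into its conjugate, so rotating x by this phase
    -- makes the value ‖f x‖.
    refine ⟨(f x / ‖f x‖) • x, ?_, ?_⟩
    · rw [norm_smul, norm_div, Complex.norm_real, norm_norm, div_self (norm_ne_zero_iff.2 h0),
        one_mul]
      exact hx.le
    · have : f ((f x / ‖f x‖) • x) = (‖f x‖ : ℂ) := by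
        rw [map_smulₛₗ, smul_eq_mul, map_div₀, Complex.conj_ofReal, div_mul_eq_mul_div,
          mul_comm, Complex.mul_conj, Complex.normSq_eq_norm_sq]
        field_simp
        push_cast
        ring
      rw [this, Complex.ofReal_re]
      exact hfx.le

theorem integrable_antiDual_apply {α : Type*} [MeasurableSpace α] {μ : Measure α}
    {g : α → AntiDual U} (hg : Integrable g μ) {u : α → U} (hu : StronglyMeasurable u)
    (hu1 : ∀ s, ‖u s‖ ≤ 1) : Integrable (fun s => g s (u s)) μ := by
  refine hg.mono ((pairing U).aestronglyMeasurable_comp₂ hg.1 hu.aestronglyMeasurable)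
    (.of_forall fun s => ?_)
  exact ((g s).le_opNorm (u s)).trans (mul_le_of_le_one_right (norm_nonneg _) (hu1 s))

/-- Since g is Bochner integrable, it is L¹-close to a simple function g', and almost norming
vectors need only be selected for the finitely many values of g'. The resulting u is simple, so no
measurable selection theorem and no Radon–Nikodym property enter. The error η(2 + μ(univ)) collects
2‖g - g'‖₁ and the selection error η. -/
theorem lintegral_enorm_le_of_forall {α : Type*} [MeasurableSpace α] {μ : Measure α}
    [IsFiniteMeasure μ] {g : α → AntiDual U} (hg : Integrable g μ) {c : ℝ}
    (hc : ∀ u : α → U, StronglyMeasurable u → (∀ s, ‖u s‖ ≤ 1) → ‖∫ s, g s (u s) ∂μ‖ ≤ c) :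
    ∫⁻ s, ‖g s‖ₑ ∂μ ≤ ENNReal.ofReal c := by
  rw [← ofReal_integral_norm_eq_lintegral_enorm hg]
  refine ENNReal.ofReal_le_ofReal ?_
  have key : ∀ η : ℝ, 0 < η → ∫ s, ‖g s‖ ∂μ ≤ c + η * (2 + μ.real univ) := by
    intro η hη
    obtain ⟨g', hg', hmem⟩ := (memLp_one_iff_integrable.2 hg).exists_simpleFunc_eLpNorm_sub_lt
      ENNReal.one_ne_top (ENNReal.ofReal_pos.2 hη).ne'
    have hgi : Integrable g' μ := memLp_one_iff_integrable.1 hmem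
    have hd : Integrable (fun s => g s - g' s) μ := hg.sub hgi
    have hdle : ∫ s, ‖g s - g' s‖ ∂μ ≤ η := by
      rw [eLpNorm_one_eq_lintegral_enorm] at hg'
      have e1 := ofReal_integral_norm_eq_lintegral_enorm hd
      exact (ENNReal.ofReal_le_ofReal_iff hη.le).1 (e1.le.trans hg'.le)
    choose χ hχ1 hχ using fun f : AntiDual U => exists_re_apply_ge f hη
    let u : SimpleFunc α U := g'.map χ
    have hum : StronglyMeasurable u := u.stronglyMeasurable
    have hu1 : ∀ s, ‖u s‖ ≤ 1 := fun s => hχ1 _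
    have hi1 := integrable_antiDual_apply hg hum hu1
    have hi2 := integrable_antiDual_apply hd hum hu1
    have hre : Integrable (fun s => (g s (u s)).re) μ := hi1.re
    have hle : ∀ s, ‖g s‖ ≤ (g s (u s)).re + 2 * ‖g s - g' s‖ + η := by
      intro s
      have e1 : ‖g s‖ ≤ ‖g' s‖ + ‖g s - g' s‖ := by
        have := norm_add_le (g' s) (g s - g' s)
        rwa [add_sub_cancel] at this
      have e2 : ‖g' s‖ - η ≤ (g' s (u s)).re := hχ (g' s)
      have e3 : (g' s (u s)).re = (g s (u s)).re - ((g s - g' s) (u s)).re := by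
        rw [sub_apply, Complex.sub_re]
        ring
      have e4 : -‖g s - g' s‖ ≤ ((g s - g' s) (u s)).re := by
        have h1 := ((g s - g' s).le_opNorm (u s)).trans
          (mul_le_of_le_one_right (norm_nonneg _) (hu1 s))
        exact (neg_le_neg ((Complex.abs_re_le_norm _).trans h1)).trans (neg_abs_le _)
      linarith
    calc ∫ s, ‖g s‖ ∂μ ≤ ∫ s, ((g s (u s)).re + 2 * ‖g s - g' s‖ + η) ∂μ :=
          integral_mono hg.norm ((hre.add (hd.norm.const_mul 2)).add (integrable_const η)) hle
      _ = ∫ s, (g s (u s)).re ∂μ + 2 * ∫ s, ‖g s - g' s‖ ∂μ + η * μ.real univ := by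
          rw [integral_add (f := fun s => (g s (u s)).re + 2 * ‖g s - g' s‖)
            (hre.add (hd.norm.const_mul 2)) (integrable_const η),
            integral_add hre (hd.norm.const_mul 2), integral_const_mul, integral_const,
            smul_eq_mul, mul_comm η]
      _ ≤ c + 2 * η + η * μ.real univ := by
          gcongr
          have e1 : ∫ s, (g s (u s)).re ∂μ = (∫ s, g s (u s) ∂μ).re := integral_re hi1
          rw [e1]
          exact (Complex.re_le_norm _).trans (hc u hum hu1)
      _ = _ := by ring
  have hlim : Tendsto (fun η : ℝ => c + η * (2 + μ.real univ)) (𝓝[>] 0)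
      (𝓝 (c + 0 * (2 + μ.real univ))) :=
    ((tendsto_id.mono_left nhdsWithin_le_nhds).mul_const _).const_add c
  rw [zero_mul, add_zero] at hlim
  exact ge_of_tendsto hlim (eventually_mem_nhdsWithin.mono fun η hη => key η hη)

end Duality

/-! ### Consequences of BIBO stability -/

section Stability

theorem ae_norm_indicator_Ici_le {Y : Type*} [NormedAddCommGroup Y] {f : ℝ → Y} {C : ℝ≥0}
    (hf : ∀ t : ℝ, 0 < t → lpNormOn ∞ f t ≤ C) :
    ∀ᵐ t, ‖(Ici (0 : ℝ)).indicator f t‖ ≤ C := by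
  have h1 : ∀ᵐ t, ∀ n : ℕ, t ∈ Icc (0 : ℝ) (n + 1) → ‖f t‖ₑ ≤ C := by
    refine ae_all_iff.2 fun n => (ae_restrict_iff' measurableSet_Icc).1 ?_
    have h2 := hf (n + 1) (by positivity)
    rw [lpNormOn, eLpNorm_exponent_top] at h2
    filter_upwards [ae_le_eLpNormEssSup (f := f) (μ := volume.restrict (Icc 0 ((n : ℝ) + 1)))]
      with t ht
    exact ht.trans h2
  filter_upwards [h1] with t ht
  rcases lt_or_ge t 0 with h | h
  · rw [indicator_of_notMem (by simpa using h), norm_zero]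
    exact C.2
  · rw [indicator_of_mem (mem_Ici.2 h)]
    have h3 := ht ⌊t⌋₊ ⟨h, (Nat.lt_floor_add_one t).le⟩
    rw [enorm_eq_nnnorm] at h3
    exact_mod_cast h3

variable {U X Y : Type*}
  [NormedAddCommGroup U] [NormedSpace ℂ U] [CompleteSpace U]
  [NormedAddCommGroup X] [NormedSpace ℂ X] [CompleteSpace X]
  [NormedAddCommGroup Y] [NormedSpace ℂ Y] [CompleteSpace Y] {S : SystemNode U X Y} {c : ℝ≥0}

/-- The hypothesis of BIBO stability with constant `c` bounds the second difference quotients of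
the twice integrated output. -/
theorem norm_secondDiff_conv_rampResponse_le {α : ℂ} (hα : α ∈ S.T.halfPlane)
    (hS : ∀ (u : ℝ → U) (x : ℝ → S.XExt) (y : Distr Y),
      IsGeneralisedSolution S u x y → MemLpLoc ∞ u → x 0 = 0 →
        ∃ f : ℝ → Y, MemLpLoc ∞ f ∧ y = distrOf f ∧
          ∀ t : ℝ, 0 < t → lpNormOn ∞ f t ≤ c * lpNormOn ∞ u t)
    {u : ℝ → U} (hu : StronglyMeasurable u) (hu1 : ∀ s, ‖u s‖ ≤ 1) (hu0 : ∀ r < 0, u r = 0)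
    {ε : ℝ} (hε : 0 < ε) (t : ℝ) : ‖secondDiff ε (conv (S.rampResponse hα) u) t‖ ≤ c := by
  have huinf : MemLpLoc ∞ u := fun t _ =>
    MemLp.of_bound hu.aestronglyMeasurable 1 (.of_forall hu1)
  have hu1' : MemLpLoc 1 u := huinf.mono_exponent le_top
  have h0 : ∀ s ≤ 0, S.rampResponse hα s = 0 := fun s hs => S.rampResponse_of_nonpos hα hs
  have hψ := S.strongCont_rampResponse hα
  obtain ⟨x, y, hsol, hx0⟩ := S.exists_isGeneralisedSolution hu1'
  obtain ⟨f, hf, hy, hfle⟩ := hS u x y hsol huinf hx0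
  rw [hsol.output_eq hα hx0] at hy
  have hw := (lineDeriv_distrOf_eq_iff
    (continuousOn_memLpLoc (hψ.continuousOn_convolution hu1')) (hf.mono_exponent le_top)).1 hy
  have hH : (Ici (0 : ℝ)).indicator (fun t => ∫ r in (0 : ℝ)..t, S.rampResponse hα (t - r) (u r)) =
      conv (S.rampResponse hα) u := by
    ext t
    rcases lt_or_ge t 0 with h | h
    · rw [indicator_of_notMem (by simpa using h), conv_of_nonpos h0 hu0 h.le]
    · rw [indicator_of_mem (mem_Ici.2 h), conv_eq_intervalIntegral h0 hu0 h]
  rw [hH] at hw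
  refine norm_secondDiff_le (continuous_conv hψ h0 hu1' hu0)
    (ae_norm_indicator_Ici_le fun t ht => (hfle t ht).trans ?_) hw hε t
  refine mul_le_of_le_one_right zero_le ?_
  rw [lpNormOn, eLpNorm_exponent_top]
  refine (eLpNormEssSup_le_of_ae_bound (C := 1) (.of_forall hu1)).trans ?_
  simp

/-- The functional v turns the bound on ∫ (Δ_ε Φ)(s) u(s) ds into one on the pairing of (Δ_ε Ψ)(s) v
with u(s). As u ranges over the unit ball of the bounded functions, this yields the L¹ norm over [0,
N], with a bound independent of N and ε. -/
theorem lintegral_enorm_secondDiff_rampResponse_le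
    {Sd : SystemNode (AntiDual Y) (AntiDual X) (AntiDual U)} (hD : IsDualNode S Sd)
    (hS : ∀ (u : ℝ → U) (x : ℝ → S.XExt) (y : Distr Y),
      IsGeneralisedSolution S u x y → MemLpLoc ∞ u → x 0 = 0 →
        ∃ f : ℝ → Y, MemLpLoc ∞ f ∧ y = distrOf f ∧
          ∀ t : ℝ, 0 < t → lpNormOn ∞ f t ≤ c * lpNormOn ∞ u t)
    {ε : ℝ} (hε : 0 < ε) (v : AntiDual Y) :
    ∫⁻ s, ‖secondDiff ε (Sd.rampResponse Sd.β_mem) s v‖ₑ ≤ c * ‖v‖ₑ := by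
  set Ψ := secondDiff ε (Sd.rampResponse Sd.β_mem)
  set Φ := secondDiff ε (S.rampResponse hD.conj_mem)
  have h0 : ∀ s ≤ 0, S.rampResponse hD.conj_mem s = 0 :=
    fun s hs => S.rampResponse_of_nonpos _ hs
  have hψ := S.strongCont_rampResponse hD.conj_mem
  have hΦ0 : ∀ s ≤ 0, Φ s = 0 := fun s hs => secondDiff_of_nonpos h0 hε.le hs
  have hΨ0 : ∀ s ≤ 0, Ψ s = 0 := fun s hs =>
    secondDiff_of_nonpos (fun s hs => Sd.rampResponse_of_nonpos _ hs) hε.le hs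
  have hdual : ∀ s u, Ψ s v u = v (Φ s u) := by
    intro s u
    simp [Ψ, Φ, secondDiff, hD.rampResponse_apply, ← Complex.coe_smul,
      show (starRingEnd ℂ) 2 = 2 from map_ofNat _ 2]
  have hΨc : Continuous fun s => Ψ s v :=
    ((Sd.strongCont_rampResponse Sd.β_mem).secondDiff ε).continuous_apply v
  have hloc : ∀ N : ℝ, 0 ≤ N → ∫⁻ s in Icc 0 N, ‖Ψ s v‖ₑ ≤ c * ‖v‖ₑ := by
    intro N hN
    have e1 : (c : ℝ≥0∞) * ‖v‖ₑ = ENNReal.ofReal (c * ‖v‖) := by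
      rw [ENNReal.ofReal_mul NNReal.zero_le_coe, ENNReal.ofReal_coe_nnreal, ofReal_norm]
    rw [e1]
    refine lintegral_enorm_le_of_forall hΨc.integrableOn_Icc fun u hum hu1 => ?_
    -- Reversing time on [0, N] makes the convolution at time N the plain integral of Φ(s) u(s) over
    -- [0, N].
    let w : ℝ → U := (Icc 0 N).indicator fun r => u (N - r)
    have hwm : StronglyMeasurable w :=
      (hum.comp_measurable (measurable_const.sub measurable_id)).indicator measurableSet_Icc
    have hw1 : ∀ s, ‖w s‖ ≤ 1 := fun s => (norm_indicator_le_norm_self _ _).trans (hu1 _)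
    have hw0 : ∀ r < 0, w r = 0 := indicator_Icc_of_neg _ N
    have hwloc : MemLpLoc 1 w := MemLpLoc.mono_exponent (p := ∞) le_top fun t _ =>
      MemLp.of_bound hwm.aestronglyMeasurable 1 (.of_forall hw1)
    have hwi : Integrable w := by
      have h1 := integrable_indicator_Icc hwloc (show 0 < N + 1 by positivity)
      refine h1.congr (.of_forall fun r => ?_)
      by_cases hr : r ∈ Icc 0 (N + 1)
      · rw [indicator_of_mem hr]
      · rw [indicator_of_notMem hr, show w r = 0 from
          indicator_of_notMem (fun h => hr ⟨h.1, h.2.trans (by linarith)⟩) _]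
    have e2 : conv Φ w N = ∫ s in 0..N, Φ s (u s) := by
      have h1 := intervalIntegral.integral_comp_sub_left (a := 0) (b := N) (fun s => Φ s (u s)) N
      rw [sub_self, sub_zero] at h1
      rw [conv_eq_intervalIntegral hΦ0 hw0 hN, ← h1]
      refine intervalIntegral.integral_congr fun r hr => ?_
      rw [uIcc_of_le hN] at hr
      simp only [w, indicator_of_mem hr]
    have hint : IntervalIntegrable (fun s => Φ s (u s)) volume 0 N := by
      have hu : IntervalIntegrable u volume 0 N :=
        (MemLp.of_bound (p := 1) hum.aestronglyMeasurable 1 (.of_forall hu1)).integrable le_rfl |>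
          (intervalIntegrable_iff_integrableOn_Ioc_of_le hN).2
      simpa using ((hψ.secondDiff ε).comp_real (f := fun t => -t)
        continuous_neg).intervalIntegrable hu 0
    have e3 : ∫ s in Icc 0 N, Ψ s v (u s) = v (conv Φ w N) := by
      rw [e2, antiDual_apply_intervalIntegral v hint, intervalIntegral.integral_of_le hN,
        integral_Icc_eq_integral_Ioc]
      simp only [hdual]
    rw [e3, conv_secondDiff hψ h0 hwi hw0, mul_comm]
    refine (v.le_opNorm _).trans (mul_le_mul_of_nonneg_left ?_ (norm_nonneg _))
    exact norm_secondDiff_conv_rampResponse_le hD.conj_mem hS hwm hw1 hw0 hε N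
  -- Passage to N → ∞; the integrand vanishes for s ≤ 0, so (-∞, N] contributes no more than [0, N].
  have hcov := (aecover_Iic (μ := volume) (tendsto_id (α := ℝ) (x := atTop))
    ).lintegral_tendsto_of_countably_generated (f := fun s => ‖Ψ s v‖ₑ)
      hΨc.enorm.measurable.aemeasurable
  refine le_of_tendsto hcov ?_
  filter_upwards [eventually_ge_atTop 0] with N hN
  refine le_trans (le_of_eq ?_) (hloc N hN)
  rw [← lintegral_indicator measurableSet_Iic, ← lintegral_indicator measurableSet_Icc]
  congr 1
  ext s
  rcases lt_or_ge s 0 with h | h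
  · have : ‖Ψ s v‖ₑ = 0 := by
      rw [hΨ0 s h.le]
      exact enorm_zero (E := AntiDual U)
    simp [indicator, this]
  · simp [indicator, h]

theorem LinftyBIBOStable.l1LILOStable_dual (hS : LinftyBIBOStable S)
    {Sd : SystemNode (AntiDual Y) (AntiDual X) (AntiDual U)} (hD : IsDualNode S Sd) :
    L1LILOStable Sd := by
  obtain ⟨c, hc, hS⟩ := hS
  refine ⟨c, hc, fun v x y hsol hv hx0 => ?_⟩
  obtain ⟨f, hf, hfy, hfle⟩ := exists_deriv2_conv (Sd.strongCont_rampResponse Sd.β_mem)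
    (fun s hs => Sd.rampResponse_of_nonpos _ hs)
    (fun ε hε e => lintegral_enorm_secondDiff_rampResponse_le hD hS hε e) hv
  exact ⟨f, hf, (hsol.output_eq Sd.β_mem hx0).trans hfy, hfle⟩

end Stability

end LinSys

end

/-! ### The main theorem -/

theorem mainTheorem1 {U X Y : Type*}
    [NormedAddCommGroup U] [NormedSpace ℂ U] [CompleteSpace U]
    [NormedAddCommGroup X] [NormedSpace ℂ X] [CompleteSpace X]
    [NormedAddCommGroup Y] [NormedSpace ℂ Y] [CompleteSpace Y]
    (S : LinSys.SystemNode U X Y)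
    (hS : LinSys.LinftyBIBOStable S)
    (hA : ∃ T' : LinSys.C0Semigroup (LinSys.AntiDual X), T'.generator = LinSys.adjoint S.A) :
    (∃ Sd : LinSys.SystemNode (LinSys.AntiDual Y) (LinSys.AntiDual X) (LinSys.AntiDual U),
      LinSys.IsDualNode S Sd) ∧
    ∀ Sd : LinSys.SystemNode (LinSys.AntiDual Y) (LinSys.AntiDual X) (LinSys.AntiDual U),
      LinSys.IsDualNode S Sd → LinSys.L1LILOStable Sd := by
  obtain ⟨T', h⟩ := hA
  exact ⟨⟨LinSys.dualNode S h, LinSys.isDualNode_dualNode S h⟩, fun Sd hD =>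
    hS.l1LILOStable_dual hD⟩
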